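/- Let $\ell\ge 3$ be an integer. Partitions are identified with their Young diagrams (English notation), $(a,b)$ is the box in row $a$ and column $b$ ($a,b\ge 1$), and its residue is $b-a \bmod \ell$. A partition is $\ell$-regular if no part occurs $\ell$ or more times. The ladders are the sets $\{(a,b): a,b\ge 1,\ a+(\ell-1)b=c\}$, $c$ constant; they are ordered from left to right by increasing $c$, and all boxes of a ladder have the same residue. Signatures. Fix a partition $\lambda$ and $i\in\mathbb{Z}/\ell\mathbb{Z}$. Mark each addable box of residue $i$ with $+$ and each removable box of residue $i$ with $-$. The $i$-signature is the word of these signs read row by row from the bottom row to the top row; the ladder $i$-signature is the word read from the leftmost to the rightmost ladder, and on each ladder from top to bottom. Cancelling adjacent pairs $-+$ as long as possible gives a reduced word $+\cdots+-\cdots-$. Let $\varepsilon_i(\lambda),\varphi_i(\lambda)$ be the numbers of $-$'s and $+$'s in the reduced $i$-signature; $\tilde e_i\lambda$ removes the box of its leftmost $-$, and $\tilde f_i\lambda$ adds the box of its rightmost $+$ (the value is $0$ if there is no such sign). Define $\widehat\varepsilon_i,\widehat\varphi_i,\widehat e_i,\widehat f_i$ in the same way from the ladder $i$-signature. The weight of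 $\lambda$ is $\Lambda_0-\sum_i c_i\alpha_i$, where $c_i$ is the number of boxes of $\lambda$ of residue $i$, in the weight lattice of $\widehat{\mathfrak{sl}}_\ell$. Crystals. $B(\Lambda_0)$ is the Misra–Miwa crystal: its nodes are the $\ell$-regular partitions, with $\tilde e_i,\tilde f_i,\varepsilon_i,\varphi_i$ and the weight. The ladder crystal $B(\Lambda_0)^L$ has as nodes the partitions obtained from $\emptyset$ by applying operators $\widehat f_i$, with $\widehat e_i,\widehat f_i,\widehat\varepsilon_i,\widehat\varphi_i$ and the weight. Regularization. $\mathcal{R}\lambda$ is the partition obtained from $\lambda$ by moving all boxes to the top of their ladders; $\mathcal{R}0=0$. Deregularization. The locked boxes of $\lambda$ are the smallest set of boxes of $\lambda$ such that: (I) a box $x$ is locked if it lies in the first row or has a locked box directly above it, and every unoccupied position of the ladder of $x$ below $x$ has an unoccupied position directly above it; (II) every box to the left of a locked box in the same row is locked. $\mathcal{S}\lambda$ is obtained from $\lambda$ by keeping the locked boxes and moving the unlocked boxes of each ladder to the lowest positions of that ladder not taken by locked boxes. Theorem. (1) For every node $\lambda$ of $B(\Lambda_0)^L$ and every $i$, $\mathcal{R}(\widehat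 f_i\lambda)=\tilde f_i(\mathcal{R}\lambda)$ and $\mathcal{R}(\widehat e_i\lambda)=\tilde e_i(\mathcal{R}\lambda)$. (2) $B(\Lambda_0)^L$ and $B(\Lambda_0)$ are crystals (they satisfy Kashiwara's axioms for $\widehat{\mathfrak{sl}}_\ell$; in particular their operators map nodes to nodes or $0$), and $\mathcal{R}$ restricts to an isomorphism of crystals $B(\Lambda_0)^L\to B(\Lambda_0)$, that is, to a bijection of the nodes which commutes with the operators $e_i,f_i$ and preserves $\varepsilon_i$, $\varphi_i$ and the weight. (3) For every $\ell$-regular $\mu$, $\mathcal{S}\mu$ is a partition, and $\mathcal{S}:B(\Lambda_0)\to B(\Lambda_0)^L$ is an isomorphism of crystals inverse to $\mathcal{R}$. -/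

import Mathlib

/-!
Partitions are Mathlib's `YoungDiagram`s in English notation.  Boxes are pairs `(row, column)`
counted from `0`, so the box `(0, 0)` is the top left corner.  The value `none` of an operator
plays the role of `0` in the theory of crystals.
-/

namespace LadderCrystal

/-- No part of the partition occurs `ℓ` or more times. -/
def IsRegular (ℓ : ℕ) (μ : YoungDiagram) : Prop :=
  ∀ k : ℕ, μ.rowLens.count k < ℓ

/-- The residue of a box: column minus row, modulo `ℓ`. -/
def residue (ℓ : ℕ) (p : ℕ × ℕ) : ZMod ℓ :=
  (p.2 : ZMod ℓ) - (p.1 : ZMod ℓ)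

/-- A set of boxes, viewed as a partition if it is one. -/
noncomputable def ofBoxes (s : Finset (ℕ × ℕ)) : Option YoungDiagram :=
  open Classical in
  if h : IsLowerSet (s : Set (ℕ × ℕ)) then some ⟨s, h⟩ else none

def Addable (μ : YoungDiagram) (p : ℕ × ℕ) : Prop :=
  p ∉ μ ∧ IsLowerSet ((insert p μ.cells : Finset (ℕ × ℕ)) : Set (ℕ × ℕ))

def Removable (μ : YoungDiagram) (p : ℕ × ℕ) : Prop :=
  p ∈ μ ∧ IsLowerSet ((μ.cells.erase p : Finset (ℕ × ℕ)) : Set (ℕ × ℕ))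

/-! ### Signatures -/

inductive Sign where
  | plus : Sign
  | minus : Sign

/-- The word of signs obtained by reading the given positions in order, writing a `+` for each
addable `i`-box and a `-` for each removable `i`-box.  Each sign carries its box. -/
noncomputable def signature (ℓ : ℕ) (i : ZMod ℓ) (μ : YoungDiagram)
    (positions : List (ℕ × ℕ)) : List (Sign × (ℕ × ℕ)) :=
  open Classical in
  positions.filterMap fun p =>
    if Addable μ p ∧ residue ℓ p = i then some (Sign.plus, p)
    else if Removable μ p ∧ residue ℓ p = i then some (Sign.minus, p)
    else none

/-- Cancel adjacent pairs `-+` until none is left (so that the word is `+ ⋯ + - ⋯ -`).  Scanning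
from the right, a `-` is cancelled against the first letter of the reduced word on its right
if that letter is a `+`. -/
def reduceWord : List (Sign × (ℕ × ℕ)) → List (Sign × (ℕ × ℕ))
  | [] => []
  | (Sign.plus, p) :: w => (Sign.plus, p) :: reduceWord w
  | (Sign.minus, p) :: w =>
    match reduceWord w with
    | (Sign.plus, _) :: w' => w'
    | w' => (Sign.minus, p) :: w'

/-- The boxes of the `-`'s in the reduced word, in order. -/
def normalBoxes (w : List (Sign × (ℕ × ℕ))) : List (ℕ × ℕ) :=
  (reduceWord w).filterMap fun s =>
    match s with
    | (Sign.minus, p) => some p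
    | (Sign.plus, _) => none

/-- The boxes of the `+`'s in the reduced word, in order. -/
def conormalBoxes (w : List (Sign × (ℕ × ℕ))) : List (ℕ × ℕ) :=
  (reduceWord w).filterMap fun s =>
    match s with
    | (Sign.plus, p) => some p
    | (Sign.minus, _) => none

/-- Remove the good box, i.e. the box of the leftmost `-` of the reduced signature. -/
noncomputable def removeGood (ℓ : ℕ) (reading : YoungDiagram → List (ℕ × ℕ)) (i : ZMod ℓ)
    (μ : YoungDiagram) : Option YoungDiagram :=
  (normalBoxes (signature ℓ i μ (reading μ))).head?.bind fun p => ofBoxes (μ.cells.erase p)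

/-- Add the cogood box, i.e. the box of the rightmost `+` of the reduced signature. -/
noncomputable def addCogood (ℓ : ℕ) (reading : YoungDiagram → List (ℕ × ℕ)) (i : ZMod ℓ)
    (μ : YoungDiagram) : Option YoungDiagram :=
  (conormalBoxes (signature ℓ i μ (reading μ))).getLast?.bind fun p =>
    ofBoxes (insert p μ.cells)

/-- Reading from bottom left to top right: row by row, the bottom row first.  All addable and
removable boxes of `μ` are among the listed positions. -/
def rowReading (μ : YoungDiagram) : List (ℕ × ℕ) :=
  (List.range (μ.card + 1)).reverse ×ˢ List.range (μ.card + 1)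

/-! ### Ladders -/

/-- The number of the ladder of a position; ladders are numbered from left to right.
Two positions are on the same ladder iff one is obtained from the other by
moving `m (ℓ - 1)` rows up and `m` columns to the right, for some integer `m`. -/
def ladderIndex (ℓ : ℕ) (p : ℕ × ℕ) : ℕ :=
  p.1 + (ℓ - 1) * p.2

/-- The set of all positions on ladder number `k` (for `2 ≤ ℓ`). -/
def ladder (ℓ k : ℕ) : Finset (ℕ × ℕ) :=
  (Finset.range (k + 1) ×ˢ Finset.range (k + 1)).filter fun p => ladderIndex ℓ p = k

/-- Reading from the leftmost to the rightmost ladder, each ladder from top to bottom.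
All addable and removable boxes of `μ` are among the listed positions. -/
def ladderReading (ℓ : ℕ) (μ : YoungDiagram) : List (ℕ × ℕ) :=
  (List.range (ℓ * μ.card + 1)).flatMap fun k =>
    (List.range (k + 1) ×ˢ List.range (k + 1)).filter fun p => ladderIndex ℓ p = k

/-! ### Crystals -/

/-- The weight lattice `⨁ᵢ ℤ Λᵢ ⊕ ℤ δ` of the affine Lie algebra `ŝl_ℓ`:
the coefficients of the `Λᵢ`, and the coefficient of `δ`. -/
abbrev Weight (ℓ : ℕ) : Type := (ZMod ℓ → ℤ) × ℤ

/-- The pairing `⟨hᵢ, w⟩` with a simple coroot. -/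
def Weight.pairing {ℓ : ℕ} (i : ZMod ℓ) (w : Weight ℓ) : ℤ := w.1 i

/-- The fundamental weight `Λ₀`. -/
def fundamentalWeight (ℓ : ℕ) : Weight ℓ := (Pi.single 0 1, 0)

/-- The entry `⟨hᵢ, αⱼ⟩` of the Cartan matrix of type `A_{ℓ-1}^{(1)}` (for `3 ≤ ℓ`). -/
def cartan (ℓ : ℕ) (i j : ZMod ℓ) : ℤ :=
  if i = j then 2 else if i = j + 1 ∨ j = i + 1 then -1 else 0

/-- The simple root `αⱼ = ∑ᵢ ⟨hᵢ, αⱼ⟩ Λᵢ + δ_{j0} δ`. -/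
def simpleRoot (ℓ : ℕ) (j : ZMod ℓ) : Weight ℓ :=
  (fun i => cartan ℓ i j, if j = 0 then 1 else 0)

/-- `Λ₀ - ∑ᵢ cᵢ αᵢ`, where `cᵢ` is the number of boxes of residue `i`. -/
def weight (ℓ : ℕ) (μ : YoungDiagram) : Weight ℓ :=
  fundamentalWeight ℓ - ∑ p ∈ μ.cells, simpleRoot ℓ (residue ℓ p)

/-- The data of a crystal of type `A_{ℓ-1}^{(1)}` whose nodes are partitions.  Only the values
at nodes matter. -/
structure CrystalData (ℓ : ℕ) where
  node : Set YoungDiagram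
  e : ZMod ℓ → YoungDiagram → Option YoungDiagram
  f : ZMod ℓ → YoungDiagram → Option YoungDiagram
  ε : ZMod ℓ → YoungDiagram → ℕ
  φ : ZMod ℓ → YoungDiagram → ℕ
  wt : YoungDiagram → Weight ℓ

/-- Kashiwara's axioms for a crystal (with finite `ε` and `φ`). -/
structure IsCrystal {ℓ : ℕ} (C : CrystalData ℓ) : Prop where
  e_mem : ∀ i, ∀ x ∈ C.node, ∀ y, C.e i x = some y → y ∈ C.node
  f_mem : ∀ i, ∀ x ∈ C.node, ∀ y, C.f i x = some y → y ∈ C.node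
  e_iff_f : ∀ i, ∀ x ∈ C.node, ∀ y ∈ C.node, C.e i x = some y ↔ C.f i y = some x
  wt_e : ∀ i, ∀ x ∈ C.node, ∀ y, C.e i x = some y → C.wt y = C.wt x + simpleRoot ℓ i
  ε_e : ∀ i, ∀ x ∈ C.node, ∀ y, C.e i x = some y → C.ε i x = C.ε i y + 1
  φ_e : ∀ i, ∀ x ∈ C.node, ∀ y, C.e i x = some y → C.φ i y = C.φ i x + 1
  wt_f : ∀ i, ∀ x ∈ C.node, ∀ y, C.f i x = some y → C.wt y = C.wt x - simpleRoot ℓ i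
  ε_f : ∀ i, ∀ x ∈ C.node, ∀ y, C.f i x = some y → C.ε i y = C.ε i x + 1
  φ_f : ∀ i, ∀ x ∈ C.node, ∀ y, C.f i x = some y → C.φ i x = C.φ i y + 1
  φ_eq : ∀ i, ∀ x ∈ C.node, (C.φ i x : ℤ) = C.ε i x + (C.wt x).pairing i

/-- `Ψ` is an isomorphism from the crystal `C` to the crystal `D`. -/
structure IsCrystalIso {ℓ : ℕ} (C D : CrystalData ℓ) (Ψ : YoungDiagram → YoungDiagram) :
    Prop where
  bijOn : Set.BijOn Ψ C.node D.node
  map_e : ∀ i, ∀ x ∈ C.node, (C.e i x).map Ψ = D.e i (Ψ x)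
  map_f : ∀ i, ∀ x ∈ C.node, (C.f i x).map Ψ = D.f i (Ψ x)
  map_ε : ∀ i, ∀ x ∈ C.node, D.ε i (Ψ x) = C.ε i x
  map_φ : ∀ i, ∀ x ∈ C.node, D.φ i (Ψ x) = C.φ i x
  map_wt : ∀ x ∈ C.node, D.wt (Ψ x) = C.wt x

/-- The crystal data with the given nodes that arises from a reading order of the boxes:
`e` removes the good box, `f` adds the cogood box, `ε` and `φ` count the normal and the
conormal boxes. -/
noncomputable def crystalOfReading (ℓ : ℕ) (node : Set YoungDiagram)
    (reading : YoungDiagram → List (ℕ × ℕ)) : CrystalData ℓ where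
  node := node
  e := removeGood ℓ reading
  f := addCogood ℓ reading
  ε := fun i μ => (normalBoxes (signature ℓ i μ (reading μ))).length
  φ := fun i μ => (conormalBoxes (signature ℓ i μ (reading μ))).length
  wt := weight ℓ

/-- The Misra–Miwa model of `B(Λ₀)`; the nodes are the `ℓ`-regular partitions. -/
noncomputable def misraMiwaCrystal (ℓ : ℕ) : CrystalData ℓ :=
  crystalOfReading ℓ {μ | IsRegular ℓ μ} rowReading

/-- The partitions obtained from the empty one by applying the ladder operators `f̂ᵢ`. -/
inductive LadderNode (ℓ : ℕ) : YoungDiagram → Prop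
  | empty : LadderNode ℓ ⊥
  | step (i : ZMod ℓ) (μ ν : YoungDiagram) :
      LadderNode ℓ μ → addCogood ℓ (ladderReading ℓ) i μ = some ν → LadderNode ℓ ν

/-- The ladder crystal `B(Λ₀)^L`. -/
noncomputable def ladderCrystal (ℓ : ℕ) : CrystalData ℓ :=
  crystalOfReading ℓ {μ | LadderNode ℓ μ} (ladderReading ℓ)

/-! ### Regularization -/

/-- The `m` highest positions of a set of positions on a ladder. -/
def highest (s : Finset (ℕ × ℕ)) (m : ℕ) : Finset (ℕ × ℕ) :=
  s.filter fun p => (s.filter fun q => q.1 < p.1).card < m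

/-- The `m` lowest positions of a set of positions on a ladder. -/
def lowest (s : Finset (ℕ × ℕ)) (m : ℕ) : Finset (ℕ × ℕ) :=
  s.filter fun p => (s.filter fun q => p.1 < q.1).card < m

/-- The boxes from `s` on ladder number `k`. -/
def onLadder (ℓ : ℕ) (s : Finset (ℕ × ℕ)) (k : ℕ) : Finset (ℕ × ℕ) :=
  s.filter fun p => ladderIndex ℓ p = k

/-- Move all boxes of `μ` to the top of their ladders. -/
def regBoxes (ℓ : ℕ) (μ : YoungDiagram) : Finset (ℕ × ℕ) :=
  (μ.cells.image (ladderIndex ℓ)).biUnion fun k =>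
    highest (ladder ℓ k) (onLadder ℓ μ.cells k).card

theorem mem_ladder {ℓ : ℕ} (hℓ : 3 ≤ ℓ) (k : ℕ) (p : ℕ × ℕ) :
    p ∈ ladder ℓ k ↔ ladderIndex ℓ p = k := by
  obtain ⟨a, b⟩ := p
  rw [ladder, Finset.mem_filter, Finset.mem_product, Finset.mem_range, Finset.mem_range,
    and_iff_right_iff_imp]
  simp only [ladderIndex]
  intro h
  have : b ≤ (ℓ - 1) * b := Nat.le_mul_of_pos_left _ (by omega)
  omega

theorem mem_onLadder (ℓ : ℕ) (μ : YoungDiagram) (k : ℕ) (p : ℕ × ℕ) :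
    p ∈ onLadder ℓ μ.cells k ↔ p ∈ μ ∧ ladderIndex ℓ p = k := by
  rw [onLadder, Finset.mem_filter, YoungDiagram.mem_cells]

theorem card_above {ℓ : ℕ} (hℓ : 3 ≤ ℓ) (a b : ℕ) :
    ((ladder ℓ (ladderIndex ℓ (a, b))).filter fun q => q.1 < a).card = a / (ℓ - 1) := by
  have hd : 0 < ℓ - 1 := by omega
  rw [← Finset.card_range (a / (ℓ - 1))]
  symm
  refine Finset.card_bij (fun j _ => (a - (ℓ - 1) * (j + 1), b + (j + 1))) ?_ ?_ ?_
  · intro j hj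
    have hj' : j + 1 ≤ a / (ℓ - 1) := by simpa using hj
    have h1 : (ℓ - 1) * (j + 1) ≤ a := by
      rw [mul_comm]; exact (Nat.le_div_iff_mul_le hd).1 hj'
    have h2 : 0 < (ℓ - 1) * (j + 1) := by positivity
    rw [Finset.mem_filter, mem_ladder hℓ]
    simp only [ladderIndex]
    refine ⟨?_, by omega⟩
    rw [mul_add (ℓ - 1) b (j + 1)]
    omega
  · intro j _ j' _ h
    simp only [Prod.mk.injEq] at h
    omega
  · rintro ⟨c, d⟩ hq
    rw [Finset.mem_filter, mem_ladder hℓ] at hq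
    simp only [ladderIndex] at hq
    obtain ⟨hk, hc⟩ := hq
    have hbd : b < d := by
      by_contra hle
      have := Nat.mul_le_mul_left (ℓ - 1) (not_lt.1 hle)
      omega
    obtain ⟨j, rfl⟩ := Nat.exists_eq_add_of_lt hbd
    have h3 : (ℓ - 1) * (b + j + 1) = (ℓ - 1) * b + (ℓ - 1) * (j + 1) := by ring
    have h4 : (j + 1) * (ℓ - 1) ≤ a := by
      rw [mul_comm]; omega
    have h5 := (Nat.le_div_iff_mul_le hd).2 h4
    refine ⟨j, by simpa using h5, ?_⟩
    simp only [Prod.mk.injEq]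
    constructor
    · omega
    · omega

theorem mem_regBoxes {ℓ : ℕ} (hℓ : 3 ≤ ℓ) (μ : YoungDiagram) (a b : ℕ) :
    (a, b) ∈ regBoxes ℓ μ ↔
      a / (ℓ - 1) < (onLadder ℓ μ.cells (ladderIndex ℓ (a, b))).card := by
  rw [← card_above hℓ a b]
  simp only [regBoxes, Finset.mem_biUnion, highest, Finset.mem_filter, mem_ladder hℓ]
  constructor
  · rintro ⟨k, _, rfl, h⟩
    exact h
  · intro h
    refine ⟨_, ?_, rfl, h⟩
    obtain ⟨q, hq⟩ := Finset.card_pos.1 (lt_of_le_of_lt (Nat.zero_le _) h)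
    rw [onLadder, Finset.mem_filter] at hq
    exact Finset.mem_image.2 ⟨q, hq.1, hq.2⟩

theorem regBoxes_left {ℓ : ℕ} (hℓ : 3 ≤ ℓ) (μ : YoungDiagram) (a b : ℕ)
    (h : (a, b + 1) ∈ regBoxes ℓ μ) : (a, b) ∈ regBoxes ℓ μ := by
  rw [mem_regBoxes hℓ] at h ⊢
  by_cases hfull : ∀ p ∈ ladder ℓ (ladderIndex ℓ (a, b)), p ∈ μ
  · rw [← card_above hℓ a b]
    apply Finset.card_lt_card
    rw [Finset.ssubset_iff_of_subset]
    · refine ⟨(a, b), ?_, by simp⟩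
      rw [mem_onLadder]
      exact ⟨hfull _ ((mem_ladder hℓ _ _).2 rfl), rfl⟩
    · intro q hq
      rw [Finset.mem_filter] at hq
      rw [mem_onLadder]
      exact ⟨hfull _ hq.1, (mem_ladder hℓ _ _).1 hq.1⟩
  · push Not at hfull
    obtain ⟨⟨a₀, b₀⟩, hl, hn⟩ := hfull
    rw [mem_ladder hℓ] at hl
    refine lt_of_lt_of_le h ?_
    simp only [ladderIndex, mul_add, mul_one] at hl ⊢
    have key : ∀ c d : ℕ, (c, d) ∈ μ → c + (ℓ - 1) * d = a + ((ℓ - 1) * b + (ℓ - 1)) →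
        d ≤ b₀ → ℓ - 1 ≤ c := by
      intro c d hcd hk hd
      by_contra hc
      have h1 := Nat.mul_le_mul_left (ℓ - 1) hd
      omega
    refine Finset.card_le_card_of_injOn
      (fun q => if b₀ < q.2 then (q.1, q.2 - 1) else (q.1 - (ℓ - 1), q.2)) ?_ ?_
    · rintro ⟨c, d⟩ hq
      simp only [Finset.mem_coe, mem_onLadder, ladderIndex] at hq ⊢
      obtain ⟨hm, hk⟩ := hq
      split_ifs with hd
      · obtain ⟨d, rfl⟩ : ∃ d', d = d' + 1 := ⟨d - 1, by omega⟩
        refine ⟨μ.up_left_mem le_rfl (by simp) hm, ?_⟩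
        rw [mul_add, mul_one] at hk
        simp only [Nat.add_sub_cancel]
        omega
      · have := key c d hm hk (by omega)
        refine ⟨μ.up_left_mem (by simp) le_rfl hm, ?_⟩
        simp only
        omega
    · rintro ⟨c, d⟩ hq ⟨c', d'⟩ hq' he
      simp only [Finset.mem_coe, mem_onLadder, ladderIndex] at hq hq' he
      have hdd : d = d' := by
        split_ifs at he with h1 h2 h2 <;> simp only [Prod.mk.injEq] at he
        · omega
        · exfalso
          have e : d' = b₀ := by omega
          subst e
          have := key c' d' hq'.1 hq'.2 le_rfl
          exact hn (μ.up_left_mem (by omega) le_rfl hq'.1)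
        · exfalso
          have e : d = b₀ := by omega
          subst e
          have := key c d hq.1 hq.2 le_rfl
          exact hn (μ.up_left_mem (by omega) le_rfl hq.1)
        · omega
      subst hdd
      simp only [Prod.mk.injEq, and_true]
      omega

theorem regBoxes_up {ℓ : ℕ} (hℓ : 3 ≤ ℓ) (μ : YoungDiagram) (a b : ℕ)
    (h : (a + 1, b) ∈ regBoxes ℓ μ) : (a, b) ∈ regBoxes ℓ μ := by
  rw [mem_regBoxes hℓ] at h ⊢
  have hd : 0 < ℓ - 1 := by omega
  set s := onLadder ℓ μ.cells (ladderIndex ℓ (a + 1, b)) with hs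
  set t := onLadder ℓ μ.cells (ladderIndex ℓ (a, b)) with ht
  have hst : (s.filter fun q => 0 < q.1).card ≤ t.card := by
    refine Finset.card_le_card_of_injOn (fun q => (q.1 - 1, q.2)) ?_ ?_
    · rintro ⟨c, d⟩ hq
      simp only [hs, ht, Finset.mem_coe, Finset.mem_filter, mem_onLadder, ladderIndex] at hq ⊢
      exact ⟨μ.up_left_mem (by simp) le_rfl hq.1.1, by omega⟩
    · rintro ⟨c, d⟩ hq ⟨c', d'⟩ hq' he
      simp only [Finset.mem_coe, Finset.mem_filter, Prod.mk.injEq] at hq hq' he ⊢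
      omega
  by_cases h0 : ∃ d, (0, d) ∈ s
  · obtain ⟨d, hd0⟩ := h0
    have hk : (ℓ - 1) * d = a + 1 + (ℓ - 1) * b := by
      have := (Finset.mem_filter.1 hd0).2
      simpa [ladderIndex] using this
    have hdvd : (ℓ - 1) ∣ a + 1 :=
      (Nat.dvd_add_left (Dvd.intro b rfl)).1 (hk ▸ Dvd.intro d rfl)
    have hdiv : (a + 1) / (ℓ - 1) = a / (ℓ - 1) + 1 := Nat.succ_div_of_dvd hdvd
    have hsub : s.erase (0, d) ⊆ s.filter fun q => 0 < q.1 := by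
      rintro ⟨c, d'⟩ hq
      rw [Finset.mem_erase] at hq
      refine Finset.mem_filter.2 ⟨hq.2, ?_⟩
      by_contra hc
      have hc0 : c = 0 := by simpa using hc
      subst hc0
      have hk' : (ℓ - 1) * d' = a + 1 + (ℓ - 1) * b := by
        have := (Finset.mem_filter.1 hq.2).2
        simpa [ladderIndex] using this
      have : d' = d := Nat.eq_of_mul_eq_mul_left hd (hk'.trans hk.symm)
      exact hq.1 (by rw [this])
    have h1 := Finset.card_le_card hsub
    rw [Finset.card_erase_of_mem hd0] at h1
    omega
  · have hall : (s.filter fun q => 0 < q.1) = s := by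
      refine Finset.filter_true_of_mem ?_
      rintro ⟨c, d⟩ hq
      by_contra hc
      have hc0 : c = 0 := by simpa using hc
      exact h0 ⟨d, hc0 ▸ hq⟩
    rw [hall] at hst
    have := Nat.div_le_div_right (c := ℓ - 1) (Nat.le_succ a)
    simp only [Nat.succ_eq_add_one] at this
    omega

theorem regBoxes_isLowerSet {ℓ : ℕ} (hℓ : 3 ≤ ℓ) (μ : YoungDiagram) :
    IsLowerSet (regBoxes ℓ μ : Set (ℕ × ℕ)) := by
  rintro ⟨a, b⟩ ⟨c, d⟩ ⟨hca, hdb⟩ h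
  simp only [Finset.mem_coe] at h ⊢
  obtain ⟨m, rfl⟩ := Nat.exists_eq_add_of_le hca
  obtain ⟨n, rfl⟩ := Nat.exists_eq_add_of_le hdb
  have hrow : ∀ m, (c + m, d + n) ∈ regBoxes ℓ μ → (c, d + n) ∈ regBoxes ℓ μ := by
    intro m
    induction m with
    | zero => exact id
    | succ m ih => exact fun h => ih (regBoxes_up hℓ μ _ _ h)
  have hcol : ∀ n, (c, d + n) ∈ regBoxes ℓ μ → (c, d) ∈ regBoxes ℓ μ := by
    intro n
    induction n with
    | zero => exact id
    | succ n ih => exact fun h => ih (regBoxes_left hℓ μ _ _ h)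
  exact hcol n (hrow m h)

/-- The regularization `𝓡 μ`. -/
def regularization (ℓ : ℕ) (hℓ : 3 ≤ ℓ) (μ : YoungDiagram) : YoungDiagram :=
  ⟨regBoxes ℓ μ, regBoxes_isLowerSet hℓ μ⟩

/-! ### Deregularization -/

/-- Every unoccupied position on the ladder of `p`, lying below `p`, has an unoccupied position
directly above it. -/
def NoRoomBelow (ℓ : ℕ) (μ : YoungDiagram) (p : ℕ × ℕ) : Prop :=
  ∀ c d : ℕ, ladderIndex ℓ (c, d) = ladderIndex ℓ p → p.1 < c → (c, d) ∉ μ → (c - 1, d) ∉ μ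

/-- The locked boxes of `μ`.  The first two rules are those of type I (for a box on the first
row, and for a box with a locked box directly above it), the third one is that of type II. -/
inductive Locked (ℓ : ℕ) (μ : YoungDiagram) : ℕ × ℕ → Prop
  | typeI_top (b : ℕ) : (0, b) ∈ μ → NoRoomBelow ℓ μ (0, b) → Locked ℓ μ (0, b)
  | typeI_below (a b : ℕ) : (a + 1, b) ∈ μ → Locked ℓ μ (a, b) →
      NoRoomBelow ℓ μ (a + 1, b) → Locked ℓ μ (a + 1, b)
  | typeII (a b c : ℕ) : b < c → Locked ℓ μ (a, c) → Locked ℓ μ (a, b)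

noncomputable def lockedBoxes (ℓ : ℕ) (μ : YoungDiagram) : Finset (ℕ × ℕ) :=
  open Classical in μ.cells.filter fun p => Locked ℓ μ p

noncomputable def unlockedBoxes (ℓ : ℕ) (μ : YoungDiagram) : Finset (ℕ × ℕ) :=
  open Classical in μ.cells.filter fun p => ¬ Locked ℓ μ p

/-- Keep the locked boxes of `μ` and move the unlocked ones down their ladders, into the lowest
positions that are not taken by locked boxes. -/
noncomputable def deregBoxes (ℓ : ℕ) (μ : YoungDiagram) : Finset (ℕ × ℕ) :=
  lockedBoxes ℓ μ ∪
    ((unlockedBoxes ℓ μ).image (ladderIndex ℓ)).biUnion fun k =>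
      lowest (ladder ℓ k \ lockedBoxes ℓ μ) (onLadder ℓ (unlockedBoxes ℓ μ) k).card

/-- The partition `𝓢 μ`, if the boxes of `deregBoxes` form a partition. -/
noncomputable def deregularization (ℓ : ℕ) (μ : YoungDiagram) : Option YoungDiagram :=
  ofBoxes (deregBoxes ℓ μ)

end LadderCrystal

namespace LadderCrystal

/-! ### Reduction of words of signs -/

/-! The nodes of the ladder crystal turn out to be the tight partitions (`IsTight`); the proof
compares words, identifies the nodes, and inverts regularization by counting on ladders.

Comparison. The ladders of residue `i` are `ℓ` apart. The ladder signature of a tight partition has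
the form `+^A₀ -^M₀ +^A₁ -^M₁ ⋯`, where `A_j` and `M_j` count the addable and removable boxes on the
`j`-th of these ladders, and so has the row signature of a regular partition
(`IsTight.ladderSorted`, `IsRegular.ladderSorted`). Its reduction depends only on `A₀` and the
differences `A_{j+1} - M_j`. An identity along the boundary of the diagram (`sum_boundary`) shows
that these are determined by the numbers of boxes on the ladders. Regularization keeps those
numbers, so the reduced words of `μ` and `𝓡 μ` agree ladder by ladder (`SameLadders.map_boxes_eq`).
Hence `ε`, `φ` and the ladders of the good and cogood boxes agree, and since a regular partition is
determined by its ladder counts, `𝓡` commutes with the operators.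

Nodes. Tightness is preserved by both ladder operators (`IsTight.addCogood`, `IsTight.removeGood`),
and every nonempty regular partition has a good box for some residue
(`IsRegular.exists_removeGood`). Stripping good boxes shows that every tight partition is a node and
that every regular partition is the regularization of a tight one.

Inverse. Let `μ` be tight and `ν = 𝓡 μ`. A box of `μ` lying above an unoccupied position of its
ladder is locked in `ν` (`IsTight.locked_of_above`), and all locked boxes of `ν` belong to `μ`
(`mem_of_locked_of_sameLadders`). So outside the locked boxes `μ` fills the lowest free positions of
each ladder, which is how `𝓢 ν` is built.

Axioms. Kashiwara's axioms hold for any reading order that misses no addable or removable box: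
adding the cogood box only turns its `+` into a `-`, which is then the good one, and `φ - ε` is read
off from the same boundary identity. -/

theorem reduceWord_eq (w : List (Sign × (ℕ × ℕ))) :
    reduceWord w = (conormalBoxes w).map (Prod.mk Sign.plus) ++
      (normalBoxes w).map (Prod.mk Sign.minus) := by
  have key : ∀ c n : List (ℕ × ℕ),
      reduceWord w = c.map (Prod.mk Sign.plus) ++ n.map (Prod.mk Sign.minus) →
        conormalBoxes w = c ∧ normalBoxes w = n := by
    intro c n h
    rw [conormalBoxes, normalBoxes, h]
    constructor <;>
    · rw [List.filterMap_append, List.filterMap_map, List.filterMap_map]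
      simp
  suffices h : ∃ c n : List (ℕ × ℕ),
      reduceWord w = c.map (Prod.mk Sign.plus) ++ n.map (Prod.mk Sign.minus) by
    obtain ⟨c, n, h⟩ := h
    rw [(key c n h).1, (key c n h).2, h]
  clear key
  induction w with
  | nil => exact ⟨[], [], rfl⟩
  | cons s w ih =>
    obtain ⟨c, n, h⟩ := ih
    obtain ⟨s, p⟩ := s
    cases s with
    | plus => exact ⟨p :: c, n, by simp [reduceWord, h]⟩
    | minus =>
      cases c with
      | nil =>
        refine ⟨[], p :: n, ?_⟩
        cases n <;> simp_all [reduceWord]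
      | cons x c => exact ⟨c, n, by simp [reduceWord, h]⟩

@[simp] theorem conormalBoxes_nil : conormalBoxes [] = [] := rfl

@[simp] theorem normalBoxes_nil : normalBoxes [] = [] := rfl

@[simp] theorem conormalBoxes_plus (p : ℕ × ℕ) (w : List (Sign × (ℕ × ℕ))) :
    conormalBoxes ((Sign.plus, p) :: w) = p :: conormalBoxes w := by
  simp [conormalBoxes, reduceWord]

@[simp] theorem normalBoxes_plus (p : ℕ × ℕ) (w : List (Sign × (ℕ × ℕ))) :
    normalBoxes ((Sign.plus, p) :: w) = normalBoxes w := by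
  simp [normalBoxes, reduceWord]

theorem reduceWord_minus_of_nil {p : ℕ × ℕ} {w : List (Sign × (ℕ × ℕ))}
    (h : conormalBoxes w = []) :
    reduceWord ((Sign.minus, p) :: w) =
      (p :: normalBoxes w).map (Prod.mk Sign.minus) := by
  have := reduceWord_eq w
  rw [h] at this
  cases hn : normalBoxes w <;> simp_all [reduceWord]

theorem reduceWord_minus_of_cons {p x : ℕ × ℕ} {c : List (ℕ × ℕ)}
    {w : List (Sign × (ℕ × ℕ))} (h : conormalBoxes w = x :: c) :
    reduceWord ((Sign.minus, p) :: w) = c.map (Prod.mk Sign.plus) ++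
      (normalBoxes w).map (Prod.mk Sign.minus) := by
  have := reduceWord_eq w
  rw [h] at this
  simp_all [reduceWord]

theorem conormalBoxes_minus (p : ℕ × ℕ) (w : List (Sign × (ℕ × ℕ))) :
    conormalBoxes ((Sign.minus, p) :: w) = (conormalBoxes w).tail := by
  cases h : conormalBoxes w with
  | nil =>
    rw [conormalBoxes, reduceWord_minus_of_nil h, List.filterMap_map]
    simp
  | cons x c =>
    rw [conormalBoxes, reduceWord_minus_of_cons h, List.filterMap_append, List.filterMap_map,
      List.filterMap_map]
    simp

theorem normalBoxes_minus_of_nil {p : ℕ × ℕ} {w : List (Sign × (ℕ × ℕ))}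
    (h : conormalBoxes w = []) :
    normalBoxes ((Sign.minus, p) :: w) = p :: normalBoxes w := by
  rw [normalBoxes, reduceWord_minus_of_nil h, List.filterMap_map]
  simp

theorem normalBoxes_minus_of_ne_nil {p : ℕ × ℕ} {w : List (Sign × (ℕ × ℕ))}
    (h : conormalBoxes w ≠ []) :
    normalBoxes ((Sign.minus, p) :: w) = normalBoxes w := by
  obtain ⟨x, c, h⟩ := List.exists_cons_of_ne_nil h
  rw [normalBoxes, reduceWord_minus_of_cons h, List.filterMap_append, List.filterMap_map,
    List.filterMap_map]
  simp

/-- Only the `-` that survive in `u` meet the `+` that survive in `v`. The rightmost of the former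
cancel against the leftmost of the latter, hence `take` and `drop`. -/
theorem boxes_append (u v : List (Sign × (ℕ × ℕ))) :
    conormalBoxes (u ++ v) =
        conormalBoxes u ++ (conormalBoxes v).drop (normalBoxes u).length ∧
      normalBoxes (u ++ v) =
        (normalBoxes u).take ((normalBoxes u).length - (conormalBoxes v).length) ++
          normalBoxes v := by
  induction u with
  | nil => simp
  | cons s u ih =>
    obtain ⟨ih1, ih2⟩ := ih
    obtain ⟨s, p⟩ := s
    cases s with
    | plus => simp [ih1, ih2]
    | minus =>
      rw [List.cons_append, conormalBoxes_minus, conormalBoxes_minus, ih1]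
      by_cases hC : conormalBoxes u = []
      · rw [normalBoxes_minus_of_nil hC, hC]
        refine ⟨by simp, ?_⟩
        by_cases hd : (conormalBoxes v).drop (normalBoxes u).length = []
        · rw [normalBoxes_minus_of_nil (by rw [ih1, hC, hd]; rfl), ih2]
          rw [List.drop_eq_nil_iff] at hd
          rw [List.length_cons, Nat.sub_add_comm hd]
          rfl
        · rw [normalBoxes_minus_of_ne_nil (by rw [ih1, hC]; exact hd), ih2]
          rw [List.drop_eq_nil_iff, not_le] at hd
          rw [List.length_cons, Nat.sub_eq_zero_of_le hd.le, Nat.sub_eq_zero_of_le hd]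
          rfl
      · rw [normalBoxes_minus_of_ne_nil hC,
          normalBoxes_minus_of_ne_nil (by rw [ih1]; simp [hC]), ih2]
        exact ⟨by rw [List.tail_append_of_ne_nil hC], rfl⟩

theorem mem_of_mem_boxes (w : List (Sign × (ℕ × ℕ))) (p : ℕ × ℕ) :
    (p ∈ conormalBoxes w → (Sign.plus, p) ∈ w) ∧ (p ∈ normalBoxes w → (Sign.minus, p) ∈ w) := by
  induction w with
  | nil => simp
  | cons s w ih =>
    obtain ⟨s, q⟩ := s
    cases s with
    | plus =>
      refine ⟨?_, ?_⟩
      · rw [conormalBoxes_plus, List.mem_cons]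
        rintro (rfl | h)
        · simp
        · exact List.mem_cons_of_mem _ (ih.1 h)
      · rw [normalBoxes_plus]
        exact fun h => List.mem_cons_of_mem _ (ih.2 h)
    | minus =>
      refine ⟨?_, ?_⟩
      · rw [conormalBoxes_minus]
        exact fun h => List.mem_cons_of_mem _ (ih.1 (List.mem_of_mem_tail h))
      · by_cases hC : conormalBoxes w = []
        · rw [normalBoxes_minus_of_nil hC, List.mem_cons]
          rintro (rfl | h)
          · simp
          · exact List.mem_cons_of_mem _ (ih.2 h)
        · rw [normalBoxes_minus_of_ne_nil hC]
          exact fun h => List.mem_cons_of_mem _ (ih.2 h)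

theorem notMem_boxes_of_notMem {w : List (Sign × (ℕ × ℕ))} {p : ℕ × ℕ}
    (h : p ∉ w.map Prod.snd) : p ∉ conormalBoxes w ∧ p ∉ normalBoxes w :=
  ⟨fun hp => h (List.mem_map_of_mem (f := Prod.snd) ((mem_of_mem_boxes w p).1 hp)),
    fun hp => h (List.mem_map_of_mem (f := Prod.snd) ((mem_of_mem_boxes w p).2 hp))⟩

theorem notMem_of_nodup_split {u v : List (Sign × (ℕ × ℕ))} {s : Sign} {p : ℕ × ℕ}
    (h : ((u ++ (s, p) :: v).map Prod.snd).Nodup) :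
    p ∉ u.map Prod.snd ∧ p ∉ v.map Prod.snd := by
  rw [List.map_append, List.map_cons, List.nodup_middle, List.nodup_cons, List.mem_append,
    not_or] at h
  exact h.1

/-- A `+` is the rightmost one of the reduced word if and only if all `-` on its left and all `+`
on its right are cancelled among themselves. -/
theorem getLast?_conormalBoxes_iff {u v : List (Sign × (ℕ × ℕ))} {p : ℕ × ℕ}
    (h : ((u ++ (Sign.plus, p) :: v).map Prod.snd).Nodup) :
    (conormalBoxes (u ++ (Sign.plus, p) :: v)).getLast? = some p ↔
      normalBoxes u = [] ∧ conormalBoxes v = [] := by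
  obtain ⟨hu, hv⟩ := notMem_of_nodup_split h
  replace hu := notMem_boxes_of_notMem hu
  replace hv := notMem_boxes_of_notMem hv
  rw [(boxes_append _ _).1, conormalBoxes_plus]
  constructor
  · intro hl
    have hm := List.mem_of_getLast? hl
    have hn : normalBoxes u = [] := by
      by_contra hn
      obtain ⟨x, n, hn⟩ := List.exists_cons_of_ne_nil hn
      rw [hn, List.length_cons, List.drop_succ_cons, List.mem_append] at hm
      exact hm.elim hu.1 fun h => hv.1 (List.mem_of_mem_drop h)
    refine ⟨hn, ?_⟩
    by_contra hc
    rw [hn, List.length_nil, List.drop_zero, List.getLast?_append_of_ne_nil _ (by simp),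
      List.getLast?_cons, List.getLast?_eq_some_getLast hc, Option.getD_some,
      Option.some_inj] at hl
    exact hv.1 (hl ▸ List.getLast_mem hc)
  · rintro ⟨hn, hc⟩
    rw [hn, hc]
    simp

/-- A `-` is the leftmost one of the reduced word if and only if all `-` on its left and all `+`
on its right are cancelled among themselves. -/
theorem head?_normalBoxes_iff {u v : List (Sign × (ℕ × ℕ))} {p : ℕ × ℕ}
    (h : ((u ++ (Sign.minus, p) :: v).map Prod.snd).Nodup) :
    (normalBoxes (u ++ (Sign.minus, p) :: v)).head? = some p ↔
      normalBoxes u = [] ∧ conormalBoxes v = [] := by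
  obtain ⟨hu, hv⟩ := notMem_of_nodup_split h
  replace hu := notMem_boxes_of_notMem hu
  replace hv := notMem_boxes_of_notMem hv
  rw [(boxes_append _ _).2, conormalBoxes_minus]
  constructor
  · intro hl
    have hc : conormalBoxes v = [] := by
      by_contra hc
      rw [normalBoxes_minus_of_ne_nil hc] at hl
      have hm := List.mem_of_mem_head? hl
      rw [List.mem_append] at hm
      exact hm.elim (fun h => hu.2 (List.mem_of_mem_take h)) hv.2
    refine ⟨?_, hc⟩
    by_contra hn
    obtain ⟨x, n, hn⟩ := List.exists_cons_of_ne_nil hn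
    rw [hc, hn] at hl
    have hx : x = p := by simpa using hl
    exact hu.2 (by rw [hn, hx]; simp)
  · rintro ⟨hn, hc⟩
    rw [hn, normalBoxes_minus_of_nil hc]
    simp

/-- A `+` can only be cancelled by a `-` on its left. -/
theorem exists_minus_of_conormalBoxes_eq_nil {u v : List (Sign × (ℕ × ℕ))} {p : ℕ × ℕ}
    (h : conormalBoxes (u ++ (Sign.plus, p) :: v) = []) : ∃ q, (Sign.minus, q) ∈ u := by
  rw [(boxes_append _ _).1, conormalBoxes_plus, List.append_eq_nil_iff] at h
  have hn : normalBoxes u ≠ [] := by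
    intro hn
    simp [hn] at h
  obtain ⟨q, hq⟩ := List.exists_mem_of_ne_nil _ hn
  exact ⟨q, (mem_of_mem_boxes u q).2 hq⟩

theorem exists_plus_of_normalBoxes_eq_nil {u v : List (Sign × (ℕ × ℕ))} {p : ℕ × ℕ}
    (h : normalBoxes (u ++ (Sign.minus, p) :: v) = []) : ∃ q, (Sign.plus, q) ∈ v := by
  rw [(boxes_append _ _).2, List.append_eq_nil_iff] at h
  have hn : conormalBoxes v ≠ [] := by
    intro hn
    rw [normalBoxes_minus_of_nil hn] at h
    simp at h
  obtain ⟨q, hq⟩ := List.exists_mem_of_ne_nil _ hn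
  exact ⟨q, (mem_of_mem_boxes v q).1 hq⟩

def Sign.isPlus : Sign → Bool
  | Sign.plus => true
  | Sign.minus => false

@[simp] theorem Sign.isPlus_plus : Sign.plus.isPlus = true := rfl

@[simp] theorem Sign.isPlus_minus : Sign.minus.isPlus = false := rfl

/-- Each cancellation removes one sign of either kind. This gives `φ - ε` without reducing the word.
-/
theorem length_boxes (w : List (Sign × (ℕ × ℕ))) :
    (conormalBoxes w).length + w.countP (fun s => !s.1.isPlus) =
      (normalBoxes w).length + w.countP (fun s => s.1.isPlus) := by
  induction w with
  | nil => rfl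
  | cons s w ih =>
    obtain ⟨s, p⟩ := s
    cases s with
    | plus => simp [List.countP_cons]; omega
    | minus =>
      rw [conormalBoxes_minus]
      cases hC : conormalBoxes w with
      | nil =>
        rw [normalBoxes_minus_of_nil hC]
        rw [hC] at ih
        simp at ih ⊢; omega
      | cons x c =>
        rw [normalBoxes_minus_of_ne_nil (by simp [hC])]
        rw [hC] at ih
        simp at ih ⊢; omega

/-- Cancellation looks at signs only, so boxes may be replaced by the labels of their ladders before
reducing. -/
theorem boxes_map (g : ℕ × ℕ → ℕ × ℕ) (w : List (Sign × (ℕ × ℕ))) :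
    conormalBoxes (w.map (Prod.map id g)) = (conormalBoxes w).map g ∧
      normalBoxes (w.map (Prod.map id g)) = (normalBoxes w).map g := by
  induction w with
  | nil => simp
  | cons s w ih =>
    obtain ⟨s, p⟩ := s
    obtain ⟨ih1, ih2⟩ := ih
    cases s with
    | plus => simp [ih1, ih2]
    | minus =>
      rw [List.map_cons, Prod.map_apply, id, conormalBoxes_minus, conormalBoxes_minus, ih1]
      refine ⟨by simp, ?_⟩
      by_cases hC : conormalBoxes w = []
      · rw [normalBoxes_minus_of_nil hC, normalBoxes_minus_of_nil (by simp [ih1, hC]), ih2]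
        simp
      · rw [normalBoxes_minus_of_ne_nil hC, normalBoxes_minus_of_ne_nil (by simp [ih1, hC]), ih2]

/-! ### Words that are sorted by a label -/

/-- The word `-^(M j) +^(A (j+1)) -^(M (j+1)) ⋯ +^(A (j+n)) -^(M (j+n))`, where each sign is
labelled by its index. -/
def layeredWord (A M : ℕ → ℕ) : ℕ → ℕ → List (Sign × (ℕ × ℕ))
  | j, 0 => List.replicate (M j) (Sign.minus, (j, 0))
  | j, n + 1 => List.replicate (M j) (Sign.minus, (j, 0)) ++
      (List.replicate (A (j + 1)) (Sign.plus, (j + 1, 0)) ++ layeredWord A M (j + 1) n)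

theorem reduceWord_append_congr (u : List (Sign × (ℕ × ℕ))) {v v' : List (Sign × (ℕ × ℕ))}
    (h : reduceWord v = reduceWord v') : reduceWord (u ++ v) = reduceWord (u ++ v') := by
  induction u with
  | nil => exact h
  | cons s u ih =>
    obtain ⟨s, p⟩ := s
    cases s <;> simp only [List.cons_append, reduceWord, ih]

theorem reduceWord_cancel (m a : ℕ) (x y : ℕ × ℕ) (v : List (Sign × (ℕ × ℕ))) :
    reduceWord (List.replicate (m + 1) (Sign.minus, x) ++
        (List.replicate (a + 1) (Sign.plus, y) ++ v)) =
      reduceWord (List.replicate m (Sign.minus, x) ++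
        (List.replicate a (Sign.plus, y) ++ v)) := by
  rw [List.replicate_succ', List.append_assoc]
  refine reduceWord_append_congr _ ?_
  simp [reduceWord, List.replicate_succ]

theorem reduceWord_replicate_congr {m a m' a' : ℕ} (h : a + m' = a' + m) (x y : ℕ × ℕ)
    (v : List (Sign × (ℕ × ℕ))) :
    reduceWord (List.replicate m (Sign.minus, x) ++
        (List.replicate a (Sign.plus, y) ++ v)) =
      reduceWord (List.replicate m' (Sign.minus, x) ++
        (List.replicate a' (Sign.plus, y) ++ v)) := by
  have key : ∀ t m a : ℕ, reduceWord (List.replicate (m + t) (Sign.minus, x) ++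
        (List.replicate (a + t) (Sign.plus, y) ++ v)) =
      reduceWord (List.replicate m (Sign.minus, x) ++
        (List.replicate a (Sign.plus, y) ++ v)) := by
    intro t
    induction t with
    | zero => exact fun _ _ => rfl
    | succ t ih => exact fun m a => (reduceWord_cancel _ _ _ _ _).trans (ih m a)
  rcases le_total m m' with hm | hm
  · obtain ⟨t, rfl⟩ := Nat.exists_eq_add_of_le hm
    obtain rfl : a' = a + t := by omega
    exact (key t m a).symm
  · obtain ⟨t, rfl⟩ := Nat.exists_eq_add_of_le hm
    obtain rfl : a = a' + t := by omega
    exact key t m' a'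

/-- In the block `-^(M j) +^(A (j+1))` pairs `-+` may be inserted or removed, so only `A (j+1) - M
j` matters. The last block of `-` has no `+` after it and must agree exactly. -/
theorem reduceWord_layeredWord_congr {A M A' M' : ℕ → ℕ}
    (h : ∀ j, A (j + 1) + M' j = A' (j + 1) + M j) (n : ℕ) :
    ∀ j, M (j + n) = M' (j + n) →
      reduceWord (layeredWord A M j n) = reduceWord (layeredWord A' M' j n) := by
  induction n with
  | zero => intro j hj; simp only [add_zero] at hj; simp only [layeredWord, hj]
  | succ n ih =>
    intro j hj
    simp only [layeredWord]
    rw [reduceWord_replicate_congr (h j)]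
    refine reduceWord_append_congr _ (reduceWord_append_congr _ (ih (j + 1) ?_))
    rwa [add_right_comm, add_assoc]

/-! ### Addable and removable boxes -/

theorem addable_iff {μ : YoungDiagram} {a b : ℕ} :
    Addable μ (a, b) ↔ (a, b) ∉ μ ∧ (∀ c, a = c + 1 → (c, b) ∈ μ) ∧
      (∀ d, b = d + 1 → (a, d) ∈ μ) := by
  refine and_congr_right fun hn => ⟨fun h => ⟨?_, ?_⟩, ?_⟩
  · rintro c rfl
    have := h (show (c, b) ≤ (c + 1, b) from ⟨by simp, le_rfl⟩) (by simp)
    simpa using this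
  · rintro d rfl
    have := h (show (a, d) ≤ (a, d + 1) from ⟨le_rfl, by simp⟩) (by simp)
    simpa using this
  · rintro ⟨h1, h2⟩ ⟨x, y⟩ ⟨c, d⟩ ⟨hc, hd⟩ hx
    simp only [Finset.coe_insert, Set.mem_insert_iff, Finset.mem_coe,
      YoungDiagram.mem_cells] at hx ⊢
    rcases hx with hx | hx
    · simp only [Prod.mk.injEq] at hx hc hd
      obtain ⟨rfl, rfl⟩ := hx
      by_cases e1 : c = x
      · by_cases e2 : d = y
        · exact Or.inl (by rw [e1, e2])
        · obtain ⟨y, rfl⟩ : ∃ y', y = y' + 1 := ⟨y - 1, by omega⟩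
          exact Or.inr (μ.up_left_mem hc (by omega) (h2 y rfl))
      · obtain ⟨x, rfl⟩ : ∃ x', x = x' + 1 := ⟨x - 1, by omega⟩
        exact Or.inr (μ.up_left_mem (by omega) hd (h1 x rfl))
    · exact Or.inr (μ.up_left_mem hc hd hx)

theorem removable_iff {μ : YoungDiagram} {a b : ℕ} :
    Removable μ (a, b) ↔ (a, b) ∈ μ ∧ (a + 1, b) ∉ μ ∧ (a, b + 1) ∉ μ := by
  refine and_congr_right fun hn => ⟨fun h => ⟨fun h1 => ?_, fun h1 => ?_⟩, ?_⟩
  · have := h (show (a, b) ≤ (a + 1, b) from ⟨by simp, le_rfl⟩) (by simpa using h1)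
    simp at this
  · have := h (show (a, b) ≤ (a, b + 1) from ⟨le_rfl, by simp⟩) (by simpa using h1)
    simp at this
  · rintro ⟨h1, h2⟩ ⟨x, y⟩ ⟨c, d⟩ ⟨hc, hd⟩ hx
    simp only [Finset.coe_erase, Set.mem_sdiff, Finset.mem_coe, YoungDiagram.mem_cells,
      Set.mem_singleton_iff] at hx ⊢
    obtain ⟨hx, hne⟩ := hx
    refine ⟨μ.up_left_mem hc hd hx, ?_⟩
    intro he
    simp only [Prod.mk.injEq] at he hne hc hd
    obtain ⟨rfl, rfl⟩ := he
    by_cases e1 : c = x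
    · exact h2 (μ.up_left_mem e1.le (by omega) hx)
    · exact h1 (μ.up_left_mem (by omega) hd hx)

theorem Addable.not_removable {μ : YoungDiagram} {p : ℕ × ℕ} (h : Addable μ p) :
    ¬ Removable μ p := fun h' => h.1 h'.1

theorem residue_right (ℓ a b : ℕ) : residue ℓ (a, b + 1) = residue ℓ (a, b) + 1 := by
  simp only [residue]; push_cast; ring

theorem residue_down (ℓ a b : ℕ) : residue ℓ (a + 1, b) = residue ℓ (a, b) - 1 := by
  simp only [residue]; push_cast; ring

theorem zmod_one_ne_zero {ℓ : ℕ} (hℓ : 3 ≤ ℓ) : (1 : ZMod ℓ) ≠ 0 := by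
  have : Fact (1 < ℓ) := ⟨by omega⟩
  exact one_ne_zero

theorem residue_right_ne {ℓ : ℕ} (hℓ : 3 ≤ ℓ) (a b : ℕ) :
    residue ℓ (a, b + 1) ≠ residue ℓ (a, b) := by
  rw [residue_right]
  intro h
  exact zmod_one_ne_zero hℓ (by simpa using h)

theorem residue_down_ne {ℓ : ℕ} (hℓ : 3 ≤ ℓ) (a b : ℕ) :
    residue ℓ (a + 1, b) ≠ residue ℓ (a, b) := by
  rw [residue_down]
  intro h
  exact zmod_one_ne_zero hℓ (by simpa using h)

theorem ladderIndex_right (ℓ a b : ℕ) :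
    ladderIndex ℓ (a, b + 1) = ladderIndex ℓ (a, b) + (ℓ - 1) := by
  simp only [ladderIndex]; ring

theorem ladderIndex_down (ℓ a b : ℕ) :
    ladderIndex ℓ (a + 1, b) = ladderIndex ℓ (a, b) + 1 := by
  simp only [ladderIndex]; ring

/-- Because `ℓ - 1` is `-1` modulo `ℓ`. Hence the ladders of a given residue are those whose index
lies in one class modulo `ℓ`. -/
theorem residue_eq_neg_ladderIndex {ℓ : ℕ} (hℓ : 3 ≤ ℓ) (p : ℕ × ℕ) :
    residue ℓ p = -(ladderIndex ℓ p : ZMod ℓ) := by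
  simp only [residue, ladderIndex]
  have : ((ℓ - 1 : ℕ) : ZMod ℓ) = -1 := by
    rw [Nat.cast_sub (by omega)]; simp
  push_cast [this]
  ring

theorem ladderIndex_inj_of_row {ℓ : ℕ} (hℓ : 3 ≤ ℓ) {a b d : ℕ}
    (h : ladderIndex ℓ (a, b) = ladderIndex ℓ (a, d)) : b = d := by
  simp only [ladderIndex] at h
  exact Nat.eq_of_mul_eq_mul_left (show 0 < ℓ - 1 by omega) (by omega)

/-- A position on the ladder of a position in or below its row lies on the left of it. -/
theorem exists_of_ladderIndex_eq {ℓ : ℕ} (hℓ : 3 ≤ ℓ) {a b c d : ℕ}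
    (h : ladderIndex ℓ (a, b) = ladderIndex ℓ (c, d)) (hac : a ≤ c) :
    ∃ m, c = a + (ℓ - 1) * m ∧ b = d + m := by
  simp only [ladderIndex] at h
  have hdb : d ≤ b := by
    by_contra hlt
    have := Nat.mul_lt_mul_of_pos_left (not_le.1 hlt) (show 0 < ℓ - 1 by omega)
    omega
  obtain ⟨m, rfl⟩ := Nat.exists_eq_add_of_le hdb
  refine ⟨m, ?_, rfl⟩
  rw [mul_add] at h
  omega

/-! ### Signatures as sorted words -/

/-- The readings `reading μ` list the positions in the order `before`, and do not miss an addable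
or removable box of `μ`. -/
structure IsReading (before : ℕ × ℕ → ℕ × ℕ → Prop)
    (reading : YoungDiagram → List (ℕ × ℕ)) : Prop where
  asymm : ∀ p q, before p q → ¬ before q p
  sorted : ∀ μ, (reading μ).Pairwise before
  mem_of_addable : ∀ μ p, Addable μ p → p ∈ reading μ
  mem_of_removable : ∀ μ p, Removable μ p → p ∈ reading μ

theorem plus_mem_signature {ℓ : ℕ} {i : ZMod ℓ} {μ : YoungDiagram} {L : List (ℕ × ℕ)}
    {p : ℕ × ℕ} :
    (Sign.plus, p) ∈ signature ℓ i μ L ↔ p ∈ L ∧ Addable μ p ∧ residue ℓ p = i := by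
  rw [signature, List.mem_filterMap]
  constructor
  · rintro ⟨q, hq, h⟩
    split_ifs at h with h1
    · simp only [Option.some.injEq, Prod.mk.injEq, true_and] at h
      exact h ▸ ⟨hq, h1⟩
    · simp at h
  · rintro ⟨hp, h⟩
    exact ⟨p, hp, by rw [if_pos h]⟩

theorem minus_mem_signature {ℓ : ℕ} {i : ZMod ℓ} {μ : YoungDiagram} {L : List (ℕ × ℕ)}
    {p : ℕ × ℕ} :
    (Sign.minus, p) ∈ signature ℓ i μ L ↔ p ∈ L ∧ Removable μ p ∧ residue ℓ p = i := by
  rw [signature, List.mem_filterMap]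
  constructor
  · rintro ⟨q, hq, h⟩
    split_ifs at h with h1 h2
    · simp at h
    · simp only [Option.some.injEq, Prod.mk.injEq, true_and] at h
      exact h ▸ ⟨hq, h2⟩
  · rintro ⟨hp, h⟩
    exact ⟨p, hp, by rw [if_neg fun h' => h'.1.not_removable h.1, if_pos h]⟩

theorem signature_pairwise {ℓ : ℕ} {i : ZMod ℓ} {μ : YoungDiagram} {L : List (ℕ × ℕ)}
    {before : ℕ × ℕ → ℕ × ℕ → Prop} (h : L.Pairwise before) :
    (signature ℓ i μ L).Pairwise fun x y => before x.2 y.2 := by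
  rw [signature, List.pairwise_filterMap]
  refine h.imp ?_
  intro p q hpq x hx y hy
  have h1 : x.2 = p := by split_ifs at hx <;> simp_all <;> rw [← hx]
  have h2 : y.2 = q := by split_ifs at hy <;> simp_all <;> rw [← hy]
  rw [h1, h2]; exact hpq

theorem ofBoxes_eq_some_iff {ν : YoungDiagram} {s : Finset (ℕ × ℕ)} :
    ofBoxes s = some ν ↔ ν.cells = s := by
  rw [ofBoxes]
  split_ifs with h
  · rw [Option.some_inj]
    exact ⟨fun h => h ▸ rfl, fun h => YoungDiagram.ext h.symm⟩
  · simp only [false_iff]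
    rintro rfl
    exact h ν.isLowerSet

section Reading

variable {before : ℕ × ℕ → ℕ × ℕ → Prop} {reading : YoungDiagram → List (ℕ × ℕ)}
  {ℓ : ℕ} {i : ZMod ℓ} {μ ν : YoungDiagram}

theorem IsReading.plus_mem (hr : IsReading before reading) {p : ℕ × ℕ} :
    (Sign.plus, p) ∈ signature ℓ i μ (reading μ) ↔ Addable μ p ∧ residue ℓ p = i := by
  rw [plus_mem_signature]
  exact ⟨And.right, fun h => ⟨hr.mem_of_addable _ _ h.1, h⟩⟩

theorem IsReading.minus_mem (hr : IsReading before reading) {p : ℕ × ℕ} :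
    (Sign.minus, p) ∈ signature ℓ i μ (reading μ) ↔ Removable μ p ∧ residue ℓ p = i := by
  rw [minus_mem_signature]
  exact ⟨And.right, fun h => ⟨hr.mem_of_removable _ _ h.1, h⟩⟩

theorem IsReading.nodup_map (hr : IsReading before reading) :
    ((signature ℓ i μ (reading μ)).map Prod.snd).Nodup := by
  refine List.Pairwise.map _ ?_ (signature_pairwise (hr.sorted μ))
  intro x y hxy he
  rw [he] at hxy
  exact hr.asymm _ _ hxy hxy

theorem IsReading.mem_right_of_before (hr : IsReading before reading)
    {u v : List (Sign × (ℕ × ℕ))} {x y : Sign × (ℕ × ℕ)}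
    (h : signature ℓ i μ (reading μ) = u ++ x :: v)
    (hy : y ∈ signature ℓ i μ (reading μ)) (hxy : before x.2 y.2) : y ∈ v := by
  have hs := signature_pairwise (ℓ := ℓ) (i := i) (μ := μ) (hr.sorted μ)
  rw [h] at hs hy
  rw [List.mem_append, List.mem_cons] at hy
  rcases hy with hy | rfl | hy
  · exact absurd ((List.pairwise_append.1 hs).2.2 y hy x (by simp)) (hr.asymm _ _ hxy)
  · exact absurd hxy (hr.asymm _ _ hxy)
  · exact hy

theorem IsReading.mem_left_of_before (hr : IsReading before reading)
    {u v : List (Sign × (ℕ × ℕ))} {x y : Sign × (ℕ × ℕ)}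
    (h : signature ℓ i μ (reading μ) = u ++ x :: v)
    (hy : y ∈ signature ℓ i μ (reading μ)) (hxy : before y.2 x.2) : y ∈ u := by
  have hs := signature_pairwise (ℓ := ℓ) (i := i) (μ := μ) (hr.sorted μ)
  rw [h] at hs hy
  rw [List.mem_append, List.mem_cons] at hy
  rcases hy with hy | rfl | hy
  · exact hy
  · exact absurd hxy (hr.asymm _ _ hxy)
  · exact absurd (List.rel_of_pairwise_cons (List.pairwise_append.1 hs).2.1 hy)
      (hr.asymm _ _ hxy)

/-- An addable box that is read after the cogood box is separated from it by a removable box. -/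
theorem IsReading.exists_removable_between (hr : IsReading before reading)
    {u v : List (Sign × (ℕ × ℕ))} {p q : ℕ × ℕ}
    (h : signature ℓ i μ (reading μ) = u ++ (Sign.plus, p) :: v) (hv : conormalBoxes v = [])
    (hq : Addable μ q) (hi : residue ℓ q = i) (hpq : before p q) :
    ∃ r, Removable μ r ∧ residue ℓ r = i ∧ before p r ∧ before r q := by
  have hs := signature_pairwise (ℓ := ℓ) (i := i) (μ := μ) (hr.sorted μ)
  have hm := hr.mem_right_of_before h (y := (Sign.plus, q)) (hr.plus_mem.2 ⟨hq, hi⟩) hpq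
  obtain ⟨v₁, v₂, rfl⟩ := List.append_of_mem hm
  obtain ⟨r, hr'⟩ := exists_minus_of_conormalBoxes_eq_nil hv
  have hmem : (Sign.minus, r) ∈ signature ℓ i μ (reading μ) := by
    rw [h]; simp [hr']
  rw [h] at hs
  have h1 := (List.pairwise_append.1 hs).2.1
  have h2 := hr.minus_mem.1 hmem
  refine ⟨r, h2.1, h2.2, ?_, ?_⟩
  · exact List.rel_of_pairwise_cons h1 (a' := (Sign.minus, r)) (by simp [hr'])
  · exact (List.pairwise_append.1 (List.Pairwise.of_cons h1)).2.2 _ hr' (Sign.plus, q) (by simp)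

/-- A removable box that is read before the good box is separated from it by an addable box. -/
theorem IsReading.exists_addable_between (hr : IsReading before reading)
    {u v : List (Sign × (ℕ × ℕ))} {p q : ℕ × ℕ}
    (h : signature ℓ i μ (reading μ) = u ++ (Sign.minus, p) :: v) (hu : normalBoxes u = [])
    (hq : Removable μ q) (hi : residue ℓ q = i) (hpq : before q p) :
    ∃ r, Addable μ r ∧ residue ℓ r = i ∧ before q r ∧ before r p := by
  have hs := signature_pairwise (ℓ := ℓ) (i := i) (μ := μ) (hr.sorted μ)
  have hm := hr.mem_left_of_before h (y := (Sign.minus, q)) (hr.minus_mem.2 ⟨hq, hi⟩) hpq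
  obtain ⟨u₁, u₂, rfl⟩ := List.append_of_mem hm
  obtain ⟨r, hr'⟩ := exists_plus_of_normalBoxes_eq_nil hu
  have hmem : (Sign.plus, r) ∈ signature ℓ i μ (reading μ) := by
    rw [h]; simp [hr']
  rw [h] at hs
  have h1 := List.pairwise_append.1 hs
  have h2 := hr.plus_mem.1 hmem
  refine ⟨r, h2.1, h2.2, ?_, ?_⟩
  · exact List.rel_of_pairwise_cons (List.pairwise_append.1 h1.1).2.1 hr'
  · exact h1.2.2 (Sign.plus, r) (by simp [hr']) (Sign.minus, p) (by simp)

/-- The condition on `u` and `v` is the same as in `IsReading.removeGood_eq_some_iff`; only the sign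
of `p` differs. This makes the two operators mutually inverse. -/
theorem IsReading.addCogood_eq_some_iff (hr : IsReading before reading) :
    addCogood ℓ reading i μ = some ν ↔ ∃ p u v, Addable μ p ∧ residue ℓ p = i ∧
      ν.cells = insert p μ.cells ∧ signature ℓ i μ (reading μ) = u ++ (Sign.plus, p) :: v ∧
      normalBoxes u = [] ∧ conormalBoxes v = [] := by
  have hn := hr.nodup_map (ℓ := ℓ) (i := i) (μ := μ)
  rw [addCogood, Option.bind_eq_some_iff]
  constructor
  · rintro ⟨p, hp, hν⟩
    have hm := (mem_of_mem_boxes _ _).1 (List.mem_of_getLast? hp)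
    obtain ⟨u, v, h⟩ := List.append_of_mem hm
    rw [h] at hn hp
    have := (getLast?_conormalBoxes_iff hn).1 hp
    have h2 := hr.plus_mem.1 hm
    exact ⟨p, u, v, h2.1, h2.2, ofBoxes_eq_some_iff.1 hν, h, this⟩
  · rintro ⟨p, u, v, ha, hi, hν, h, h'⟩
    rw [h] at hn ⊢
    exact ⟨p, (getLast?_conormalBoxes_iff hn).2 h', ofBoxes_eq_some_iff.2 hν⟩

theorem IsReading.removeGood_eq_some_iff (hr : IsReading before reading) :
    removeGood ℓ reading i μ = some ν ↔ ∃ p u v, Removable μ p ∧ residue ℓ p = i ∧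
      ν.cells = μ.cells.erase p ∧ signature ℓ i μ (reading μ) = u ++ (Sign.minus, p) :: v ∧
      normalBoxes u = [] ∧ conormalBoxes v = [] := by
  have hn := hr.nodup_map (ℓ := ℓ) (i := i) (μ := μ)
  rw [removeGood, Option.bind_eq_some_iff]
  constructor
  · rintro ⟨p, hp, hν⟩
    have hm := (mem_of_mem_boxes _ _).2 (List.mem_of_mem_head? hp)
    obtain ⟨u, v, h⟩ := List.append_of_mem hm
    rw [h] at hn hp
    have := (head?_normalBoxes_iff hn).1 hp
    have h2 := hr.minus_mem.1 hm
    exact ⟨p, u, v, h2.1, h2.2, ofBoxes_eq_some_iff.1 hν, h, this⟩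
  · rintro ⟨p, u, v, ha, hi, hν, h, h'⟩
    rw [h] at hn ⊢
    exact ⟨p, (head?_normalBoxes_iff hn).2 h', ofBoxes_eq_some_iff.2 hν⟩

end Reading

/-! ### The two readings -/

/-- The boxes above `(a, b)` in its column, those to its left in its row, and the box itself are `a
+ b + 1` boxes of `μ`. -/
theorem add_lt_card {μ : YoungDiagram} {a b : ℕ} (h : (a, b) ∈ μ) : a + b < μ.card := by
  have : (Finset.range (a + b + 1)).card ≤ μ.cells.card := by
    refine Finset.card_le_card_of_injOn
      (fun t => if t ≤ a then (t, b) else (a, t - a - 1)) ?_ ?_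
    · intro t ht
      simp only [Finset.coe_range, Set.mem_Iio] at ht
      simp only [Finset.mem_coe, YoungDiagram.mem_cells]
      split_ifs with h1
      · exact μ.up_left_mem h1 le_rfl h
      · exact μ.up_left_mem le_rfl (by omega) h
    · intro t ht s hs he
      simp only [Finset.coe_range, Set.mem_Iio] at ht hs he
      split_ifs at he <;> simp only [Prod.mk.injEq] at he <;> omega
  rw [Finset.card_range] at this
  exact this

theorem Addable.add_le_card {μ : YoungDiagram} {a b : ℕ} (h : Addable μ (a, b)) :
    a + b ≤ μ.card := by
  have h1 := add_lt_card (μ := ⟨insert (a, b) μ.cells, h.2⟩) (a := a) (b := b)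
    (YoungDiagram.mem_cells _ |>.1 (Finset.mem_insert_self _ _))
  have h2 : ((insert (a, b) μ.cells).card) ≤ μ.cells.card + 1 := Finset.card_insert_le _ _
  exact Nat.lt_succ_iff.1 (lt_of_lt_of_le h1 h2)

def RowBefore (p q : ℕ × ℕ) : Prop := q.1 < p.1 ∨ (p.1 = q.1 ∧ p.2 < q.2)

def LadderBefore (ℓ : ℕ) (p q : ℕ × ℕ) : Prop :=
  ladderIndex ℓ p < ladderIndex ℓ q ∨ (ladderIndex ℓ p = ladderIndex ℓ q ∧ p.1 < q.1)

theorem pairwise_product {l m : List ℕ} {r : ℕ → ℕ → Prop} (hl : l.Pairwise r)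
    (hm : m.Pairwise (· < ·)) :
    (l ×ˢ m).Pairwise fun p q => r p.1 q.1 ∨ (p.1 = q.1 ∧ p.2 < q.2) := by
  change (l.flatMap fun a => m.map (Prod.mk a)).Pairwise _
  rw [List.pairwise_flatMap]
  constructor
  · intro a _
    exact hm.map _ fun x y h => Or.inr ⟨rfl, h⟩
  · refine hl.imp ?_
    intro a b hab x hx y hy
    rw [List.mem_map] at hx hy
    obtain ⟨_, _, rfl⟩ := hx
    obtain ⟨_, _, rfl⟩ := hy
    exact Or.inl hab

theorem isReading_rowReading : IsReading RowBefore rowReading := by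
  have hmem : ∀ μ : YoungDiagram, ∀ a b, a + b ≤ μ.card → (a, b) ∈ rowReading μ := by
    intro μ a b h
    refine List.mem_product.2 ⟨?_, ?_⟩
    · rw [List.mem_reverse, List.mem_range]; omega
    · rw [List.mem_range]; omega
  refine ⟨?_, ?_, ?_, ?_⟩
  · simp only [RowBefore]; intro p q; omega
  · intro μ
    exact pairwise_product (r := fun x y => y < x)
      (List.pairwise_reverse.2 List.pairwise_lt_range) List.pairwise_lt_range
  · exact fun μ p h => hmem μ _ _ h.add_le_card
  · exact fun μ p h => hmem μ _ _ (add_lt_card h.1).le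

theorem isReading_ladderReading {ℓ : ℕ} (hℓ : 3 ≤ ℓ) :
    IsReading (LadderBefore ℓ) (ladderReading ℓ) := by
  have hmem : ∀ μ : YoungDiagram, ∀ a b, a + b ≤ μ.card → (a, b) ∈ ladderReading ℓ μ := by
    intro μ a b h
    have h1 : a ≤ (ℓ - 1) * a := Nat.le_mul_of_pos_left _ (by omega)
    have h2 : b ≤ (ℓ - 1) * b := Nat.le_mul_of_pos_left _ (by omega)
    have h3 : (ℓ - 1) * (a + b) ≤ ℓ * μ.card := Nat.mul_le_mul (by omega) h
    rw [mul_add] at h3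
    refine List.mem_flatMap.2 ⟨ladderIndex ℓ (a, b), ?_, List.mem_filter.2 ⟨?_, by simp⟩⟩
    · rw [List.mem_range]; simp only [ladderIndex]; omega
    · refine List.mem_product.2 ?_
      simp only [ladderIndex, List.mem_range]; omega
  refine ⟨?_, ?_, ?_, ?_⟩
  · simp only [LadderBefore]; intro p q; omega
  · intro μ
    rw [ladderReading, List.pairwise_flatMap]
    constructor
    · intro k _
      rw [List.pairwise_filter]
      refine (pairwise_product (r := (· < ·)) List.pairwise_lt_range
        List.pairwise_lt_range).imp ?_
      rintro ⟨a, b⟩ ⟨c, d⟩ h hp hq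
      simp only [decide_eq_true_eq] at hp hq h
      refine Or.inr ⟨hp.trans hq.symm, ?_⟩
      rcases h with h | ⟨rfl, h⟩
      · exact h
      · exact absurd (ladderIndex_inj_of_row hℓ (hp.trans hq.symm)) h.ne
    · refine List.pairwise_lt_range.imp ?_
      intro k k' hk p hp q hq
      rw [List.mem_filter, decide_eq_true_eq] at hp hq
      exact Or.inl (by omega)
  · exact fun μ p h => hmem μ _ _ h.add_le_card
  · exact fun μ p h => hmem μ _ _ (add_lt_card h.1).le

/-! ### Adding a box -/

theorem mem_of_cells_eq_insert {μ ν : YoungDiagram} {p : ℕ × ℕ}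
    (h : ν.cells = insert p μ.cells) (q : ℕ × ℕ) : q ∈ ν ↔ q = p ∨ q ∈ μ := by
  rw [← YoungDiagram.mem_cells, h, Finset.mem_insert, YoungDiagram.mem_cells]

theorem removable_of_cells_eq_insert {μ ν : YoungDiagram} {p : ℕ × ℕ}
    (h : ν.cells = insert p μ.cells) (hp : p ∉ μ) : Removable ν p := by
  refine ⟨(mem_of_cells_eq_insert h p).2 (Or.inl rfl), ?_⟩
  rw [h, Finset.erase_insert (by rwa [YoungDiagram.mem_cells])]
  exact μ.isLowerSet

theorem cells_eq_insert_iff {μ ν : YoungDiagram} {p : ℕ × ℕ} :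
    (Addable μ p ∧ ν.cells = insert p μ.cells) ↔
      (Removable ν p ∧ μ.cells = ν.cells.erase p) := by
  constructor
  · rintro ⟨h1, h2⟩
    refine ⟨removable_of_cells_eq_insert h2 h1.1, ?_⟩
    rw [h2, Finset.erase_insert (by rw [YoungDiagram.mem_cells]; exact h1.1)]
  · rintro ⟨h1, h2⟩
    have h3 : ν.cells = insert p μ.cells := by
      rw [h2, Finset.insert_erase ((YoungDiagram.mem_cells _).2 h1.1)]
    refine ⟨⟨?_, ?_⟩, h3⟩
    · rw [← YoungDiagram.mem_cells, h2]; simp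
    · rw [← h3]; exact ν.isLowerSet

/-- Addability of `q` involves only `q` and its upper and left neighbours, and these neighbours have
residues different from that of `q`. For removability the lower and right neighbours play this role.
-/
theorem addable_insert_iff {ℓ : ℕ} (hℓ : 3 ≤ ℓ) {μ ν : YoungDiagram} {p q : ℕ × ℕ}
    (h : ν.cells = insert p μ.cells) (hr : residue ℓ q = residue ℓ p) (hq : q ≠ p) :
    Addable ν q ↔ Addable μ q := by
  obtain ⟨a, b⟩ := q
  have h1 : ∀ c, a = c + 1 → (c, b) ≠ p := by
    rintro c rfl rfl
    exact residue_down_ne hℓ _ _ hr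
  have h2 : ∀ d, b = d + 1 → (a, d) ≠ p := by
    rintro d rfl rfl
    exact residue_right_ne hℓ _ _ hr
  simp only [addable_iff, mem_of_cells_eq_insert h]
  grind

theorem removable_insert_iff {ℓ : ℕ} (hℓ : 3 ≤ ℓ) {μ ν : YoungDiagram} {p q : ℕ × ℕ}
    (h : ν.cells = insert p μ.cells) (hr : residue ℓ q = residue ℓ p) (hq : q ≠ p) :
    Removable ν q ↔ Removable μ q := by
  obtain ⟨a, b⟩ := q
  have h1 : (a + 1, b) ≠ p := by
    rintro rfl
    exact residue_down_ne hℓ _ _ hr.symm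
  have h2 : (a, b + 1) ≠ p := by
    rintro rfl
    exact residue_right_ne hℓ _ _ hr.symm
  simp only [removable_iff, mem_of_cells_eq_insert h]
  grind

/-- A word sorted for an asymmetric order is determined by its set of letters. The lists of
positions read for two partitions differ, so their signatures are compared in this way. -/
theorem eq_of_pairwise_of_mem_iff {before : ℕ × ℕ → ℕ × ℕ → Prop}
    (hb : ∀ p q, before p q → ¬ before q p) {w w' : List (Sign × (ℕ × ℕ))}
    (h : w.Pairwise fun x y => before x.2 y.2) (h' : w'.Pairwise fun x y => before x.2 y.2)
    (hm : ∀ x, x ∈ w ↔ x ∈ w') : w = w' := by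
  have hn : ∀ {w : List (Sign × (ℕ × ℕ))}, (w.Pairwise fun x y => before x.2 y.2) →
      w.Nodup := fun h => h.imp fun hxy he => by
    rw [he] at hxy
    exact hb _ _ hxy hxy
  exact ((List.perm_ext_iff_of_nodup (hn h) (hn h')).2 hm).eq_of_pairwise
    (fun x y _ _ h1 h2 => absurd h2 (hb _ _ h1)) h h'

theorem mem_append_cons_iff {u v : List (Sign × (ℕ × ℕ))} {s : Sign} {p : ℕ × ℕ}
    (h : ((u ++ (s, p) :: v).map Prod.snd).Nodup) (t : Sign) (x : Sign × (ℕ × ℕ)) :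
    x ∈ u ++ (t, p) :: v ↔ x = (t, p) ∨ (x ∈ u ++ (s, p) :: v ∧ x.2 ≠ p) := by
  obtain ⟨hu, hv⟩ := notMem_of_nodup_split h
  have hu' : ∀ y ∈ u, y.2 ≠ p := fun y hy he => hu (he ▸ List.mem_map_of_mem hy)
  have hv' : ∀ y ∈ v, y.2 ≠ p := fun y hy he => hv (he ▸ List.mem_map_of_mem hy)
  simp only [List.mem_append, List.mem_cons]
  constructor
  · rintro (h | h | h)
    · exact Or.inr ⟨Or.inl h, hu' x h⟩
    · exact Or.inl h
    · exact Or.inr ⟨Or.inr (Or.inr h), hv' x h⟩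
  · rintro (h | ⟨h | rfl | h, hne⟩)
    · exact Or.inr (Or.inl h)
    · exact Or.inl h
    · exact absurd rfl hne
    · exact Or.inr (Or.inr h)

/-- Adding a box leaves all other signs of its residue unchanged and flips its own sign, in the same
place of the word. -/
theorem IsReading.signature_insert_iff {before : ℕ × ℕ → ℕ × ℕ → Prop}
    {reading : YoungDiagram → List (ℕ × ℕ)} (hr : IsReading before reading) {ℓ : ℕ}
    (hℓ : 3 ≤ ℓ) {μ ν : YoungDiagram} {p : ℕ × ℕ} (hp : Addable μ p)
    (h : ν.cells = insert p μ.cells) (u v : List (Sign × (ℕ × ℕ))) :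
    signature ℓ (residue ℓ p) μ (reading μ) = u ++ (Sign.plus, p) :: v ↔
      signature ℓ (residue ℓ p) ν (reading ν) = u ++ (Sign.minus, p) :: v := by
  have hpν := removable_of_cells_eq_insert h hp.1
  have hmem : ∀ x : Sign × (ℕ × ℕ), x.2 ≠ p →
      (x ∈ signature ℓ (residue ℓ p) μ (reading μ) ↔
        x ∈ signature ℓ (residue ℓ p) ν (reading ν)) := by
    rintro ⟨s, q⟩ hq
    cases s with
    | plus =>
      rw [hr.plus_mem, hr.plus_mem]
      exact and_congr_left fun hi => (addable_insert_iff hℓ h hi hq).symm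
    | minus =>
      rw [hr.minus_mem, hr.minus_mem]
      exact and_congr_left fun hi => (removable_insert_iff hℓ h hi hq).symm
  have hμ : ∀ x ∈ signature ℓ (residue ℓ p) μ (reading μ), x.2 = p → x = (Sign.plus, p) := by
    rintro ⟨s, q⟩ hx rfl
    cases s with
    | plus => rfl
    | minus => exact absurd (hr.minus_mem.1 hx).1 hp.not_removable
  have hν : ∀ x ∈ signature ℓ (residue ℓ p) ν (reading ν), x.2 = p → x = (Sign.minus, p) := by
    rintro ⟨s, q⟩ hx rfl
    cases s with
    | minus => rfl
    | plus => exact absurd hpν (hr.plus_mem.1 hx).1.not_removable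
  have hpw : ∀ s t : Sign,
      ((u ++ (s, p) :: v).Pairwise fun x y => before x.2 y.2) →
      (u ++ (t, p) :: v).Pairwise fun x y => before x.2 y.2 := by
    intro s t hs
    rw [← List.pairwise_map (f := Prod.snd)] at hs ⊢
    simpa using hs
  constructor
  · intro hw
    have hn := hr.nodup_map (ℓ := ℓ) (i := residue ℓ p) (μ := μ)
    have hs := signature_pairwise (ℓ := ℓ) (i := residue ℓ p) (μ := μ) (hr.sorted μ)
    refine eq_of_pairwise_of_mem_iff hr.asymm (signature_pairwise (hr.sorted ν))
      (hpw _ _ (hw ▸ hs)) fun x => ?_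
    rw [hw] at hn
    rw [mem_append_cons_iff hn, ← hw]
    constructor
    · intro hx
      by_cases hxp : x.2 = p
      · exact Or.inl (hν x hx hxp)
      · exact Or.inr ⟨(hmem x hxp).2 hx, hxp⟩
    · rintro (rfl | ⟨hx, hxp⟩)
      · exact hr.minus_mem.2 ⟨hpν, rfl⟩
      · exact (hmem x hxp).1 hx
  · intro hw
    have hn := hr.nodup_map (ℓ := ℓ) (i := residue ℓ p) (μ := ν)
    have hs := signature_pairwise (ℓ := ℓ) (i := residue ℓ p) (μ := ν) (hr.sorted ν)
    refine eq_of_pairwise_of_mem_iff hr.asymm (signature_pairwise (hr.sorted μ))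
      (hpw _ _ (hw ▸ hs)) fun x => ?_
    rw [hw] at hn
    rw [mem_append_cons_iff hn, ← hw]
    constructor
    · intro hx
      by_cases hxp : x.2 = p
      · exact Or.inl (hμ x hx hxp)
      · exact Or.inr ⟨(hmem x hxp).1 hx, hxp⟩
    · rintro (rfl | ⟨hx, hxp⟩)
      · exact hr.plus_mem.2 ⟨hp, rfl⟩
      · exact (hmem x hxp).2 hx

/-! ### Counting addable and removable boxes -/

open Classical in
noncomputable def addableBoxes (μ : YoungDiagram) : Finset (ℕ × ℕ) :=
  (Finset.range (μ.card + 1) ×ˢ Finset.range (μ.card + 1)).filter fun p => Addable μ p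

open Classical in
noncomputable def removableBoxes (μ : YoungDiagram) : Finset (ℕ × ℕ) :=
  μ.cells.filter fun p => Removable μ p

theorem mem_addableBoxes {μ : YoungDiagram} {p : ℕ × ℕ} :
    p ∈ addableBoxes μ ↔ Addable μ p := by
  classical
  rw [addableBoxes, Finset.mem_filter, and_iff_right_iff_imp]
  intro h
  have := h.add_le_card
  rw [Finset.mem_product, Finset.mem_range, Finset.mem_range]
  omega

theorem mem_removableBoxes {μ : YoungDiagram} {p : ℕ × ℕ} :
    p ∈ removableBoxes μ ↔ Removable μ p := by
  classical
  rw [removableBoxes, Finset.mem_filter, and_iff_right_iff_imp]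
  exact fun h => (YoungDiagram.mem_cells _).2 h.1

/-- Each position contributes equally to both sides, by the ways in which the boundary
of a partition can pass around its upper left corner. -/
theorem sum_boundary (μ : YoungDiagram) (g : ℕ × ℕ → ℕ) :
    ∑ p ∈ μ.cells, g p + ∑ p ∈ μ.cells, g (p.1 + 1, p.2 + 1) + ∑ p ∈ addableBoxes μ, g p =
      ∑ p ∈ μ.cells, g (p.1 + 1, p.2) + ∑ p ∈ μ.cells, g (p.1, p.2 + 1) +
        ∑ p ∈ removableBoxes μ, g (p.1 + 1, p.2 + 1) + g (0, 0) := by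
  classical
  -- A square that contains all positions occurring in any of the sums, so that the sums can be
  -- compared position by position.
  set B := Finset.range (μ.card + 2) ×ˢ Finset.range (μ.card + 2) with hB
  have hsum : ∀ (X : Finset (ℕ × ℕ)) (σ : ℕ × ℕ → ℕ × ℕ), Function.Injective σ →
      (∀ p ∈ X, σ p ∈ B) →
      ∑ p ∈ X, g (σ p) = ∑ q ∈ B, if q ∈ X.image σ then g q else 0 := by
    intro X σ hσ hX
    rw [Finset.sum_ite_mem, Finset.inter_eq_right.2 (Finset.image_subset_iff.2 hX),
      Finset.sum_image fun _ _ _ _ h => hσ h]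
  have hcell : ∀ p ∈ μ.cells, p.1 + p.2 < μ.card := fun p hp =>
    add_lt_card ((YoungDiagram.mem_cells _).1 hp)
  have hadd : ∀ p ∈ addableBoxes μ, p.1 + p.2 ≤ μ.card := fun p hp =>
    (mem_addableBoxes.1 hp).add_le_card
  have hrem : ∀ p ∈ removableBoxes μ, p.1 + p.2 < μ.card := fun p hp =>
    add_lt_card (mem_removableBoxes.1 hp).1
  have hmemB : ∀ p : ℕ × ℕ, p.1 < μ.card + 2 → p.2 < μ.card + 2 → p ∈ B := by
    intro p h1 h2
    rw [hB, Finset.mem_product, Finset.mem_range, Finset.mem_range]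
    exact ⟨h1, h2⟩
  have h0 : g (0, 0) = ∑ q ∈ B, if q = (0, 0) then g q else 0 := by
    rw [Finset.sum_ite_eq' B (0, 0) g, if_pos (hmemB _ (by simp) (by simp))]
  have h1 := hsum μ.cells id Function.injective_id
    fun p hp => hmemB _ (by have := hcell p hp; simp; omega) (by have := hcell p hp; simp; omega)
  have h2 := hsum (addableBoxes μ) id Function.injective_id
    fun p hp => hmemB _ (by have := hadd p hp; simp; omega) (by have := hadd p hp; simp; omega)
  have inj : ∀ x y : ℕ, Function.Injective fun p : ℕ × ℕ => (p.1 + x, p.2 + y) := by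
    rintro x y ⟨a, b⟩ ⟨c, d⟩ h
    simpa using h
  have h3 := hsum μ.cells _ (inj 1 1)
    fun p hp => hmemB _ (by have := hcell p hp; simp; omega) (by have := hcell p hp; simp; omega)
  have h4 := hsum μ.cells _ (inj 1 0)
    fun p hp => hmemB _ (by have := hcell p hp; simp; omega) (by have := hcell p hp; simp; omega)
  have h5 := hsum μ.cells _ (inj 0 1)
    fun p hp => hmemB _ (by have := hcell p hp; simp; omega) (by have := hcell p hp; simp; omega)
  have h6 := hsum (removableBoxes μ) _ (inj 1 1)
    fun p hp => hmemB _ (by have := hrem p hp; simp; omega) (by have := hrem p hp; simp; omega)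
  simp only [id, add_zero] at h1 h2 h4 h5
  rw [h0, h1, h2, h3, h4, h5, h6]
  simp only [← Finset.sum_add_distrib]
  refine Finset.sum_congr rfl ?_
  rintro ⟨a, b⟩ -
  have i11 : ∀ X : Finset (ℕ × ℕ), ∀ a b : ℕ,
      (a + 1, b + 1) ∈ X.image (fun p => (p.1 + 1, p.2 + 1)) ↔ (a, b) ∈ X := by
    intro X a b
    simp
  have i10 : ∀ X : Finset (ℕ × ℕ), ∀ a b : ℕ,
      (a + 1, b) ∈ X.image (fun p => (p.1 + 1, p.2)) ↔ (a, b) ∈ X := by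
    intro X a b
    simp
  have i01 : ∀ X : Finset (ℕ × ℕ), ∀ a b : ℕ,
      (a, b + 1) ∈ X.image (fun p => (p.1, p.2 + 1)) ↔ (a, b) ∈ X := by
    intro X a b
    simp
  have n1 : ∀ X : Finset (ℕ × ℕ), ∀ b y : ℕ,
      ¬ (0, b) ∈ X.image (fun p => (p.1 + 1, p.2 + y)) := by
    intro X b y
    simp
  have n2 : ∀ X : Finset (ℕ × ℕ), ∀ a x : ℕ,
      ¬ (a, 0) ∈ X.image (fun p => (p.1 + x, p.2 + 1)) := by
    intro X a x
    simp
  have n1' := fun X b => n1 X b 0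
  have n2' := fun X a => n2 X a 0
  have iid : ∀ X : Finset (ℕ × ℕ), X.image id = X := fun X => Finset.image_id
  simp only [add_zero] at n1' n2'
  -- On the first row and first column some shifted images cannot reach the position. At the corner
  -- none can, which accounts for the term `g (0, 0)`.
  rcases a with _ | a <;> rcases b with _ | b
  · have hA : (0, 0) ∈ addableBoxes μ ↔ (0, 0) ∉ μ := by
      rw [mem_addableBoxes, addable_iff]; simp
    by_cases h : (0, 0) ∈ μ <;>
      simp [n1, n1', n2', iid, hA, h, -Finset.mem_image]
  · have hA : (0, b + 1) ∈ addableBoxes μ ↔ (0, b + 1) ∉ μ ∧ (0, b) ∈ μ := by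
      rw [mem_addableBoxes, addable_iff]; simp
    have hl : (0, b + 1) ∈ μ → (0, b) ∈ μ := μ.up_left_mem le_rfl (by simp)
    simp only [n1, n1', iid, hA, i01, YoungDiagram.mem_cells]
    by_cases h : (0, b + 1) ∈ μ
    · simp [h, hl h]
    · by_cases h' : (0, b) ∈ μ <;> simp [h, h']
  · have hA : (a + 1, 0) ∈ addableBoxes μ ↔ (a + 1, 0) ∉ μ ∧ (a, 0) ∈ μ := by
      rw [mem_addableBoxes, addable_iff]; simp
    have hl : (a + 1, 0) ∈ μ → (a, 0) ∈ μ := μ.up_left_mem (by simp) le_rfl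
    simp only [n2, n2', iid, hA, i10, YoungDiagram.mem_cells]
    by_cases h : (a + 1, 0) ∈ μ
    · simp [h, hl h]
    · by_cases h' : (a, 0) ∈ μ <;> simp [h, h']
  · have hA : (a + 1, b + 1) ∈ addableBoxes μ ↔
        (a + 1, b + 1) ∉ μ ∧ (a, b + 1) ∈ μ ∧ (a + 1, b) ∈ μ := by
      rw [mem_addableBoxes, addable_iff]; simp
    have hR : (a, b) ∈ removableBoxes μ ↔
        (a, b) ∈ μ ∧ (a + 1, b) ∉ μ ∧ (a, b + 1) ∉ μ := by
      rw [mem_removableBoxes, removable_iff]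
    have e1 : (a + 1, b + 1) ∈ μ → (a, b + 1) ∈ μ := μ.up_left_mem (by simp) le_rfl
    have e2 : (a + 1, b + 1) ∈ μ → (a + 1, b) ∈ μ := μ.up_left_mem le_rfl (by simp)
    have e3 : (a, b + 1) ∈ μ → (a, b) ∈ μ := μ.up_left_mem le_rfl (by simp)
    have e4 : (a + 1, b) ∈ μ → (a, b) ∈ μ := μ.up_left_mem (by simp) le_rfl
    simp only [iid, i11, i10, i01, hA, hR, YoungDiagram.mem_cells]
    by_cases c1 : (a + 1, b + 1) ∈ μ
    · simp [c1, e1 c1, e2 c1, e3 (e1 c1)]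
    · by_cases c2 : (a, b + 1) ∈ μ
      · by_cases c3 : (a + 1, b) ∈ μ <;> simp [c1, c2, c3, e3 c2]
      · by_cases c3 : (a + 1, b) ∈ μ
        · simp [c1, c2, c3, e4 c3]
        · by_cases c4 : (a, b) ∈ μ <;> simp [c1, c2, c3, c4]

theorem countP_eq_card {w : List (Sign × (ℕ × ℕ))} (hw : (w.map Prod.snd).Nodup)
    (P : Sign × (ℕ × ℕ) → Bool) (s : Finset (ℕ × ℕ))
    (hs : ∀ p, p ∈ s ↔ ∃ x ∈ w, P x = true ∧ x.2 = p) : w.countP P = s.card := by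
  rw [List.countP_eq_length_filter, ← List.length_map (f := Prod.snd)]
  have hn : ((w.filter P).map Prod.snd).Nodup :=
    hw.sublist (List.filter_sublist.map _)
  rw [← List.toFinset_card_of_nodup hn]
  congr 1
  ext p
  simp only [List.mem_toFinset, List.mem_map, List.mem_filter, hs, and_assoc]

section Reading

variable {before : ℕ × ℕ → ℕ × ℕ → Prop} {reading : YoungDiagram → List (ℕ × ℕ)}
  {ℓ : ℕ} {i : ZMod ℓ} {μ : YoungDiagram}

theorem IsReading.countP_plus (hr : IsReading before reading) (Q : ℕ × ℕ → Bool) :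
    (signature ℓ i μ (reading μ)).countP (fun s => s.1.isPlus && Q s.2) =
      ((addableBoxes μ).filter fun p => residue ℓ p = i ∧ Q p = true).card := by
  refine countP_eq_card hr.nodup_map _ _ fun p => ?_
  rw [Finset.mem_filter, mem_addableBoxes, ← and_assoc, ← hr.plus_mem]
  constructor
  · exact fun h => ⟨_, h.1, by simpa using h.2, rfl⟩
  · rintro ⟨⟨s, q⟩, hx, hs, rfl⟩
    cases s with
    | plus => exact ⟨hx, by simpa using hs⟩
    | minus => simp at hs

theorem IsReading.countP_minus (hr : IsReading before reading) (Q : ℕ × ℕ → Bool) :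
    (signature ℓ i μ (reading μ)).countP (fun s => !s.1.isPlus && Q s.2) =
      ((removableBoxes μ).filter fun p => residue ℓ p = i ∧ Q p = true).card := by
  refine countP_eq_card hr.nodup_map _ _ fun p => ?_
  rw [Finset.mem_filter, mem_removableBoxes, ← and_assoc, ← hr.minus_mem]
  constructor
  · exact fun h => ⟨_, h.1, by simpa using h.2, rfl⟩
  · rintro ⟨⟨s, q⟩, hx, hs, rfl⟩
    cases s with
    | minus => exact ⟨hx, by simpa using hs⟩
    | plus => simp at hs

/-- The form that matches the sums over cells in `sum_boundary`. For `3 ≤ ℓ` the classes `j`, `j +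
1`, `j - 1` are distinct, so at most one indicator is nonzero. -/
theorem cartan_eq {ℓ : ℕ} (hℓ : 3 ≤ ℓ) (i j : ZMod ℓ) :
    cartan ℓ i j =
      2 * (if j = i then 1 else 0) - (if j + 1 = i then 1 else 0) -
        (if j - 1 = i then 1 else 0) := by
  have h1 := zmod_one_ne_zero hℓ
  have h2 : (2 : ZMod ℓ) ≠ 0 := by
    have : ((2 : ℕ) : ZMod ℓ) ≠ 0 := by
      rw [Ne, ZMod.natCast_eq_zero_iff]
      exact fun h => absurd (Nat.le_of_dvd (by simp) h) (by omega)
    exact_mod_cast this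
  have e1 : ∀ j : ZMod ℓ, j + 1 ≠ j := fun j h => h1 (by simpa using h)
  have e2 : ∀ j : ZMod ℓ, j - 1 ≠ j := fun j h => h1 (by simpa using h)
  have e3 : ∀ j : ZMod ℓ, j + 1 ≠ j - 1 := fun j h => h2 (by linear_combination h)
  have e4 : j = i + 1 ↔ j - 1 = i := sub_eq_iff_eq_add.symm
  simp only [cartan, e4]
  by_cases a1 : j = i
  · subst a1
    simp [e1, e2]
  · by_cases a2 : j + 1 = i
    · subst a2
      simp [(e1 j).symm, (e1 j), (e3 j).symm]
    · by_cases a3 : j - 1 = i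
      · subst a3
        simp [(e2 j).symm, e2 j, e3 j]
      · simp [a1, a2, a3, eq_comm]
        grind

/-- This is `sum_boundary` for the indicator of residue `i`. Diagonal shifts keep residues, whence
the coefficient `2`; the shifts down and right give the two coefficients `-1`, and the corner gives
`Λ₀`. -/
theorem pairing_weight {ℓ : ℕ} (hℓ : 3 ≤ ℓ) (μ : YoungDiagram) (i : ZMod ℓ) :
    (((addableBoxes μ).filter fun p => residue ℓ p = i).card : ℤ) =
      ((removableBoxes μ).filter fun p => residue ℓ p = i).card +
        (weight ℓ μ).pairing i := by
  have h := sum_boundary μ fun p => if residue ℓ p = i then 1 else 0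
  have hd : ∀ p : ℕ × ℕ, residue ℓ (p.1 + 1, p.2 + 1) = residue ℓ p := by
    intro p
    rw [residue_right, residue_down]
    ring
  simp only [hd, residue_down, residue_right] at h
  simp only [Weight.pairing, weight, fundamentalWeight, simpleRoot, Prod.fst_sub, Prod.fst_sum,
    Pi.sub_apply, Finset.sum_apply, cartan_eq hℓ, Finset.sum_sub_distrib, ← Finset.mul_sum]
  rw [Finset.card_filter, Finset.card_filter]
  have h0 : residue ℓ (0, 0) = 0 := by simp [residue]
  rw [h0] at h
  have hs : (Pi.single (0 : ZMod ℓ) (1 : ℤ) : ZMod ℓ → ℤ) i =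
      ((if (0 : ZMod ℓ) = i then 1 else 0 : ℕ) : ℤ) := by
    rw [Pi.single_apply]
    simp [eq_comm]
  rw [hs]
  zify at h
  push_cast at h ⊢
  linarith

/-! ### Kashiwara's axioms -/

/-- Only the stability of the nodes depends on the particular crystal. That the operators are
mutually inverse holds for all partitions and is kept as a separate conclusion, since it is also
needed before the nodes are known. -/
theorem IsReading.isCrystal (hr : IsReading before reading) (hℓ : 3 ≤ ℓ)
    {node : Set YoungDiagram}
    (he : ∀ i, ∀ x ∈ node, ∀ y, removeGood ℓ reading i x = some y → y ∈ node)
    (hf : ∀ i, ∀ x ∈ node, ∀ y, addCogood ℓ reading i x = some y → y ∈ node) :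
    (∀ i x y, removeGood ℓ reading i x = some y ↔ addCogood ℓ reading i y = some x) ∧
      IsCrystal (crystalOfReading ℓ node reading) := by
  have hiff : ∀ i x y, removeGood ℓ reading i x = some y ↔ addCogood ℓ reading i y = some x := by
    intro i x y
    rw [hr.removeGood_eq_some_iff, hr.addCogood_eq_some_iff]
    refine exists_congr fun p => exists_congr fun u => exists_congr fun v => ?_
    constructor
    · rintro ⟨h1, rfl, h2, h3, h4⟩
      obtain ⟨h5, h6⟩ := cells_eq_insert_iff.2 ⟨h1, h2⟩
      exact ⟨h5, rfl, h6, (hr.signature_insert_iff hℓ h5 h6 u v).2 h3, h4⟩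
    · rintro ⟨h1, rfl, h2, h3, h4⟩
      obtain ⟨h5, h6⟩ := cells_eq_insert_iff.1 ⟨h1, h2⟩
      exact ⟨h5, rfl, h6, (hr.signature_insert_iff hℓ h1 h2 u v).1 h3, h4⟩
  have key : ∀ i x y, addCogood ℓ reading i x = some y →
      weight ℓ y = weight ℓ x - simpleRoot ℓ i ∧
      (normalBoxes (signature ℓ i y (reading y))).length =
        (normalBoxes (signature ℓ i x (reading x))).length + 1 ∧
      (conormalBoxes (signature ℓ i x (reading x))).length =
        (conormalBoxes (signature ℓ i y (reading y))).length + 1 := by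
    intro i x y h
    obtain ⟨p, u, v, h1, rfl, h2, h3, h4, h5⟩ := hr.addCogood_eq_some_iff.1 h
    refine ⟨?_, ?_⟩
    · rw [weight, weight, h2, Finset.sum_insert (by rw [YoungDiagram.mem_cells]; exact h1.1)]
      abel
    -- No `-` of `u` and no `+` of `v` survives, so the two reduced words consist of the `+` of `u`,
    -- the sign of `p`, and the `-` of `v`.
    · rw [(hr.signature_insert_iff hℓ h1 h2 u v).1 h3, h3]
      simp only [boxes_append, h4, h5, conormalBoxes_plus, normalBoxes_plus,
        conormalBoxes_minus, normalBoxes_minus_of_nil h5]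
      simp
  refine ⟨hiff, he, hf, fun i x _ y _ => hiff i x y, ?_, ?_, ?_, ?_, ?_, ?_, ?_⟩
  · intro i x _ y h
    change weight ℓ y = weight ℓ x + _
    rw [(key i y x ((hiff i x y).1 h)).1]
    abel
  · exact fun i x _ y h => (key i y x ((hiff i x y).1 h)).2.1
  · exact fun i x _ y h => (key i y x ((hiff i x y).1 h)).2.2
  · exact fun i x _ y h => (key i x y h).1
  · exact fun i x _ y h => (key i x y h).2.1
  · exact fun i x _ y h => (key i x y h).2.2
  · intro i x _
    have h1 := length_boxes (signature ℓ i x (reading x))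
    have h2 := hr.countP_plus (ℓ := ℓ) (i := i) (μ := x) fun _ => true
    have h3 := hr.countP_minus (ℓ := ℓ) (i := i) (μ := x) fun _ => true
    have h4 := pairing_weight hℓ x i
    simp only [Bool.and_true, and_true] at h2 h3
    rw [h2, h3] at h1
    change ((conormalBoxes (signature ℓ i x (reading x))).length : ℤ) =
      (normalBoxes (signature ℓ i x (reading x))).length + (weight ℓ x).pairing i
    omega

end Reading

/-! ### Vanishing of the operators -/

section Reading

variable {before : ℕ × ℕ → ℕ × ℕ → Prop} {reading : YoungDiagram → List (ℕ × ℕ)}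
  {ℓ : ℕ} {i : ZMod ℓ} {μ : YoungDiagram}

/-- The cogood box is addable, so `ofBoxes` cannot fail there: the value is `none` only for lack of
a `+`. -/
theorem IsReading.addCogood_eq_none_iff (hr : IsReading before reading) :
    addCogood ℓ reading i μ = none ↔ conormalBoxes (signature ℓ i μ (reading μ)) = [] := by
  rw [addCogood, Option.bind_eq_none_iff]
  constructor
  · intro h
    by_contra hc
    have h1 := List.getLast?_eq_some_getLast hc
    have h2 := (hr.plus_mem.1 ((mem_of_mem_boxes _ _).1 (List.mem_of_getLast? h1))).1
    have h3 := ofBoxes_eq_some_iff.2 (show YoungDiagram.cells ⟨_, h2.2⟩ = _ from rfl)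
    rw [h _ h1] at h3
    simp at h3
  · intro h p hp
    rw [h] at hp
    simp at hp

theorem IsReading.removeGood_eq_none_iff (hr : IsReading before reading) :
    removeGood ℓ reading i μ = none ↔ normalBoxes (signature ℓ i μ (reading μ)) = [] := by
  rw [removeGood, Option.bind_eq_none_iff]
  constructor
  · intro h
    by_contra hc
    have h1 := List.head?_eq_some_head hc
    have h2 := (hr.minus_mem.1 ((mem_of_mem_boxes _ _).2 (List.mem_of_mem_head? h1))).1
    have h3 := ofBoxes_eq_some_iff.2 (show YoungDiagram.cells ⟨_, h2.2⟩ = _ from rfl)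
    rw [h _ h1] at h3
    simp at h3
  · intro h p hp
    rw [h] at hp
    simp at hp

end Reading

theorem mem_of_cells_eq_erase {μ ν : YoungDiagram} {p : ℕ × ℕ}
    (h : ν.cells = μ.cells.erase p) (q : ℕ × ℕ) : q ∈ ν ↔ q ≠ p ∧ q ∈ μ := by
  rw [← YoungDiagram.mem_cells, h, Finset.mem_erase, YoungDiagram.mem_cells]

theorem residue_eq_iff {ℓ : ℕ} (hℓ : 3 ≤ ℓ) {p q : ℕ × ℕ} :
    residue ℓ p = residue ℓ q ↔ ladderIndex ℓ p % ℓ = ladderIndex ℓ q % ℓ := by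
  rw [residue_eq_neg_ladderIndex hℓ, residue_eq_neg_ladderIndex hℓ, neg_inj,
    ZMod.natCast_eq_natCast_iff']

theorem residue_eq_of_ladderIndex_eq {ℓ : ℕ} (hℓ : 3 ≤ ℓ) {p q : ℕ × ℕ}
    (h : ladderIndex ℓ p = ladderIndex ℓ q) : residue ℓ p = residue ℓ q :=
  (residue_eq_iff hℓ).2 (by rw [h])

/-- A box of residue `i` that is read between two ladders of residue `i` at distance `ℓ` must lie on
one of them. -/
theorem eq_or_eq_of_mod_eq {ℓ j k : ℕ} (h : j % ℓ = k % ℓ) (h1 : k ≤ j) (h2 : j ≤ k + ℓ) :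
    j = k ∨ j = k + ℓ := by
  obtain ⟨t, rfl⟩ := Nat.exists_eq_add_of_le h1
  have hd : ℓ ∣ t := by
    have := (Nat.modEq_iff_dvd' h1).1 (show k % ℓ = (k + t) % ℓ from h.symm)
    simpa using this
  obtain ⟨m, rfl⟩ := hd
  rcases Nat.eq_zero_or_pos ℓ with rfl | hpos
  · left; simp
  · have hm : m ≤ 1 := by
      by_contra hm
      have := Nat.mul_le_mul_left ℓ (show 2 ≤ m by omega)
      omega
    interval_cases m <;> simp

/-! ### Tight partitions -/

/-- There are no two positions of a ladder such that the higher one is the last box of its row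
and the lower one is the first unoccupied position of its column. -/
def IsTight (ℓ : ℕ) (μ : YoungDiagram) : Prop :=
  ∀ a b c d, ladderIndex ℓ (a, b) = ladderIndex ℓ (c + 1, d) → a < c + 1 →
    (a, b) ∈ μ → (a, b + 1) ∉ μ → (c, d) ∈ μ → (c + 1, d) ∈ μ

section Tight

variable {ℓ : ℕ} {i : ZMod ℓ} {μ ν : YoungDiagram}

/-- A removable box ends its row, and the box above an addable position is occupied; this is the
configuration that tightness excludes. -/
theorem IsTight.not_removable_above_addable (hμ : IsTight ℓ μ) {p q : ℕ × ℕ}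
    (hl : ladderIndex ℓ p = ladderIndex ℓ q) (hpq : p.1 < q.1) (hp : Removable μ p) :
    ¬ Addable μ q := by
  intro hq
  obtain ⟨a, b⟩ := p
  obtain ⟨c, d⟩ := q
  obtain ⟨c, rfl⟩ : ∃ c', c = c' + 1 := ⟨c - 1, by simp only at hpq; omega⟩
  rw [removable_iff] at hp
  rw [addable_iff] at hq
  exact hq.1 (hμ a b c d hl hpq hp.1 hp.2.2 (hq.2.1 c rfl))

theorem isTight_bot : IsTight ℓ ⊥ := fun _ _ _ _ _ _ h => absurd h (YoungDiagram.notMem_bot _)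

/-- A new violation involves the added box, either as the end of its row or as the box above the
gap. It then yields an addable box of residue `i` read after the cogood one, unless it can be moved
to a violation in `μ`. The removable box that separates the two contradicts the tightness of `μ`. -/
theorem IsTight.addCogood (hℓ : 3 ≤ ℓ) (hμ : IsTight ℓ μ)
    (h : addCogood ℓ (ladderReading ℓ) i μ = some ν) : IsTight ℓ ν := by
  have hr := isReading_ladderReading hℓ
  obtain ⟨⟨x, y⟩, u, v, hadd, hi, hν, hw, -, hv⟩ := hr.addCogood_eq_some_iff.1 h
  have hbetween := fun q => hr.exists_removable_between (q := q) hw hv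
  have hm := mem_of_cells_eq_insert hν
  have hadd' := addable_iff.1 hadd
  intro a b c d hl hac h1 h2 h3
  by_contra h4
  rw [hm, not_or] at h2 h4
  rw [hm] at h1 h3
  rcases h1 with h1 | h1
  · simp only [Prod.mk.injEq] at h1
    obtain ⟨rfl, rfl⟩ := h1
    have hcd : (c, d) ∈ μ := by
      refine h3.resolve_left fun he => ?_
      rw [ladderIndex_down, he] at hl
      omega
    -- If the gap `(c + 1, d)` has its left neighbour, it is addable and on the ladder of the new
    -- box. Otherwise moving the whole configuration one column to the left violates tightness in
    -- `μ`.
    by_cases hleft : ∀ d', d = d' + 1 → (c + 1, d') ∈ μ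
    · obtain ⟨r, hrem, hri, hb1, hb2⟩ := hbetween (c + 1, d)
        (addable_iff.2 ⟨h4.2, fun c' hc' => by obtain rfl : c = c' := by omega
                                               exact hcd, hleft⟩)
        ((residue_eq_of_ladderIndex_eq hℓ hl).symm.trans hi) (Or.inr ⟨hl, hac⟩)
      simp only [LadderBefore] at hb1 hb2
      exact hμ.not_removable_above_addable (p := r) (q := (c + 1, d)) (by omega)
        (by simp only; omega) hrem
        (addable_iff.2 ⟨h4.2, fun c' hc' => by obtain rfl : c = c' := by omega
                                               exact hcd, hleft⟩)
    · push Not at hleft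
      obtain ⟨d, rfl, hleft⟩ := hleft
      obtain ⟨b, rfl⟩ : ∃ b', b = b' + 1 := by
        rcases b with _ | b
        · simp only [ladderIndex] at hl; omega
        · exact ⟨b, rfl⟩
      rw [ladderIndex_right, ladderIndex_right] at hl
      exact hleft (hμ a b c d (by omega) hac (hadd'.2.2 b rfl) hadd'.1
        (μ.up_left_mem le_rfl (by simp) hcd))
  · rcases h3 with h3 | h3
    · simp only [Prod.mk.injEq] at h3
      obtain ⟨rfl, rfl⟩ := h3
      obtain ⟨m, hm1, hm2⟩ := exists_of_ladderIndex_eq hℓ hl hac.le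
      have hm0 : (ℓ - 1) ≤ (ℓ - 1) * m := by
        rcases m with _ | m
        · omega
        · exact Nat.le_mul_of_pos_right _ (by omega)
      obtain ⟨c, rfl⟩ : ∃ c', c = c' + 1 := ⟨c - 1, by omega⟩
      rw [ladderIndex_down] at hl
      -- The position to the right of the row end lies `ℓ` ladders after the new box. The separating
      -- removable box is on one of these two ladders, and both cases contradict tightness.
      have hadd2 : Addable μ (a, b + 1) := by
        refine addable_iff.2 ⟨h2.2, ?_, ?_⟩
        · rintro a rfl
          by_contra hn
          rw [ladderIndex_down] at hl
          exact hadd'.1 (hμ a b c d (by omega) (by omega) (μ.up_left_mem (by simp) le_rfl h1)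
            hn (hadd'.2.1 c rfl))
        · intro b' hb'
          obtain rfl : b = b' := by omega
          exact h1
      have hli : ladderIndex ℓ (a, b + 1) = ladderIndex ℓ (c + 1, d) + ℓ := by
        rw [ladderIndex_right]; omega
      have hres : residue ℓ (a, b + 1) = i := by
        rw [← hi, residue_eq_iff hℓ, hli, Nat.add_mod_right]
      obtain ⟨⟨e, f⟩, hrem, hri, hb1, hb2⟩ := hbetween (a, b + 1) hadd2 hres
        (Or.inl (by omega))
      rw [← hi, residue_eq_iff hℓ] at hri
      simp only [LadderBefore] at hb1 hb2
      rcases eq_or_eq_of_mod_eq hri (by omega) (by omega) with hc | hc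
      · have hrem' := removable_iff.1 hrem
        exact hrem'.2.1 (hμ a b e f (by rw [ladderIndex_down]; omega) (by omega) h1 h2.2
          hrem'.1)
      · exact hμ.not_removable_above_addable (p := (e, f)) (q := (a, b + 1)) (by omega)
          (by simp only; omega) hrem hadd2
    · exact h4.2 (hμ a b c d hl hac h1 h2.2 h3)

/-- Dual to `IsTight.addCogood`: a new violation arises because the removed box was to the right of
the row end or was the gap itself. It yields a removable box of residue `i` read before the good
one, or moves to a violation in `μ`. The separating addable box again contradicts tightness. -/
theorem IsTight.removeGood (hℓ : 3 ≤ ℓ) (hμ : IsTight ℓ μ)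
    (h : removeGood ℓ (ladderReading ℓ) i μ = some ν) : IsTight ℓ ν := by
  have hr := isReading_ladderReading hℓ
  obtain ⟨⟨x, y⟩, u, v, hrem, hi, hν, hw, hu, -⟩ := hr.removeGood_eq_some_iff.1 h
  have hbetween := fun q => hr.exists_addable_between (q := q) hw hu
  have hm := mem_of_cells_eq_erase hν
  have hrem' := removable_iff.1 hrem
  intro a b c d hl hac h1 h2 h3
  by_contra h4
  rw [hm] at h1 h3
  rw [hm, not_and'] at h2 h4
  obtain ⟨-, h1⟩ := h1
  obtain ⟨-, h3⟩ := h3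
  by_cases h2' : (a, b + 1) ∈ μ
  · have he := not_not.1 (h2 h2')
    simp only [Prod.mk.injEq] at he
    obtain ⟨rfl, rfl⟩ := he
    have hlr := ladderIndex_right ℓ a b
    have h4' : (c + 1, d) ∉ μ := by
      intro h5
      have := not_not.1 (h4 h5)
      rw [this] at hl
      omega
    have hremcd : Removable μ (c, d) := by
      refine removable_iff.2 ⟨h3, h4', fun h5 => h4' ?_⟩
      refine μ.up_left_mem le_rfl (Nat.le_succ d) (hμ a (b + 1) c (d + 1) ?_ hac h2' hrem'.2.2 h5)
      rw [ladderIndex_right, ladderIndex_right]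
      omega
    rw [ladderIndex_down] at hl
    have hli : ladderIndex ℓ (a, b + 1) = ladderIndex ℓ (c, d) + ℓ := by omega
    have hres : residue ℓ (c, d) = i := by
      rw [← hi, residue_eq_iff hℓ, hli, Nat.add_mod_right]
    obtain ⟨⟨e, f⟩, hadd, hri, hb1, hb2⟩ := hbetween (c, d) hremcd hres (Or.inl (by omega))
    rw [← hres, residue_eq_iff hℓ] at hri
    simp only [LadderBefore] at hb1 hb2
    rcases eq_or_eq_of_mod_eq hri (by omega) (by omega) with hc | hc
    · exact hμ.not_removable_above_addable (p := (c, d)) (q := (e, f)) (by omega)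
        (by simp only; omega) hremcd hadd
    · have hea : e < a := by omega
      obtain ⟨f, rfl⟩ : ∃ f', f = f' + 1 := by
        rcases f with _ | f
        · rw [← hli] at hc
          simp only [ladderIndex] at hc
          omega
        · exact ⟨f, rfl⟩
      -- The left neighbour of the separating addable position ends its row and lies on the ladder
      -- of the gap `(c + 1, d)`, above it.
      have hadd' := addable_iff.1 hadd
      rw [ladderIndex_right] at hc
      exact h4' (hμ e f c d (by rw [ladderIndex_down]; omega) (by omega) (hadd'.2.2 f rfl)
        hadd'.1 h3)
  · have h4' := hμ a b c d hl hac h1 h2' h3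
    have he := not_not.1 (h4 h4')
    simp only [Prod.mk.injEq] at he
    obtain ⟨rfl, rfl⟩ := he
    by_cases hdown : (a + 1, b) ∈ μ
    · refine hrem'.2.1 (hμ (a + 1) b (c + 1) d ?_ (by omega) hdown
        (fun h5 => h2' (μ.up_left_mem (by simp) le_rfl h5)) h4')
      rw [ladderIndex_down, ladderIndex_down, hl]
    · have hremab : Removable μ (a, b) := removable_iff.2 ⟨h1, hdown, h2'⟩
      obtain ⟨r, hadd, hri, hb1, hb2⟩ := hbetween (a, b) hremab
        ((residue_eq_of_ladderIndex_eq hℓ hl).trans hi) (Or.inr ⟨hl, hac⟩)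
      simp only [LadderBefore] at hb1 hb2
      exact hμ.not_removable_above_addable (p := (a, b)) (q := r) (by omega)
        (by simp only; omega) hremab hadd

end Tight

/-! ### Regular partitions -/

section Regular

variable {ℓ : ℕ} {i : ZMod ℓ} {μ ν : YoungDiagram}

theorem count_rowLens (μ : YoungDiagram) (k : ℕ) :
    μ.rowLens.count k = ((Finset.range (μ.colLen 0)).filter fun a => μ.rowLen a = k).card := by
  rw [YoungDiagram.rowLens, List.count, List.countP_map, List.countP_eq_length_filter]
  simp only [Finset.card, Finset.filter, Finset.range, Multiset.range, Multiset.filter_coe,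
    Multiset.coe_card, Function.comp_def, beq_eq_decide]

/-- A partition is regular if and only if its boxes are at the top of their ladders. -/
theorem isRegular_iff (hℓ : 3 ≤ ℓ) : IsRegular ℓ μ ↔
    ∀ a b c d, ladderIndex ℓ (a, b) = ladderIndex ℓ (c, d) → a ≤ c → (c, d) ∈ μ →
      (a, b) ∈ μ := by
  constructor
  · intro h
    -- Otherwise the `ℓ` rows from `a` to `a + (ℓ - 1)` would all have length `b + 1`.
    have step : ∀ a b, (a, b + 1) ∉ μ → (a + (ℓ - 1), b) ∉ μ := by
      intro a b h1 h2
      have h3 := h (b + 1)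
      rw [count_rowLens] at h3
      have h4 : Finset.Icc a (a + (ℓ - 1)) ⊆
          (Finset.range (μ.colLen 0)).filter fun a => μ.rowLen a = b + 1 := by
        intro t ht
        rw [Finset.mem_Icc] at ht
        rw [Finset.mem_filter, Finset.mem_range, ← YoungDiagram.mem_iff_lt_colLen]
        rw [YoungDiagram.mem_iff_lt_rowLen] at h1 h2
        have h5 := μ.rowLen_anti _ _ ht.1
        have h6 := μ.rowLen_anti _ _ ht.2
        refine ⟨YoungDiagram.mem_iff_lt_rowLen.2 (by omega), by omega⟩
      have h5 := Finset.card_le_card h4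
      rw [Nat.card_Icc] at h5
      omega
    have steps : ∀ m a d, (a, d + m) ∉ μ → (a + (ℓ - 1) * m, d) ∉ μ := by
      intro m
      induction m with
      | zero => exact fun a d h => by simpa using h
      | succ m ih =>
        intro a d h1
        have h2 := ih _ _ (step a (d + m) h1)
        rwa [mul_add, mul_one, add_comm _ (ℓ - 1), ← add_assoc]
    intro a b c d hl hac hcd
    obtain ⟨m, rfl, rfl⟩ := exists_of_ladderIndex_eq hℓ hl hac
    exact not_not.1 fun hn => steps _ _ _ hn hcd
  · intro h k
    rw [count_rowLens]
    by_contra hk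
    rw [not_lt] at hk
    -- With `ℓ` rows of length `k = j + 1`, the first and the last are at least `ℓ - 1` apart. So
    -- column `j` is occupied `ℓ - 1` rows below the first, while the next position up that ladder,
    -- just beyond the end of the first row, is not.
    set F := (Finset.range (μ.colLen 0)).filter fun a => μ.rowLen a = k with hF
    have hne : F.Nonempty := Finset.card_pos.1 (by omega)
    have hmem : ∀ t ∈ F, (t, 0) ∈ μ ∧ μ.rowLen t = k := by
      intro t ht
      rw [hF, Finset.mem_filter, Finset.mem_range, ← YoungDiagram.mem_iff_lt_colLen] at ht
      exact ht
    have h0 := hmem _ (F.min'_mem hne)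
    have h1 := hmem _ (F.max'_mem hne)
    have hsub : F ⊆ Finset.Icc (F.min' hne) (F.max' hne) := fun t ht =>
      Finset.mem_Icc.2 ⟨F.min'_le t ht, F.le_max' t ht⟩
    have hcard := Finset.card_le_card hsub
    rw [Nat.card_Icc] at hcard
    have hk0 := YoungDiagram.mem_iff_lt_rowLen.1 h0.1
    obtain ⟨j, rfl⟩ : ∃ j, k = j + 1 := ⟨k - 1, by omega⟩
    have h2 : (F.max' hne, j) ∈ μ := YoungDiagram.mem_iff_lt_rowLen.2 (by omega)
    have h3 : (F.min' hne + (ℓ - 1), j) ∈ μ := μ.up_left_mem (by omega) le_rfl h2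
    have h4 := h (F.min' hne) (j + 1) _ j
      (by rw [ladderIndex_right]; simp only [ladderIndex]; omega) (by omega) h3
    rw [YoungDiagram.mem_iff_lt_rowLen] at h4
    omega

/-- If a position above the new box `(c, d)` on its ladder were empty, so would be the one a single
ladder step up. That position would be addable and read later. All rows from there to row `c - 1`
end in column `d`, so the only candidate for a separating removable box is `(c - 1, d)`, which has
the wrong residue. -/
theorem IsRegular.addCogood (hℓ : 3 ≤ ℓ) (hμ : IsRegular ℓ μ)
    (h : addCogood ℓ rowReading i μ = some ν) : IsRegular ℓ ν := by
  have hr := isReading_rowReading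
  obtain ⟨⟨a, b⟩, u, v, hadd, hi, hν, hw, -, hv⟩ := hr.addCogood_eq_some_iff.1 h
  have hbetween := fun q => hr.exists_removable_between (q := q) hw hv
  have hm := mem_of_cells_eq_insert hν
  have hadd' := addable_iff.1 hadd
  rw [isRegular_iff hℓ] at hμ ⊢
  intro a₁ b₁ c d hl hac hcd
  rw [hm] at hcd ⊢
  rcases hcd with hcd | hcd
  swap
  · exact Or.inr (hμ _ _ _ _ hl hac hcd)
  simp only [Prod.mk.injEq] at hcd
  obtain ⟨rfl, rfl⟩ := hcd
  obtain ⟨m, hm1, rfl⟩ := exists_of_ladderIndex_eq hℓ hl hac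
  rcases m with _ | m
  · left
    rw [hm1]
    simp
  right
  rw [mul_add, mul_one, ← add_assoc] at hm1
  set a' := a₁ + (ℓ - 1) * m with ha'
  have hla : ladderIndex ℓ (a', d + 1) = ladderIndex ℓ (c, d) := by
    rw [ladderIndex_right, hm1]
    simp only [ladderIndex]
    omega
  suffices hs : (a', d + 1) ∈ μ from hμ _ _ _ _ (hl.trans hla.symm) (by omega) hs
  by_contra hn
  have hup : (c - 1, d) ∈ μ := hadd'.2.1 _ (by omega)
  have hadd2 : Addable μ (a', d + 1) := by
    refine addable_iff.2 ⟨hn, ?_, ?_⟩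
    · intro a'' h1
      refine hμ _ _ _ _ ?_ (by omega) hup
      have e1 := ladderIndex_down ℓ a'' (d + 1)
      have e2 := ladderIndex_down ℓ (c - 1) d
      rw [show c - 1 + 1 = c by omega] at e2
      rw [← h1] at e1
      omega
    · intro b' hb'
      obtain rfl : d = b' := by omega
      exact μ.up_left_mem (by omega) le_rfl hup
  obtain ⟨⟨e, f⟩, hrem, hri, hb1, hb2⟩ := hbetween _ hadd2
    ((residue_eq_of_ladderIndex_eq hℓ hla).trans hi) (Or.inl (by simp only; omega))
  simp only [RowBefore] at hb1 hb2
  have hrem' := removable_iff.1 hrem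
  have hec : e ≠ c := by
    rintro rfl
    exact hadd'.1 (μ.up_left_mem le_rfl (by omega) hrem'.1)
  have hfd : f ≤ d := by
    by_contra hf
    exact hn (μ.up_left_mem (by omega) (by omega) hrem'.1)
  have hdf : d ≤ f := by
    by_contra hf
    exact hrem'.2.2 (μ.up_left_mem (by omega) (by omega) hup)
  obtain rfl : f = d := by omega
  have hee : e + 1 = c := by
    by_contra he
    exact hrem'.2.1 (μ.up_left_mem (by omega) le_rfl hup)
  exact residue_down_ne hℓ e f (by rw [hee, hi, hri])

/-- If boxes remained below the removed one on its ladder, the position a single ladder step down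
would hold a removable box read earlier. The only candidate for a separating addable box is directly
below the removed box and has the wrong residue. -/
theorem IsRegular.removeGood (hℓ : 3 ≤ ℓ) (hμ : IsRegular ℓ μ)
    (h : removeGood ℓ rowReading i μ = some ν) : IsRegular ℓ ν := by
  have hr := isReading_rowReading
  obtain ⟨⟨a, b⟩, u, v, hrem, hi, hν, hw, hu, -⟩ := hr.removeGood_eq_some_iff.1 h
  have hbetween := fun q => hr.exists_addable_between (q := q) hw hu
  have hm := mem_of_cells_eq_erase hν
  have hrem' := removable_iff.1 hrem
  rw [isRegular_iff hℓ] at hμ ⊢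
  intro a₁ b₁ c d hl hac hcd
  rw [hm] at hcd ⊢
  refine ⟨?_, hμ _ _ _ _ hl hac hcd.2⟩
  intro he
  simp only [Prod.mk.injEq] at he
  obtain ⟨rfl, rfl⟩ := he
  obtain ⟨m, hm1, rfl⟩ := exists_of_ladderIndex_eq hℓ hl hac
  rcases m with _ | m
  · rw [hm1] at hcd
    simp at hcd
  rw [mul_add, mul_one] at hm1
  have hle : ladderIndex ℓ (a₁ + (ℓ - 1), d + m) = ladderIndex ℓ (a₁, d + (m + 1)) := by
    rw [← add_assoc, ladderIndex_right]
    simp only [ladderIndex]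
    omega
  have hx : (a₁ + (ℓ - 1), d + m) ∈ μ := hμ _ _ _ _ (hle.trans hl) (by omega) hcd.2
  have hrem2 : Removable μ (a₁ + (ℓ - 1), d + m) := by
    refine removable_iff.2 ⟨hx, fun h1 => hrem'.2.1 ?_, fun h1 => hrem'.2.1 ?_⟩
    · refine hμ _ _ _ _ ?_ (by omega) h1
      rw [ladderIndex_down, ladderIndex_down, hle]
    · exact μ.up_left_mem (by omega) (by omega) h1
  obtain ⟨⟨e, f⟩, hadd, hri, hb1, hb2⟩ := hbetween _ hrem2
    ((residue_eq_of_ladderIndex_eq hℓ hle).trans hi) (Or.inl (by simp only; omega))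
  simp only [RowBefore] at hb1 hb2
  have hadd' := addable_iff.1 hadd
  have hea : e ≠ a₁ := by
    rintro rfl
    exact hadd'.1 (μ.up_left_mem le_rfl (by omega) hrem'.1)
  have hf : d + (m + 1) ≤ f := by
    by_contra hf
    exact hadd'.1 (μ.up_left_mem (by omega) (by omega) hx)
  have hup : (e - 1, f) ∈ μ := hadd'.2.1 _ (by omega)
  have he : e = a₁ + 1 := by
    by_contra he
    exact hrem'.2.1 (μ.up_left_mem (by omega) hf hup)
  subst he
  have hf' : f = d + (m + 1) := by
    by_contra hne
    exact hrem'.2.2 (μ.up_left_mem (by omega) (by omega) hup)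
  subst hf'
  exact residue_down_ne hℓ _ _ (hri.trans hi.symm)

/-- Take the lowest box `(a, b)` of the last column. The only addable position read after it is `(0,
b + 1)`. Regularity gives `a < ℓ - 1`, so the ladder indices of the two differ by a number strictly
between `0` and `ℓ`; the residues differ and the `-` of `(a, b)` survives. -/
theorem IsRegular.exists_removeGood (hℓ : 3 ≤ ℓ) (hμ : IsRegular ℓ μ) (hne : μ ≠ ⊥) :
    ∃ i ν, LadderCrystal.removeGood ℓ rowReading i μ = some ν := by
  have hr := isReading_rowReading
  have h00 : (0, 0) ∈ μ := by
    by_contra hn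
    refine hne (YoungDiagram.ext ?_)
    rw [YoungDiagram.cells_bot, Finset.eq_empty_iff_forall_notMem]
    exact fun p hp => hn (μ.up_left_mem (Nat.zero_le _) (Nat.zero_le _) hp)
  obtain ⟨b, hb⟩ : ∃ b, μ.rowLen 0 = b + 1 :=
    ⟨μ.rowLen 0 - 1, by have := YoungDiagram.mem_iff_lt_rowLen.1 h00; omega⟩
  have h0b : (0, b) ∈ μ := YoungDiagram.mem_iff_lt_rowLen.2 (by omega)
  have h0b' : (0, b + 1) ∉ μ := fun h => by
    have := YoungDiagram.mem_iff_lt_rowLen.1 h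
    omega
  obtain ⟨a, ha⟩ : ∃ a, μ.colLen b = a + 1 :=
    ⟨μ.colLen b - 1, by have := YoungDiagram.mem_iff_lt_colLen.1 h0b; omega⟩
  have hab : (a, b) ∈ μ := YoungDiagram.mem_iff_lt_colLen.2 (by omega)
  have hrem : Removable μ (a, b) := by
    refine removable_iff.2 ⟨hab, fun h => ?_, fun h => ?_⟩
    · have := YoungDiagram.mem_iff_lt_colLen.1 h
      omega
    · exact h0b' (μ.up_left_mem (Nat.zero_le _) le_rfl h)
  have haℓ : a < ℓ - 1 := by
    by_contra hn
    refine h0b' ((isRegular_iff hℓ).1 hμ 0 (b + 1) (ℓ - 1) b ?_ (Nat.zero_le _)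
      (μ.up_left_mem (by omega) le_rfl hab))
    rw [ladderIndex_right]
    simp only [ladderIndex]
    omega
  refine ⟨residue ℓ (a, b), Option.ne_none_iff_exists'.1 fun hnone => ?_⟩
  rw [hr.removeGood_eq_none_iff] at hnone
  obtain ⟨u, v, h⟩ := List.append_of_mem
    (hr.minus_mem.2 ⟨hrem, rfl⟩ : _ ∈ signature ℓ (residue ℓ (a, b)) μ (rowReading μ))
  have hs := signature_pairwise (ℓ := ℓ) (i := residue ℓ (a, b)) (μ := μ) (hr.sorted μ)
  rw [h, (boxes_append _ _).2, List.append_eq_nil_iff] at hnone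
  have hc : conormalBoxes v ≠ [] := fun hc => by
    rw [normalBoxes_minus_of_nil hc] at hnone
    simp at hnone
  obtain ⟨⟨e, f⟩, hq⟩ := List.exists_mem_of_ne_nil _ hc
  have hq' := (mem_of_mem_boxes v _).1 hq
  have hmem : (Sign.plus, (e, f)) ∈ signature ℓ (residue ℓ (a, b)) μ (rowReading μ) := by
    rw [h]; simp [hq']
  obtain ⟨hadd, hres⟩ := hr.plus_mem.1 hmem
  rw [h] at hs
  have hbef := List.rel_of_pairwise_cons (List.pairwise_append.1 hs).2.1 hq'
  simp only [RowBefore] at hbef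
  have hadd' := addable_iff.1 hadd
  have hf : b < f := by
    by_contra hf
    exact hadd'.1 (μ.up_left_mem (by omega) (by omega) hab)
  have he : e = 0 := by
    by_contra he
    exact h0b' (μ.up_left_mem (Nat.zero_le _) hf (hadd'.2.1 (e - 1) (by omega)))
  subst he
  have hf' : f = b + 1 := by
    by_contra hne
    exact h0b' (μ.up_left_mem le_rfl (show b + 1 ≤ f - 1 by omega)
      (hadd'.2.2 (f - 1) (by omega)))
  subst hf'
  rw [residue_eq_iff hℓ] at hres
  have h1 : ladderIndex ℓ (0, b + 1) = ladderIndex ℓ (0, b) + (ℓ - 1) := ladderIndex_right ℓ 0 b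
  have h2 : ladderIndex ℓ (a, b) = ladderIndex ℓ (0, b) + a := by
    simp only [ladderIndex]; omega
  rcases eq_or_eq_of_mod_eq hres (by omega) (by omega) with h | h <;> omega

end Regular

/-! ### Words sorted by a label -/

/-- The order of the letters in a word that reads the labels in increasing order, and among equal
labels first all `+` and then all `-`. -/
def LabelOrder (x y : Sign × (ℕ × ℕ)) : Prop :=
  x.2.1 < y.2.1 ∨ (x.2.1 = y.2.1 ∧ (x.1.isPlus = true ∨ y.1.isPlus = false))

theorem layeredWord_pairwise (A M : ℕ → ℕ) (n : ℕ) : ∀ j,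
    (layeredWord A M j n).Pairwise LabelOrder ∧ ∀ x ∈ layeredWord A M j n,
      x.2.2 = 0 ∧ (j < x.2.1 ∨ (x.2.1 = j ∧ x.1 = Sign.minus)) := by
  induction n with
  | zero =>
    intro j
    simp only [layeredWord, List.pairwise_replicate, List.mem_replicate, and_imp]
    refine ⟨Or.inr (Or.inr ⟨rfl, Or.inr rfl⟩), ?_⟩
    rintro _ - rfl
    simp
  | succ n ih =>
    intro j
    obtain ⟨h1, h2⟩ := ih (j + 1)
    constructor
    · simp only [layeredWord, List.pairwise_append, List.pairwise_replicate, List.mem_append,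
        List.mem_replicate]
      refine ⟨Or.inr (Or.inr ⟨rfl, Or.inr rfl⟩),
        ⟨Or.inr (Or.inr ⟨rfl, Or.inl rfl⟩), h1, ?_⟩, ?_⟩
      · rintro x ⟨-, rfl⟩ y hy
        rcases (h2 y hy).2 with h | h
        · exact Or.inl h
        · exact Or.inr ⟨h.1.symm, Or.inl rfl⟩
      · rintro x ⟨-, rfl⟩ y (⟨-, rfl⟩ | hy)
        · exact Or.inl (Nat.lt_succ_self j)
        · rcases (h2 y hy).2 with h | h
          · exact Or.inl (by simp only; omega)
          · exact Or.inl (by simp only; omega)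
    · intro x hx
      simp only [layeredWord, List.mem_append, List.mem_replicate] at hx
      rcases hx with ⟨-, rfl⟩ | ⟨-, rfl⟩ | hx
      · simp
      · simp
      · obtain ⟨h3, h4⟩ := h2 x hx
        exact ⟨h3, by omega⟩

open Classical in
theorem count_layeredWord (A M : ℕ → ℕ) (t n : ℕ) : ∀ j,
    (layeredWord A M j n).count (Sign.plus, (t, 0)) = (if j < t ∧ t ≤ j + n then A t else 0) ∧
    (layeredWord A M j n).count (Sign.minus, (t, 0)) =
      if j ≤ t ∧ t ≤ j + n then M t else 0 := by
  induction n with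
  | zero =>
    intro j
    simp only [layeredWord, List.count_replicate, beq_iff_eq, Prod.mk.injEq, reduceCtorEq,
      false_and, true_and, and_true, if_false, add_zero]
    constructor
    · rw [if_neg (by omega)]
    · by_cases h : j = t
      · subst h; simp
      · rw [if_neg h, if_neg (by omega)]
  | succ n ih =>
    intro j
    obtain ⟨h1, h2⟩ := ih (j + 1)
    simp only [layeredWord, List.count_append, h1, h2, List.count_replicate, beq_iff_eq,
      Prod.mk.injEq, reduceCtorEq, false_and, true_and, and_true, if_false]
    constructor
    · by_cases h : j + 1 = t
      · subst h; simp
      · rw [if_neg h]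
        simp only [zero_add]
        exact if_congr (by omega) rfl rfl
    · by_cases h : j = t
      · subst h; simp
      · rw [if_neg h]
        simp only [zero_add]
        exact if_congr (by omega) rfl rfl

/-- The order fixes the word once the multiplicity of each letter is known. The `+` of label `0`
stand apart because `layeredWord` starts with the `-` of its first label. -/
theorem eq_layeredWord {w : List (Sign × (ℕ × ℕ))} (hw : w.Pairwise LabelOrder) {N : ℕ}
    (hN : ∀ x ∈ w, x.2.2 = 0 ∧ x.2.1 ≤ N) {A M : ℕ → ℕ}
    (hA : ∀ j, w.countP (fun x => x.1.isPlus && decide (x.2 = (j, 0))) = A j)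
    (hM : ∀ j, w.countP (fun x => !x.1.isPlus && decide (x.2 = (j, 0))) = M j) :
    w = List.replicate (A 0) (Sign.plus, (0, 0)) ++ layeredWord A M 0 N := by
  classical
  have hA' : ∀ j, w.count (Sign.plus, (j, 0)) = A j := by
    intro j
    rw [← hA, List.count]
    refine List.countP_congr ?_
    rintro ⟨s, p⟩ -
    cases s <;> simp
  have hM' : ∀ j, w.count (Sign.minus, (j, 0)) = M j := by
    intro j
    rw [← hM, List.count]
    refine List.countP_congr ?_
    rintro ⟨s, p⟩ -
    cases s <;> simp
  obtain ⟨h1, h2⟩ := layeredWord_pairwise A M N 0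
  have hmem : ∀ x ∈ List.replicate (A 0) (Sign.plus, ((0, 0) : ℕ × ℕ)) ++ layeredWord A M 0 N,
      x.2.2 = 0 := by
    intro x hx
    rw [List.mem_append, List.mem_replicate] at hx
    rcases hx with ⟨-, rfl⟩ | hx
    · rfl
    · exact (h2 x hx).1
  refine List.Perm.eq_of_pairwise (le := LabelOrder) ?_ hw ?_ ?_
  · rintro ⟨s, p, p'⟩ ⟨t, q, q'⟩ hx hy h3 h4
    have e1 := (hN _ hx).1
    have e2 := hmem _ hy
    simp only at e1 e2
    subst e1 e2
    simp only [LabelOrder] at h3 h4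
    obtain rfl : p = q := by omega
    cases s <;> cases t <;> simp_all
  · rw [List.pairwise_append]
    refine ⟨List.pairwise_replicate.2 (Or.inr (Or.inr ⟨rfl, Or.inl rfl⟩)), h1, ?_⟩
    intro x hx y hy
    obtain ⟨-, rfl⟩ := List.mem_replicate.1 hx
    rcases (h2 y hy).2 with h | h
    · exact Or.inl h
    · exact Or.inr ⟨h.1.symm, Or.inl rfl⟩
  · rw [List.perm_iff_count]
    rintro ⟨s, t, t'⟩
    by_cases ht' : t' = 0
    · subst ht'
      rw [List.count_append, List.count_replicate]
      cases s with
      | plus =>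
        rw [(count_layeredWord A M t N 0).1, hA']
        simp only [beq_iff_eq, Prod.mk.injEq, true_and, and_true]
        by_cases h0 : 0 = t
        · subst h0; simp
        · rw [if_neg h0, zero_add]
          by_cases htN : t ≤ N
          · rw [if_pos (by omega)]
          · rw [if_neg (by omega), ← hA', List.count_eq_zero]
            exact fun h => htN (hN _ h).2
      | minus =>
        rw [(count_layeredWord A M t N 0).2, hM']
        simp only [beq_iff_eq, Prod.mk.injEq, reduceCtorEq, false_and, if_false, zero_add]
        by_cases htN : t ≤ N
        · rw [if_pos (by omega)]
        · rw [if_neg (by omega), ← hM', List.count_eq_zero]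
          exact fun h => htN (hN _ h).2
    · rw [List.count_eq_zero.2 fun h => ht' (hN _ h).1,
        List.count_eq_zero.2 fun h => ht' (hmem _ h)]

/-! ### Partitions with the same number of boxes on each ladder -/

def SameLadders (ℓ : ℕ) (μ ν : YoungDiagram) : Prop :=
  ∀ k, (onLadder ℓ μ.cells k).card = (onLadder ℓ ν.cells k).card

/-- By `sum_boundary` for the indicator of ladder `k`. A diagonal shift moves a box by `ℓ` ladders,
so the addable boxes on ladder `k` minus the removable ones on ladder `k - ℓ` are expressed through
ladder counts alone. -/
theorem SameLadders.card_addable_add {ℓ : ℕ} (hℓ : 3 ≤ ℓ) {μ ν : YoungDiagram}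
    (h : SameLadders ℓ μ ν) (k : ℕ) :
    ((addableBoxes μ).filter fun p => ladderIndex ℓ p = k).card +
        ((removableBoxes ν).filter fun p => ladderIndex ℓ p + ℓ = k).card =
      ((addableBoxes ν).filter fun p => ladderIndex ℓ p = k).card +
        ((removableBoxes μ).filter fun p => ladderIndex ℓ p + ℓ = k).card := by
  have hshift : ∀ t, ∑ p ∈ μ.cells, (if ladderIndex ℓ p + t = k then 1 else 0) =
      ∑ p ∈ ν.cells, (if ladderIndex ℓ p + t = k then 1 else 0) := by
    intro t
    rw [← Finset.card_filter, ← Finset.card_filter]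
    by_cases ht : t ≤ k
    · have e : ∀ p : ℕ × ℕ, ladderIndex ℓ p + t = k ↔ ladderIndex ℓ p = k - t := by
        intro p; omega
      simp only [e]
      exact h (k - t)
    · have e : ∀ p : ℕ × ℕ, ¬ ladderIndex ℓ p + t = k := by
        intro p; omega
      simp [e]
  have hd : ∀ p : ℕ × ℕ, ladderIndex ℓ (p.1 + 1, p.2 + 1) = ladderIndex ℓ p + ℓ := by
    intro p
    rw [ladderIndex_right, ladderIndex_down]
    change ladderIndex ℓ p + 1 + (ℓ - 1) = _
    omega
  have h1 := sum_boundary μ fun p => if ladderIndex ℓ p = k then 1 else 0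
  have h2 := sum_boundary ν fun p => if ladderIndex ℓ p = k then 1 else 0
  simp only [hd, ladderIndex_down, ladderIndex_right, Prod.mk.eta,
    ← Finset.card_filter _ (addableBoxes _),
    ← Finset.card_filter _ (removableBoxes _)] at h1 h2
  have e0 := hshift 0
  have e1 := hshift 1
  have e2 := hshift (ℓ - 1)
  have e3 := hshift ℓ
  simp only [add_zero] at e0
  omega

theorem ladderIndex_le {ℓ : ℕ} (hℓ : 3 ≤ ℓ) {a b n : ℕ} (h : a + b ≤ n) :
    ladderIndex ℓ (a, b) ≤ ℓ * n := by
  have h1 : a ≤ (ℓ - 1) * a := Nat.le_mul_of_pos_left _ (by omega)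
  have h3 : (ℓ - 1) * (a + b) ≤ ℓ * n := Nat.mul_le_mul (by omega) h
  rw [mul_add] at h3
  simp only [ladderIndex]
  omega

/-- The letters of a signature appear in the order of their ladders, and on each ladder all `+`
precede all `-`. -/
def LadderSorted (ℓ : ℕ) (w : List (Sign × (ℕ × ℕ))) : Prop :=
  w.Pairwise fun x y => ladderIndex ℓ x.2 < ladderIndex ℓ y.2 ∨
    (ladderIndex ℓ x.2 = ladderIndex ℓ y.2 ∧ (x.1.isPlus = true ∨ y.1.isPlus = false))

/-! ### Comparison of the reduced signatures of two partitions -/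

section Compare

variable {ℓ : ℕ} {i : ZMod ℓ} {μ ν : YoungDiagram}
  {before before' : ℕ × ℕ → ℕ × ℕ → Prop} {reading reading' : YoungDiagram → List (ℕ × ℕ)}

theorem residue_eq_iff_mod (hℓ : 3 ≤ ℓ) (p : ℕ × ℕ) :
    residue ℓ p = i ↔ ladderIndex ℓ p % ℓ = (-i).val := by
  have : NeZero ℓ := ⟨by omega⟩
  rw [residue_eq_neg_ladderIndex hℓ, neg_eq_iff_eq_neg, ← ZMod.val_natCast]
  exact (ZMod.val_injective ℓ).eq_iff.symm

/-- The ladders of residue `i` are numbered by `j`, starting from the ladder with index `(-i).val`;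
the quotient by `ℓ` serves as label. -/
theorem residue_and_label_iff (hℓ : 3 ≤ ℓ) (p : ℕ × ℕ) (j : ℕ) :
    (residue ℓ p = i ∧ ladderIndex ℓ p / ℓ = j) ↔ ladderIndex ℓ p = (-i).val + ℓ * j := by
  have : NeZero ℓ := ⟨by omega⟩
  have hlt := ZMod.val_lt (-i)
  rw [residue_eq_iff_mod hℓ]
  constructor
  · rintro ⟨h1, h2⟩
    rw [← h1, ← h2, Nat.mod_add_div]
  · intro h
    rw [h, Nat.add_mul_mod_self_left, Nat.mod_eq_of_lt hlt,
      Nat.add_mul_div_left _ _ (by omega), Nat.div_eq_of_lt hlt, zero_add]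
    exact ⟨rfl, rfl⟩

theorem IsReading.map_label_eq (hr : IsReading before reading) (hℓ : 3 ≤ ℓ)
    (hs : LadderSorted ℓ (signature ℓ i μ (reading μ))) {N : ℕ} (hN : ℓ * μ.card ≤ N) :
    (signature ℓ i μ (reading μ)).map (Prod.map id fun p => (ladderIndex ℓ p / ℓ, 0)) =
      List.replicate ((addableBoxes μ).filter fun p => ladderIndex ℓ p = (-i).val).card
          (Sign.plus, (0, 0)) ++
        layeredWord
          (fun j => ((addableBoxes μ).filter fun p => ladderIndex ℓ p = (-i).val + ℓ * j).card)
          (fun j => ((removableBoxes μ).filter fun p => ladderIndex ℓ p = (-i).val + ℓ * j).card)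
          0 N := by
  have hmem : ∀ x ∈ signature ℓ i μ (reading μ),
      residue ℓ x.2 = i ∧ x.2.1 + x.2.2 ≤ μ.card := by
    rintro ⟨s, p⟩ hx
    cases s with
    | plus => exact ⟨(hr.plus_mem.1 hx).2, (hr.plus_mem.1 hx).1.add_le_card⟩
    | minus => exact ⟨(hr.minus_mem.1 hx).2, (add_lt_card (hr.minus_mem.1 hx).1.1).le⟩
  have h := eq_layeredWord (N := N)
    (w := (signature ℓ i μ (reading μ)).map (Prod.map id fun p => (ladderIndex ℓ p / ℓ, 0)))
    (A := fun j => ((addableBoxes μ).filter fun p => ladderIndex ℓ p = (-i).val + ℓ * j).card)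
    (M := fun j => ((removableBoxes μ).filter fun p => ladderIndex ℓ p = (-i).val + ℓ * j).card)
    ?_ ?_ ?_ ?_
  · rw [h, mul_zero, add_zero]
  · rw [List.pairwise_map]
    refine List.Pairwise.imp_of_mem ?_ hs
    intro x y hx hy hxy
    have h1 := (residue_and_label_iff hℓ x.2 _).1 ⟨(hmem x hx).1, rfl⟩
    have h2 := (residue_and_label_iff hℓ y.2 _).1 ⟨(hmem y hy).1, rfl⟩
    simp only [LabelOrder, Prod.map, id]
    rcases hxy with hxy | hxy
    · left
      by_contra hle
      have := Nat.mul_le_mul_left ℓ (not_lt.1 hle)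
      omega
    · exact Or.inr ⟨by rw [hxy.1], hxy.2⟩
  · intro x hx
    obtain ⟨y, hy, rfl⟩ := List.mem_map.1 hx
    refine ⟨rfl, (Nat.div_le_self _ _).trans ((ladderIndex_le hℓ (hmem y hy).2).trans hN)⟩
  · intro j
    rw [List.countP_map]
    have := hr.countP_plus (ℓ := ℓ) (i := i) (μ := μ)
      fun p => decide ((ladderIndex ℓ p / ℓ, 0) = (j, 0))
    simp only [decide_eq_true_eq, Prod.mk.injEq, and_true, residue_and_label_iff hℓ] at this
    rw [← this]
    simp [Function.comp_def]
  · intro j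
    rw [List.countP_map]
    have := hr.countP_minus (ℓ := ℓ) (i := i) (μ := μ)
      fun p => decide ((ladderIndex ℓ p / ℓ, 0) = (j, 0))
    simp only [decide_eq_true_eq, Prod.mk.injEq, and_true, residue_and_label_iff hℓ] at this
    rw [← this]
    simp [Function.comp_def]

/-- The reduced signatures of two partitions with the same number of boxes on each ladder are
the same, up to the positions of the boxes on their ladders. -/
theorem SameLadders.map_boxes_eq (hℓ : 3 ≤ ℓ) (h : SameLadders ℓ μ ν)
    (hr : IsReading before reading) (hr' : IsReading before' reading')
    (hμ : LadderSorted ℓ (signature ℓ i μ (reading μ)))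
    (hν : LadderSorted ℓ (signature ℓ i ν (reading' ν))) :
    (conormalBoxes (signature ℓ i μ (reading μ))).map (ladderIndex ℓ) =
        (conormalBoxes (signature ℓ i ν (reading' ν))).map (ladderIndex ℓ) ∧
      (normalBoxes (signature ℓ i μ (reading μ))).map (ladderIndex ℓ) =
        (normalBoxes (signature ℓ i ν (reading' ν))).map (ladderIndex ℓ) := by
  have : NeZero ℓ := ⟨by omega⟩
  have hlt := ZMod.val_lt (-i)
  set N := ℓ * μ.card + ℓ * ν.card with hN
  have h1 := hr.map_label_eq hℓ hμ (N := N) (by omega)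
  have h2 := hr'.map_label_eq hℓ hν (N := N) (by omega)
  -- The bound `N` is so large that the ladder with label `N` carries no removable box. The last
  -- blocks of both layered words are empty.
  have hrem0 : ∀ μ : YoungDiagram, ℓ * μ.card ≤ N →
      ((removableBoxes μ).filter fun p => ladderIndex ℓ p = (-i).val + ℓ * (0 + N)).card =
        0 := by
    intro μ hμN
    rw [Finset.card_eq_zero, Finset.filter_eq_empty_iff]
    intro p hp hpl
    have hc := add_lt_card (mem_removableBoxes.1 hp).1
    have h3 := ladderIndex_le hℓ hc.le
    have h4 : 1 * N < ℓ * N := by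
      refine Nat.mul_lt_mul_of_pos_right (by omega) (lt_of_lt_of_le ?_ hμN)
      exact Nat.mul_pos (by omega) (by omega)
    change ladderIndex ℓ p ≤ _ at h3
    rw [zero_add] at hpl
    omega
  have key : reduceWord ((signature ℓ i μ (reading μ)).map
        (Prod.map id fun p => (ladderIndex ℓ p / ℓ, 0))) =
      reduceWord ((signature ℓ i ν (reading' ν)).map
        (Prod.map id fun p => (ladderIndex ℓ p / ℓ, 0))) := by
    rw [h1, h2]
    -- There is no ladder `ℓ` before the first one, so the numbers of leading `+` agree outright.
    have h0 := h.card_addable_add hℓ (-i).val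
    have e : ∀ p : ℕ × ℕ, ¬ ladderIndex ℓ p + ℓ = (-i).val := by
      intro p; omega
    simp only [e, Finset.filter_false, Finset.card_empty, add_zero] at h0
    rw [h0]
    refine reduceWord_append_congr _ (reduceWord_layeredWord_congr ?_ N 0 ?_)
    · intro j
      have h3 := h.card_addable_add hℓ ((-i).val + ℓ * (j + 1))
      have e : ∀ p : ℕ × ℕ, ladderIndex ℓ p + ℓ = (-i).val + ℓ * (j + 1) ↔
          ladderIndex ℓ p = (-i).val + ℓ * j := by
        intro p
        rw [mul_add, mul_one]
        omega
      simpa only [e] using h3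
    · rw [hrem0 μ (by omega), hrem0 ν (by omega)]
  have hback : ∀ {L L' : List (ℕ × ℕ)}, (∀ p ∈ L, residue ℓ p = i) → (∀ p ∈ L', residue ℓ p = i) →
      L.map (fun p => (ladderIndex ℓ p / ℓ, 0)) = L'.map (fun p => (ladderIndex ℓ p / ℓ, 0)) →
      L.map (ladderIndex ℓ) = L'.map (ladderIndex ℓ) := by
    intro L L' hL hL' he
    have hmap : ∀ {L : List (ℕ × ℕ)}, (∀ p ∈ L, residue ℓ p = i) →
        L.map (ladderIndex ℓ) = (L.map (fun p => (ladderIndex ℓ p / ℓ, 0))).map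
          fun q : ℕ × ℕ => (-i).val + ℓ * q.1 := by
      intro L hL
      rw [List.map_map]
      refine List.map_congr_left fun p hp => ?_
      exact (residue_and_label_iff hℓ p _).1 ⟨hL p hp, rfl⟩
    rw [hmap hL, hmap hL', he]
  constructor
  · refine hback ?_ ?_ ?_
    · exact fun p hp => (hr.plus_mem.1 ((mem_of_mem_boxes _ _).1 hp)).2
    · exact fun p hp => (hr'.plus_mem.1 ((mem_of_mem_boxes _ _).1 hp)).2
    · rw [← (boxes_map _ _).1, ← (boxes_map _ _).1, conormalBoxes, key, conormalBoxes]
  · refine hback ?_ ?_ ?_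
    · exact fun p hp => (hr.minus_mem.1 ((mem_of_mem_boxes _ _).2 hp)).2
    · exact fun p hp => (hr'.minus_mem.1 ((mem_of_mem_boxes _ _).2 hp)).2
    · rw [← (boxes_map _ _).2, ← (boxes_map _ _).2, normalBoxes, key, normalBoxes]

/-- Ladders are read from top to bottom, and tightness forbids a `-` above a `+` on the same ladder.
-/
theorem IsTight.ladderSorted (hℓ : 3 ≤ ℓ) (hμ : IsTight ℓ μ) :
    LadderSorted ℓ (signature ℓ i μ (ladderReading ℓ μ)) := by
  have hr := isReading_ladderReading hℓ
  refine List.Pairwise.imp_of_mem ?_ (signature_pairwise (hr.sorted μ))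
  rintro ⟨s, p⟩ ⟨t, q⟩ hx hy (h | h)
  · exact Or.inl h
  · refine Or.inr ⟨h.1, ?_⟩
    cases s with
    | plus => exact Or.inl rfl
    | minus =>
      cases t with
      | minus => exact Or.inr rfl
      | plus =>
        exact absurd (hr.plus_mem.1 hy).1
          (hμ.not_removable_above_addable h.1 h.2 (hr.minus_mem.1 hx).1)

/-- Let `(a, b)` be read before `(c, d)` in a higher row. Were its ladder later, the box above `(a,
b)` would lie on the ladder of `(c + 1, d)` or on a later one. Since boxes of a regular partition
can be slid up their ladders, `(c + 1, d)` would be occupied, which is impossible for an addable or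
removable `(c, d)`. On a common ladder, a `-` below a `+` contradicts regularity directly. -/
theorem IsRegular.ladderSorted (hℓ : 3 ≤ ℓ) (hμ : IsRegular ℓ μ) :
    LadderSorted ℓ (signature ℓ i μ (rowReading μ)) := by
  have hr := isReading_rowReading
  have hreg := (isRegular_iff hℓ).1 hμ
  have hmem : ∀ x ∈ signature ℓ i μ (rowReading μ), residue ℓ x.2 = i ∧
      (∀ a, x.2.1 = a + 1 → (a, x.2.2) ∈ μ) ∧ (∀ b, x.2.2 = b + 1 → (x.2.1, b) ∈ μ) ∧
      (x.2.1 + 1, x.2.2) ∉ μ ∧ (x.2.1, x.2.2 + 1) ∉ μ := by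
    rintro ⟨s, a, b⟩ hx
    cases s with
    | plus =>
      obtain ⟨h1, h2⟩ := hr.plus_mem.1 hx
      have h3 := addable_iff.1 h1
      exact ⟨h2, h3.2.1, h3.2.2, fun h => h3.1 (μ.up_left_mem (by simp) le_rfl h),
        fun h => h3.1 (μ.up_left_mem le_rfl (by simp) h)⟩
    | minus =>
      obtain ⟨h1, h2⟩ := hr.minus_mem.1 hx
      have h3 := removable_iff.1 h1
      exact ⟨h2, fun c hc => μ.up_left_mem (by simp only at hc; omega) le_rfl h3.1,
        fun c hc => μ.up_left_mem le_rfl (by simp only at hc; omega) h3.1, h3.2⟩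
  refine List.Pairwise.imp_of_mem ?_ (signature_pairwise (hr.sorted μ))
  rintro ⟨s, a, b⟩ ⟨t, c, d⟩ hx hy h
  obtain ⟨hp1, hp2, hp3, -, hp5⟩ := hmem _ hx
  obtain ⟨hq1, hq2, hq3, hq4, -⟩ := hmem _ hy
  simp only [RowBefore] at h hp1 hp2 hp3 hp5 hq1 hq2 hq3 hq4 ⊢
  rcases h with hca | ⟨rfl, hbd⟩
  · have hle : ladderIndex ℓ (a, b) ≤ ladderIndex ℓ (c, d) := by
      by_contra hlt
      have hbd : b ≤ d := by
        by_contra hdb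
        exact hq4 (μ.up_left_mem (by omega) (by omega) (hp3 (b - 1) (by omega)))
      have hne : ladderIndex ℓ (a, b) ≠ ladderIndex ℓ (c, d) + 1 := by
        intro he
        rw [← ladderIndex_down] at he
        have := residue_eq_of_ladderIndex_eq hℓ he
        exact residue_down_ne hℓ c d (by rw [← this, hp1, hq1])
      obtain ⟨m, rfl⟩ := Nat.exists_eq_add_of_le hbd
      have h1 : ladderIndex ℓ (c + 1, b + m) = ladderIndex ℓ (c + 1 + (ℓ - 1) * m, b) := by
        simp only [ladderIndex]; ring
      refine hq4 (hreg _ _ _ _ h1 (by omega) (μ.up_left_mem (i2 := a - 1) ?_ le_rfl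
        (hp2 (a - 1) (by omega))))
      simp only [ladderIndex, mul_add] at hlt hne
      omega
    rcases hle.lt_or_eq with hlt | heq
    · exact Or.inl hlt
    · refine Or.inr ⟨heq, ?_⟩
      cases s with
      | plus => exact Or.inl rfl
      | minus =>
        cases t with
        | minus => exact Or.inr rfl
        | plus =>
          exact absurd (hreg _ _ _ _ heq.symm hca.le (hr.minus_mem.1 hx).1.1)
            (hr.plus_mem.1 hy).1.1
  · exfalso
    have hd : d = b + 1 := by
      by_contra hne
      exact hp5 (μ.up_left_mem le_rfl (by omega) (hq3 (d - 1) (by omega)))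
    subst hd
    exact residue_right_ne hℓ a b (hq1.trans hp1.symm)

end Compare

/-! ### Regularization -/

section Regularization

variable {ℓ : ℕ} {i : ZMod ℓ} {μ ν : YoungDiagram}

theorem mem_regularization (hℓ : 3 ≤ ℓ) {a b : ℕ} :
    (a, b) ∈ regularization ℓ hℓ μ ↔
      a / (ℓ - 1) < (onLadder ℓ μ.cells (ladderIndex ℓ (a, b))).card :=
  mem_regBoxes hℓ μ a b

theorem isRegular_regularization (hℓ : 3 ≤ ℓ) : IsRegular ℓ (regularization ℓ hℓ μ) := by
  rw [isRegular_iff hℓ]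
  intro a b c d hl hac hcd
  rw [mem_regularization hℓ] at hcd ⊢
  rw [hl]
  exact (Nat.div_le_div_right hac).trans_lt hcd

theorem div_ladderIndex (hℓ : 3 ≤ ℓ) (a b : ℕ) :
    ladderIndex ℓ (a, b) / (ℓ - 1) = a / (ℓ - 1) + b :=
  Nat.add_mul_div_left _ _ (by omega)

theorem card_ladder_le (hℓ : 3 ≤ ℓ) (k : ℕ) : (ladder ℓ k).card ≤ k / (ℓ - 1) + 1 := by
  rw [← Finset.card_range (k / (ℓ - 1) + 1)]
  refine Finset.card_le_card_of_injOn Prod.snd ?_ ?_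
  · rintro ⟨a, b⟩ hp
    rw [Finset.mem_coe, mem_ladder hℓ] at hp
    rw [Finset.mem_coe, Finset.mem_range, ← hp, div_ladderIndex hℓ]
    exact Nat.lt_succ_of_le (Nat.le_add_left _ _)
  · rintro ⟨a, b⟩ hp ⟨c, d⟩ hq h
    rw [Finset.mem_coe, mem_ladder hℓ] at hp hq
    simp only [ladderIndex] at hp hq h
    subst h
    simp only [Prod.mk.injEq, and_true]
    omega

theorem onLadder_subset_ladder (hℓ : 3 ≤ ℓ) (k : ℕ) : onLadder ℓ μ.cells k ⊆ ladder ℓ k :=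
  fun _ hp => (mem_ladder hℓ _ _).2 ((mem_onLadder _ _ _ _).1 hp).2

theorem sameLadders_regularization (hℓ : 3 ≤ ℓ) : SameLadders ℓ μ (regularization ℓ hℓ μ) := by
  intro k
  have hn := (Finset.card_le_card (onLadder_subset_ladder (μ := μ) hℓ k)).trans
    (card_ladder_le hℓ k)
  set n := (onLadder ℓ μ.cells k).card with hndef
  rw [← Finset.card_range n]
  -- The witness for `j` is the position of ladder `k` with exactly `j` positions above it. The
  -- bound `hn` ensures that the ladder is long enough.
  refine Finset.card_bij
    (fun j _ => (k % (ℓ - 1) + (ℓ - 1) * j, k / (ℓ - 1) - j)) ?_ ?_ ?_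
  · intro j hj
    rw [Finset.mem_range] at hj
    have hl : ladderIndex ℓ (k % (ℓ - 1) + (ℓ - 1) * j, k / (ℓ - 1) - j) = k := by
      simp only [ladderIndex]
      rw [add_assoc, ← mul_add, Nat.add_sub_cancel' (by omega), Nat.mod_add_div]
    rw [mem_onLadder, mem_regularization hℓ, hl, ← hndef, Nat.add_mul_div_left _ _ (by omega),
      Nat.div_eq_of_lt (Nat.mod_lt _ (by omega)), zero_add]
    exact ⟨hj, rfl⟩
  · intro j hj j' hj' h
    rw [Finset.mem_range] at hj hj'
    simp only [Prod.mk.injEq] at h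
    omega
  · rintro ⟨a, b⟩ hp
    rw [mem_onLadder, mem_regularization hℓ] at hp
    obtain ⟨h1, rfl⟩ := hp
    refine ⟨a / (ℓ - 1), Finset.mem_range.2 h1, ?_⟩
    rw [div_ladderIndex hℓ, Nat.add_sub_cancel_left]
    simp only [ladderIndex]
    rw [Nat.add_mul_mod_self_left, Nat.mod_add_div]

/-- The boxes of a regular partition form the top segment of each ladder. A box of `μ` missing from
`ν` would make the segment of `μ` strictly longer. -/
theorem IsRegular.le_of_sameLadders (hℓ : 3 ≤ ℓ) (hμ : IsRegular ℓ μ) (hν : IsRegular ℓ ν)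
    (h : SameLadders ℓ μ ν) : μ ≤ ν := by
  rw [isRegular_iff hℓ] at hμ hν
  rintro ⟨a, b⟩ hp
  by_contra hn
  replace hn : (a, b) ∉ ν := hn
  have hlt : (onLadder ℓ ν.cells (ladderIndex ℓ (a, b))).card <
      (onLadder ℓ μ.cells (ladderIndex ℓ (a, b))).card := by
    refine Finset.card_lt_card ((Finset.ssubset_iff_of_subset ?_).2 ⟨(a, b), ?_, ?_⟩)
    · rintro ⟨c, d⟩ hq
      rw [mem_onLadder] at hq ⊢
      refine ⟨?_, hq.2⟩
      rcases le_total a c with hac | hca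
      · exact absurd (hν _ _ _ _ hq.2.symm hac hq.1) hn
      · exact hμ _ _ _ _ hq.2 hca hp
    · exact (mem_onLadder _ _ _ _).2 ⟨hp, rfl⟩
    · exact fun h => hn ((mem_onLadder _ _ _ _).1 h).1
  exact hlt.ne (h _).symm

theorem SameLadders.symm (h : SameLadders ℓ μ ν) : SameLadders ℓ ν μ := fun k => (h k).symm

theorem regularization_eq_iff (hℓ : 3 ≤ ℓ) :
    regularization ℓ hℓ μ = ν ↔ IsRegular ℓ ν ∧ SameLadders ℓ μ ν := by
  constructor
  · rintro rfl
    exact ⟨isRegular_regularization hℓ, sameLadders_regularization hℓ⟩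
  · rintro ⟨h1, h2⟩
    have h3 : SameLadders ℓ (regularization ℓ hℓ μ) ν := fun k =>
      (sameLadders_regularization hℓ k).symm.trans (h2 k)
    exact le_antisymm ((isRegular_regularization hℓ).le_of_sameLadders hℓ h1 h3)
      (h1.le_of_sameLadders hℓ (isRegular_regularization hℓ) h3.symm)

theorem card_onLadder_insert {p : ℕ × ℕ} (h : ν.cells = insert p μ.cells) (hp : p ∉ μ) (k : ℕ) :
    (onLadder ℓ ν.cells k).card =
      (onLadder ℓ μ.cells k).card + if ladderIndex ℓ p = k then 1 else 0 := by
  rw [onLadder, h, Finset.filter_insert]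
  split_ifs with hk
  · rw [Finset.card_insert_of_notMem fun hm => hp (Finset.mem_filter.1 hm).1]
    rfl
  · rfl

theorem IsReading.exists_of_addCogood {before : ℕ × ℕ → ℕ × ℕ → Prop}
    {reading : YoungDiagram → List (ℕ × ℕ)} (hr : IsReading before reading)
    (h : addCogood ℓ reading i μ = some ν) :
    ∃ p, (conormalBoxes (signature ℓ i μ (reading μ))).getLast? = some p ∧ p ∉ μ ∧
      ν.cells = insert p μ.cells := by
  rw [addCogood, Option.bind_eq_some_iff] at h
  obtain ⟨p, h1, h2⟩ := h
  exact ⟨p, h1, (hr.plus_mem.1 ((mem_of_mem_boxes _ _).1 (List.mem_of_getLast? h1))).1.1,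
    ofBoxes_eq_some_iff.1 h2⟩

theorem IsReading.exists_of_removeGood {before : ℕ × ℕ → ℕ × ℕ → Prop}
    {reading : YoungDiagram → List (ℕ × ℕ)} (hr : IsReading before reading)
    (h : removeGood ℓ reading i μ = some ν) :
    ∃ p, (normalBoxes (signature ℓ i μ (reading μ))).head? = some p ∧ p ∉ ν ∧
      μ.cells = insert p ν.cells := by
  rw [removeGood, Option.bind_eq_some_iff] at h
  obtain ⟨p, h1, h2⟩ := h
  have h3 := (hr.minus_mem.1 ((mem_of_mem_boxes _ _).2 (List.mem_of_mem_head? h1))).1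
  obtain ⟨h4, h5⟩ := cells_eq_insert_iff.2 ⟨h3, ofBoxes_eq_some_iff.1 h2⟩
  exact ⟨p, h1, h4.1, h5⟩

variable (i) in
theorem IsTight.map_boxes_eq (hℓ : 3 ≤ ℓ) (hμ : IsTight ℓ μ) :
    (conormalBoxes (signature ℓ i μ (ladderReading ℓ μ))).map (ladderIndex ℓ) =
        (conormalBoxes (signature ℓ i (regularization ℓ hℓ μ)
          (rowReading (regularization ℓ hℓ μ)))).map (ladderIndex ℓ) ∧
      (normalBoxes (signature ℓ i μ (ladderReading ℓ μ))).map (ladderIndex ℓ) =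
        (normalBoxes (signature ℓ i (regularization ℓ hℓ μ)
          (rowReading (regularization ℓ hℓ μ)))).map (ladderIndex ℓ) :=
  (sameLadders_regularization hℓ).map_boxes_eq hℓ (isReading_ladderReading hℓ)
    isReading_rowReading (hμ.ladderSorted hℓ) ((isRegular_regularization hℓ).ladderSorted hℓ)

/-- The cogood boxes of `μ` and of its regularization exist together and lie on the same ladder.
Adding them keeps the ladder counts equal, and these determine the regular partition. -/
theorem IsTight.map_addCogood (hℓ : 3 ≤ ℓ) (hμ : IsTight ℓ μ) :
    (LadderCrystal.addCogood ℓ (ladderReading ℓ) i μ).map (regularization ℓ hℓ) =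
      LadderCrystal.addCogood ℓ rowReading i (regularization ℓ hℓ μ) := by
  have hr := isReading_ladderReading hℓ
  have hr' := isReading_rowReading
  have hmap := (hμ.map_boxes_eq i hℓ).1
  cases hf : LadderCrystal.addCogood ℓ rowReading i (regularization ℓ hℓ μ) with
  | none =>
    rw [hr'.addCogood_eq_none_iff] at hf
    rw [hf, List.map_nil, List.map_eq_nil_iff] at hmap
    rw [hr.addCogood_eq_none_iff.2 hmap]
    rfl
  | some ν' =>
    obtain ⟨q, hq1, hq2, hq3⟩ := hr'.exists_of_addCogood hf
    cases hf' : LadderCrystal.addCogood ℓ (ladderReading ℓ) i μ with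
    | none =>
      rw [hr.addCogood_eq_none_iff] at hf'
      rw [hf', List.map_nil, eq_comm, List.map_eq_nil_iff] at hmap
      rw [hmap] at hq1
      simp at hq1
    | some ν =>
      obtain ⟨p, hp1, hp2, hp3⟩ := hr.exists_of_addCogood hf'
      have hpq := congrArg List.getLast? hmap
      rw [List.getLast?_map, List.getLast?_map, hp1, hq1, Option.map_some, Option.map_some,
        Option.some_inj] at hpq
      rw [Option.map_some, Option.some_inj, regularization_eq_iff hℓ]
      refine ⟨(isRegular_regularization hℓ).addCogood hℓ hf, fun k => ?_⟩
      rw [card_onLadder_insert hp3 hp2, card_onLadder_insert hq3 hq2, hpq,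
        sameLadders_regularization hℓ k]

theorem IsTight.map_removeGood (hℓ : 3 ≤ ℓ) (hμ : IsTight ℓ μ) :
    (LadderCrystal.removeGood ℓ (ladderReading ℓ) i μ).map (regularization ℓ hℓ) =
      LadderCrystal.removeGood ℓ rowReading i (regularization ℓ hℓ μ) := by
  have hr := isReading_ladderReading hℓ
  have hr' := isReading_rowReading
  have hmap := (hμ.map_boxes_eq i hℓ).2
  cases hf : LadderCrystal.removeGood ℓ rowReading i (regularization ℓ hℓ μ) with
  | none =>
    rw [hr'.removeGood_eq_none_iff] at hf
    rw [hf, List.map_nil, List.map_eq_nil_iff] at hmap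
    rw [hr.removeGood_eq_none_iff.2 hmap]
    rfl
  | some ν' =>
    obtain ⟨q, hq1, hq2, hq3⟩ := hr'.exists_of_removeGood hf
    cases hf' : LadderCrystal.removeGood ℓ (ladderReading ℓ) i μ with
    | none =>
      rw [hr.removeGood_eq_none_iff] at hf'
      rw [hf', List.map_nil, eq_comm, List.map_eq_nil_iff] at hmap
      rw [hmap] at hq1
      simp at hq1
    | some ν =>
      obtain ⟨p, hp1, hp2, hp3⟩ := hr.exists_of_removeGood hf'
      have hpq := congrArg List.head? hmap
      rw [List.head?_map, List.head?_map, hp1, hq1, Option.map_some, Option.map_some,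
        Option.some_inj] at hpq
      rw [Option.map_some, Option.some_inj, regularization_eq_iff hℓ]
      refine ⟨(isRegular_regularization hℓ).removeGood hℓ hf, fun k => ?_⟩
      have h1 := card_onLadder_insert (ℓ := ℓ) hp3 hp2 k
      have h2 := card_onLadder_insert (ℓ := ℓ) hq3 hq2 k
      have h3 := sameLadders_regularization (μ := μ) hℓ k
      rw [hpq] at h1
      omega

theorem sum_residue_eq (hℓ : 3 ≤ ℓ) {M : Type*} [AddCommMonoid M] (g : ZMod ℓ → M)
    (h : SameLadders ℓ μ ν) :
    ∑ p ∈ μ.cells, g (residue ℓ p) = ∑ p ∈ ν.cells, g (residue ℓ p) := by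
  have key : ∀ ρ : YoungDiagram, ρ ∈ ({μ, ν} : Set YoungDiagram) →
      ∑ p ∈ ρ.cells, g (residue ℓ p) =
        ∑ k ∈ (μ.cells ∪ ν.cells).image (ladderIndex ℓ),
          (onLadder ℓ ρ.cells k).card • g (-(k : ZMod ℓ)) := by
    intro ρ hρ
    rw [← Finset.sum_fiberwise_of_maps_to (g := ladderIndex ℓ)
      (t := (μ.cells ∪ ν.cells).image (ladderIndex ℓ))]
    · refine Finset.sum_congr rfl fun k _ => ?_
      rw [← Finset.sum_const]
      refine Finset.sum_congr rfl fun p hp => ?_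
      rw [residue_eq_neg_ladderIndex hℓ, (Finset.mem_filter.1 hp).2]
    · intro p hp
      refine Finset.mem_image_of_mem _ ?_
      rcases hρ with rfl | rfl
      · exact Finset.mem_union_left _ hp
      · exact Finset.mem_union_right _ hp
  rw [key μ (by simp), key ν (by simp)]
  exact Finset.sum_congr rfl fun k _ => by rw [h k]

theorem weight_regularization (hℓ : 3 ≤ ℓ) :
    weight ℓ (regularization ℓ hℓ μ) = weight ℓ μ := by
  rw [weight, weight, ← sum_residue_eq hℓ (simpleRoot ℓ) (sameLadders_regularization hℓ)]

theorem card_lt_of_removeGood {before : ℕ × ℕ → ℕ × ℕ → Prop}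
    {reading : YoungDiagram → List (ℕ × ℕ)} (hr : IsReading before reading)
    (h : removeGood ℓ reading i μ = some ν) : ν.card < μ.card := by
  obtain ⟨p, -, hp, h⟩ := hr.exists_of_removeGood h
  have := Finset.card_insert_of_notMem (s := ν.cells) (a := p) hp
  rw [← h] at this
  exact Nat.lt_of_succ_le this.ge

theorem removeGood_eq_some_iff_addCogood {before : ℕ × ℕ → ℕ × ℕ → Prop}
    {reading : YoungDiagram → List (ℕ × ℕ)} (hr : IsReading before reading) (hℓ : 3 ≤ ℓ) :
    removeGood ℓ reading i μ = some ν ↔ addCogood ℓ reading i ν = some μ :=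
  (hr.isCrystal hℓ (node := Set.univ) (fun _ _ _ _ _ => trivial)
    (fun _ _ _ _ _ => trivial)).1 i μ ν

theorem regularization_bot (hℓ : 3 ≤ ℓ) : regularization ℓ hℓ ⊥ = ⊥ := by
  rw [regularization_eq_iff hℓ]
  refine ⟨(isRegular_iff hℓ).2 ?_, fun _ => rfl⟩
  exact fun _ _ _ _ _ _ h => absurd h (YoungDiagram.notMem_bot _)

theorem eq_bot_of_regularization_eq_bot (hℓ : 3 ≤ ℓ) (h : regularization ℓ hℓ μ = ⊥) :
    μ = ⊥ := by
  refine YoungDiagram.ext ?_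
  rw [YoungDiagram.cells_bot, Finset.eq_empty_iff_forall_notMem]
  intro p hp
  have h1 := ((regularization_eq_iff hℓ).1 h).2 (ladderIndex ℓ p)
  have h2 : p ∈ onLadder ℓ μ.cells (ladderIndex ℓ p) :=
    (mem_onLadder _ _ _ _).2 ⟨hp, rfl⟩
  rw [show onLadder ℓ (⊥ : YoungDiagram).cells (ladderIndex ℓ p) = ∅ from rfl,
    Finset.card_empty, Finset.card_eq_zero] at h1
  rw [h1] at h2
  simp at h2

theorem LadderNode.isTight (hℓ : 3 ≤ ℓ) (h : LadderNode ℓ μ) : IsTight ℓ μ := by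
  induction h with
  | empty => exact isTight_bot
  | step i μ ν _ hf ih => exact ih.addCogood hℓ hf

/-- Induction on size: a good box of the regularization provides a good box of `μ`. Its removal
keeps tightness, and the operator `f̂` puts it back. -/
theorem IsTight.ladderNode (hℓ : 3 ≤ ℓ) (h : IsTight ℓ μ) : LadderNode ℓ μ := by
  have hr := isReading_ladderReading hℓ
  induction hn : μ.card using Nat.strong_induction_on generalizing μ with
  | _ n ih =>
    subst hn
    by_cases hbot : regularization ℓ hℓ μ = ⊥
    · rw [eq_bot_of_regularization_eq_bot hℓ hbot]
      exact LadderNode.empty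
    · obtain ⟨i, ν', hν'⟩ := (isRegular_regularization hℓ).exists_removeGood hℓ hbot
      rw [← h.map_removeGood hℓ, Option.map_eq_some_iff] at hν'
      obtain ⟨ν, hν, -⟩ := hν'
      exact LadderNode.step i ν μ
        (ih _ (card_lt_of_removeGood hr hν) (h.removeGood hℓ hν) rfl)
        ((removeGood_eq_some_iff_addCogood hr hℓ).1 hν)

/-- Remove a good box, lift the smaller partition to a tight one by induction, and add the box back
on the tight side. -/
theorem IsRegular.exists_isTight (hℓ : 3 ≤ ℓ) (h : IsRegular ℓ μ) :
    ∃ ν, IsTight ℓ ν ∧ regularization ℓ hℓ ν = μ := by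
  have hr := isReading_rowReading
  induction hn : μ.card using Nat.strong_induction_on generalizing μ with
  | _ n ih =>
    subst hn
    by_cases hbot : μ = ⊥
    · exact ⟨⊥, isTight_bot, hbot ▸ regularization_bot hℓ⟩
    · obtain ⟨i, μ', hμ'⟩ := h.exists_removeGood hℓ hbot
      obtain ⟨ν', hν', hreg⟩ :=
        ih _ (card_lt_of_removeGood hr hμ') (h.removeGood hℓ hμ') rfl
      have h1 := (removeGood_eq_some_iff_addCogood hr hℓ).1 hμ'
      rw [← hreg, ← hν'.map_addCogood hℓ, Option.map_eq_some_iff] at h1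
      obtain ⟨ν, hν, hreg'⟩ := h1
      exact ⟨ν, hν'.addCogood hℓ hν, hreg'⟩

end Regularization

/-! ### Deregularization -/

section Deregularization

variable {ℓ : ℕ} {μ ν : YoungDiagram}

theorem exists_last_of_le {P : ℕ → Prop} {k m : ℕ} (hkm : k ≤ m) (hk : P k) (hm : ¬ P m) :
    ∃ j, k ≤ j ∧ j < m ∧ P j ∧ ¬ P (j + 1) := by
  induction m, hkm using Nat.le_induction with
  | base => exact absurd hk hm
  | succ m hkm ih =>
    by_cases h : P m
    · exact ⟨m, hkm, Nat.lt_succ_self m, h, hm⟩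
    · obtain ⟨j, h1, h2, h3⟩ := ih h
      exact ⟨j, h1, h2.trans (Nat.lt_succ_self m), h3⟩

/-- On a ladder, an unoccupied position followed downwards by an occupied one cannot be followed
later by an occupied-unoccupied step. Otherwise climb column `y` from the lower gap: the rows from
`a + (ℓ - 1)` upwards, down to but excluding row `a`, end in column `y + n`, so tightness propagates
the gap. After `ℓ - 1` rows it reaches the left neighbour of an occupied position. -/
theorem IsTight.not_gap (hμ : IsTight ℓ μ) {a y n : ℕ} (h1 : (a, y + n + 1) ∉ μ)
    (h2 : (a + (ℓ - 1), y + n) ∈ μ) (h3 : (a + (ℓ - 1) * n, y + 1) ∈ μ) (hn : 0 < n) :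
    (a + (ℓ - 1) * (n + 1), y) ∈ μ := by
  by_contra h4
  have hle : ℓ - 1 ≤ (ℓ - 1) * n := Nat.le_mul_of_pos_right _ hn
  rw [mul_add, mul_one] at h4
  have key : ∀ s ≤ ℓ - 1, (a + ((ℓ - 1) * n + (ℓ - 1)) - s, y) ∉ μ := by
    intro s
    induction s with
    | zero => exact fun _ => h4
    | succ s ih =>
      intro hs hmem
      refine ih (by omega) ?_
      obtain ⟨c, hc⟩ : ∃ c, a + ((ℓ - 1) * n + (ℓ - 1)) - s = c + 1 :=
        ⟨a + ((ℓ - 1) * n + (ℓ - 1)) - s - 1, by omega⟩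
      rw [hc]
      refine hμ (a + (ℓ - 1) - s) (y + n) c y ?_ (by omega)
        (μ.up_left_mem (by omega) le_rfl h2)
        (fun h => h1 (μ.up_left_mem (by omega) (by omega) h)) ?_
      · simp only [ladderIndex, mul_add]
        omega
      · rwa [show c = a + ((ℓ - 1) * n + (ℓ - 1)) - (s + 1) by omega]
  have := key (ℓ - 1) le_rfl
  rw [show a + ((ℓ - 1) * n + (ℓ - 1)) - (ℓ - 1) = a + (ℓ - 1) * n by omega] at this
  exact this (μ.up_left_mem le_rfl (by simp) h3)

/-- On a ladder of a tight partition, the positions above a box that is higher than an unoccupied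
position are occupied. -/
theorem IsTight.mem_of_above (hℓ : 3 ≤ ℓ) (hμ : IsTight ℓ μ) {a b c d e f : ℕ}
    (hp : (a, b) ∈ μ) (hl : ladderIndex ℓ (a, b) = ladderIndex ℓ (c, d)) (hac : a ≤ c)
    (hq : (c, d) ∉ μ) (hl' : ladderIndex ℓ (e, f) = ladderIndex ℓ (a, b)) (hea : e ≤ a) :
    (e, f) ∈ μ := by
  by_contra hr
  obtain ⟨k, rfl, rfl⟩ := exists_of_ladderIndex_eq hℓ hl' hea
  obtain ⟨m, rfl, rfl⟩ := exists_of_ladderIndex_eq hℓ hl hac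
  -- The ladder is numbered downwards from `(e, f)`. `P` fails at `0`, holds at `k` and fails at `m
  -- + k`, so it switches on after some `s` and off after some later `t`, contrary to
  -- `IsTight.not_gap`.
  set P : ℕ → Prop := fun j => (e + (ℓ - 1) * j, d + (m + k) - j) ∈ μ with hP
  have h0 : ¬ P 0 := by
    intro h
    refine hr ?_
    simp only [hP, mul_zero, add_zero, Nat.sub_zero] at h
    rwa [add_assoc]
  have hk : P k := by
    simp only [hP]
    rwa [← add_assoc, Nat.add_sub_cancel]
  have hm : ¬ P (m + k) := by
    intro h
    refine hq ?_
    simp only [hP] at h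
    rw [Nat.add_sub_cancel, add_comm m k, mul_add, ← add_assoc] at h
    exact h
  obtain ⟨s, -, hs1, hs2, hs3⟩ := exists_last_of_le (P := fun j => ¬ P j) (Nat.zero_le k) h0
    (not_not.2 hk)
  rw [not_not] at hs3
  obtain ⟨t, ht1, ht2, ht3, ht4⟩ := exists_last_of_le (Nat.le_add_left k m) hk hm
  obtain ⟨n, rfl⟩ := Nat.exists_eq_add_of_le (show s ≤ t by omega)
  simp only [hP] at hs2 hs3 ht3 ht4
  refine ht4 ?_
  have h5 := hμ.not_gap (a := e + (ℓ - 1) * s) (y := d + (m + k) - (s + n + 1)) (n := n)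
    ?_ ?_ ?_ (by omega)
  · rwa [add_assoc, ← mul_add, ← add_assoc] at h5
  · rwa [show d + (m + k) - (s + n + 1) + n + 1 = d + (m + k) - s by omega]
  · rw [mul_add, mul_one, ← add_assoc] at hs3
    rwa [show d + (m + k) - (s + n + 1) + n = d + (m + k) - (s + 1) by omega]
  · rw [mul_add, ← add_assoc] at ht3
    rwa [show d + (m + k) - (s + n + 1) + 1 = d + (m + k) - (s + n) by omega]

/-! ### Locked boxes -/

theorem mem_of_locked {p : ℕ × ℕ} (h : Locked ℓ μ p) : p ∈ μ := by
  induction h with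
  | typeI_top b h _ => exact h
  | typeI_below a b h _ _ _ => exact h
  | typeII a b c hbc _ ih => exact μ.up_left_mem le_rfl hbc.le ih

theorem mem_iff_of_regular (hℓ : 3 ≤ ℓ) (hν : IsRegular ℓ ν) (h : SameLadders ℓ μ ν)
    {a b : ℕ} :
    (a, b) ∈ ν ↔ a / (ℓ - 1) < (onLadder ℓ μ.cells (ladderIndex ℓ (a, b))).card := by
  rw [← (regularization_eq_iff hℓ).2 ⟨hν, h⟩, mem_regularization hℓ]

theorem ladderIndex_right_add (ℓ a b m : ℕ) :
    ladderIndex ℓ (a, b + m) = ladderIndex ℓ (a, b) + (ℓ - 1) * m := by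
  simp only [ladderIndex]; ring

/-- The ladder of `(a, b)` is full in `μ` from `(a, b)` upwards, so `ν` also reaches `(a, b)`.
Moving down a row maps the boxes of `μ` on the preceding ladder into `μ`, by this fullness or by
tightness. The resulting inequality of counts excludes an empty position of `ν` with a box directly
above it. -/
theorem IsTight.noRoomBelow (hℓ : 3 ≤ ℓ) (hμ : IsTight ℓ μ) (hν : IsRegular ℓ ν)
    (h : SameLadders ℓ μ ν) {a b c d : ℕ} (hl : ladderIndex ℓ (a, b) = ladderIndex ℓ (c, d))
    (hac : a < c) (hp : (a, b) ∈ μ) (hend : (a, b + 1) ∉ μ) (hq : (c, d) ∉ μ) :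
    (a, b) ∈ ν ∧ NoRoomBelow ℓ ν (a, b) := by
  have habove : ∀ e f, ladderIndex ℓ (e, f) = ladderIndex ℓ (a, b) → e ≤ a → (e, f) ∈ μ :=
    fun e f hef hea => hμ.mem_of_above hℓ hp hl hac.le hq hef hea
  constructor
  · rw [mem_iff_of_regular hℓ hν h, ← card_above hℓ]
    refine Finset.card_lt_card ((Finset.ssubset_iff_of_subset ?_).2 ⟨(a, b), ?_, by simp⟩)
    · rintro ⟨e, f⟩ hx
      rw [Finset.mem_filter, mem_ladder hℓ] at hx
      exact (mem_onLadder _ _ _ _).2 ⟨habove e f hx.1 hx.2.le, hx.1⟩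
    · exact (mem_onLadder _ _ _ _).2 ⟨hp, rfl⟩
  · intro c₁ d₁ hl₁ hac₁ hn₁ hm₁
    simp only at hac₁
    rw [mem_iff_of_regular hℓ hν h, not_lt, hl₁] at hn₁
    rw [mem_iff_of_regular hℓ hν h] at hm₁
    have hl₂ : ladderIndex ℓ (c₁ - 1, d₁) + 1 = ladderIndex ℓ (a, b) := by
      rw [← ladderIndex_down, Nat.sub_add_cancel (by omega), hl₁]
    set S := onLadder ℓ μ.cells (ladderIndex ℓ (a, b)) with hS
    set T := onLadder ℓ μ.cells (ladderIndex ℓ (c₁ - 1, d₁)) with hT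
    have hTS : T.card ≤ (S.filter fun q => 0 < q.1).card := by
      refine Finset.card_le_card_of_injOn (fun q => (q.1 + 1, q.2)) ?_ ?_
      · rintro ⟨e, f⟩ hx
        rw [Finset.mem_coe, hT, mem_onLadder] at hx
        have hef : ladderIndex ℓ (e + 1, f) = ladderIndex ℓ (a, b) := by
          rw [ladderIndex_down, hx.2, hl₂]
        rw [Finset.mem_coe, Finset.mem_filter, hS, mem_onLadder]
        refine ⟨⟨?_, hef⟩, Nat.succ_pos e⟩
        by_cases hea : e + 1 ≤ a
        · exact habove _ _ hef hea
        · exact hμ a b e f hef.symm (by omega) hp hend hx.1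
      · rintro ⟨e, f⟩ _ ⟨e', f'⟩ _ he
        simpa using he
    have hle : (S.filter fun q => 0 < q.1).card ≤ S.card := Finset.card_filter_le _ _
    -- If `ℓ - 1` divides `c₁`, the quotient drops by one in the row above; the compensation is that
    -- the ladder meets the first row in a box that is not hit by the shift.
    by_cases hdvd : ℓ - 1 ∣ c₁
    · obtain ⟨m, rfl⟩ := hdvd
      have h0 : ladderIndex ℓ (0, m + d₁) = ladderIndex ℓ (a, b) := by
        rw [← hl₁]
        simp only [ladderIndex]
        ring
      have hlt : (S.filter fun q => 0 < q.1).card < S.card := by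
        refine Finset.card_lt_card ((Finset.ssubset_iff_of_subset (Finset.filter_subset _ _)).2
          ⟨(0, m + d₁), ?_, by simp⟩)
        exact (mem_onLadder _ _ _ _).2 ⟨habove _ _ h0 (Nat.zero_le _), h0⟩
      rw [Nat.mul_div_cancel_left _ (by omega)] at hn₁
      have : ((ℓ - 1) * m - 1) / (ℓ - 1) + 1 = m := by
        have h1 := Nat.succ_div_of_dvd (a := (ℓ - 1) * m - 1) (b := ℓ - 1)
          (by rw [Nat.sub_add_cancel (by omega)]; exact Dvd.intro m rfl)
        rw [Nat.sub_add_cancel (by omega), Nat.mul_div_cancel_left _ (by omega)] at h1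
        exact h1.symm
      omega
    · have h1 := Nat.succ_div_of_not_dvd (a := c₁ - 1) (b := ℓ - 1)
        (by rwa [Nat.sub_add_cancel (by omega)])
      rw [Nat.sub_add_cancel (by omega)] at h1
      omega

/-- The boxes of a tight partition that are higher on their ladder than an unoccupied position
are locked in the regularization. -/
theorem IsTight.locked_of_above (hℓ : 3 ≤ ℓ) (hμ : IsTight ℓ μ) (hν : IsRegular ℓ ν)
    (h : SameLadders ℓ μ ν) (a : ℕ) : ∀ b c d : ℕ,
    ladderIndex ℓ (a, b) = ladderIndex ℓ (c, d) → a < c → (a, b) ∈ μ → (c, d) ∉ μ →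
      Locked ℓ ν (a, b) := by
  -- The last box of a row suffices: the gap moves along to the right, and rule II carries the lock
  -- back to the left.
  have reduce : ∀ a : ℕ, (∀ b c d : ℕ, ladderIndex ℓ (a, b) = ladderIndex ℓ (c, d) → a < c →
      (a, b) ∈ μ → (a, b + 1) ∉ μ → (c, d) ∉ μ → Locked ℓ ν (a, b)) →
      ∀ b c d : ℕ, ladderIndex ℓ (a, b) = ladderIndex ℓ (c, d) → a < c →
        (a, b) ∈ μ → (c, d) ∉ μ → Locked ℓ ν (a, b) := by
    intro a hend b c d hl hac hp hq
    have hb := YoungDiagram.mem_iff_lt_rowLen.1 hp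
    obtain ⟨m, hm⟩ := Nat.exists_eq_add_of_lt hb
    have hlock := hend (b + m) c (d + m)
      (by rw [ladderIndex_right_add, ladderIndex_right_add, hl]) hac
      (YoungDiagram.mem_iff_lt_rowLen.2 (by omega))
      (fun h => by have := YoungDiagram.mem_iff_lt_rowLen.1 h; omega)
      (fun h => hq (μ.up_left_mem le_rfl (by omega) h))
    rcases Nat.eq_zero_or_pos m with rfl | hm0
    · exact hlock
    · exact Locked.typeII a b (b + m) (by omega) hlock
  induction a with
  | zero =>
    refine reduce _ fun b c d hl hac hp hend hq => ?_
    obtain ⟨h1, h2⟩ := hμ.noRoomBelow hℓ hν h hl hac hp hend hq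
    exact Locked.typeI_top b h1 h2
  | succ a ih =>
    refine reduce _ fun b c d hl hac hp hend hq => ?_
    obtain ⟨h1, h2⟩ := hμ.noRoomBelow hℓ hν h hl hac hp hend hq
    obtain ⟨c, rfl⟩ : ∃ c', c = c' + 1 := ⟨c - 1, by omega⟩
    -- By tightness the position above the gap is unoccupied too, so the induction hypothesis locks
    -- the box above.
    refine Locked.typeI_below a b h1 (ih b c d ?_ (by omega)
      (μ.up_left_mem (by simp) le_rfl hp) ?_) h2
    · rw [ladderIndex_down, ladderIndex_down] at hl
      omega
    · exact fun hcd => hq (hμ _ _ _ _ hl hac hp hend hcd)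

/-- If `(a, b)` were missing from `μ`, the ladder would have a first position empty in `ν`, lying
below `(a, b)`; by hypothesis the position above it is empty in `ν`. But moving boxes of `μ` up a
row injects them into the preceding ladder and, when `0 < a`, misses `(a - 1, b)`. That ladder then
holds too many boxes for this. -/
theorem mem_of_noRoomBelow (hℓ : 3 ≤ ℓ) (hν : IsRegular ℓ ν)
    (h : SameLadders ℓ μ ν) {a b : ℕ} (hp : (a, b) ∈ ν) (hroom : NoRoomBelow ℓ ν (a, b))
    (hup : ∀ c, a = c + 1 → (c, b) ∈ μ) : (a, b) ∈ μ := by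
  by_contra hn
  rw [mem_iff_of_regular hℓ hν h] at hp
  set k := ladderIndex ℓ (a, b) with hk
  set S := onLadder ℓ μ.cells k with hS
  have hdpos : 0 < ℓ - 1 := by omega
  have hlt : S.card < k / (ℓ - 1) + 1 := by
    refine lt_of_lt_of_le (Finset.card_lt_card ?_) (card_ladder_le hℓ k)
    refine (Finset.ssubset_iff_of_subset (onLadder_subset_ladder hℓ k)).2 ⟨(a, b), ?_, ?_⟩
    · exact (mem_ladder hℓ _ _).2 rfl
    · exact fun hm => hn ((mem_onLadder _ _ _ _).1 hm).1
  have hmod : a % (ℓ - 1) = k % (ℓ - 1) := by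
    rw [hk, ladderIndex, Nat.add_mul_mod_self_left]
  have hza : a < k % (ℓ - 1) + (ℓ - 1) * S.card := by
    rw [← hmod]
    conv_lhs => rw [← Nat.mod_add_div a (ℓ - 1)]
    exact Nat.add_lt_add_left (Nat.mul_lt_mul_of_pos_left hp hdpos) _
  -- This is the highest position of ladder `k` that is not occupied in `ν`.
  have hzl : ladderIndex ℓ (k % (ℓ - 1) + (ℓ - 1) * S.card, k / (ℓ - 1) - S.card) = k := by
    simp only [ladderIndex]
    rw [add_assoc, ← mul_add, Nat.add_sub_cancel' (by omega), Nat.mod_add_div]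
  have hmlt := Nat.mod_lt k hdpos
  have hz : (k % (ℓ - 1) + (ℓ - 1) * S.card, k / (ℓ - 1) - S.card) ∉ ν := by
    rw [mem_iff_of_regular hℓ hν h, hzl, Nat.add_mul_div_left _ _ hdpos, Nat.div_eq_of_lt hmlt,
      zero_add]
    exact lt_irrefl _
  have hz' := hroom _ _ hzl hza hz
  obtain ⟨z, hz1⟩ : ∃ z, k % (ℓ - 1) + (ℓ - 1) * S.card = z + 1 :=
    ⟨k % (ℓ - 1) + (ℓ - 1) * S.card - 1, by omega⟩
  rw [hz1] at hzl hz'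
  rw [Nat.add_sub_cancel, mem_iff_of_regular hℓ hν h, not_lt] at hz'
  rw [ladderIndex_down] at hzl
  set T := onLadder ℓ μ.cells (ladderIndex ℓ (z, k / (ℓ - 1) - S.card)) with hT
  have hmap : ∀ X : Finset (ℕ × ℕ), (∀ q ∈ X, q ∈ S ∧ 0 < q.1) → ∀ Y : Finset (ℕ × ℕ),
      (∀ q ∈ X, (q.1 - 1, q.2) ∈ T → (q.1 - 1, q.2) ∈ Y) → X.card ≤ Y.card := by
    intro X hX Y hY
    refine Finset.card_le_card_of_injOn (fun q => (q.1 - 1, q.2)) ?_ ?_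
    · rintro ⟨e, f⟩ hq
      obtain ⟨h1, h2⟩ := hX _ hq
      refine hY _ hq ?_
      rw [hS, mem_onLadder] at h1
      obtain ⟨e, rfl⟩ : ∃ e', e = e' + 1 := ⟨e - 1, by simp only at h2; omega⟩
      rw [ladderIndex_down] at h1
      refine (mem_onLadder _ _ _ _).2 ⟨μ.up_left_mem (by simp) le_rfl h1.1, ?_⟩
      simp only [Nat.add_sub_cancel]
      omega
    · rintro ⟨e, f⟩ hq ⟨e', f'⟩ hq' he
      have h1 := (hX _ hq).2
      have h2 := (hX _ hq').2
      simp only [Prod.mk.injEq] at he h1 h2 ⊢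
      omega
  have htop : ∀ q ∈ S, q.1 = 0 → k % (ℓ - 1) = 0 ∧ q = (0, k / (ℓ - 1)) := by
    rintro ⟨e, f⟩ hq rfl
    rw [hS, mem_onLadder] at hq
    have h1 : (ℓ - 1) * f = k := by simpa [ladderIndex] using hq.2
    rw [← h1, Nat.mul_mod_right, Nat.mul_div_cancel_left _ hdpos]
    exact ⟨rfl, rfl⟩
  have hcount : S.card ≤ (S.filter fun q => 0 < q.1).card + 1 := by
    have hsub : S ⊆ insert (0, k / (ℓ - 1)) (S.filter fun q => 0 < q.1) := by
      intro q hq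
      rw [Finset.mem_insert, Finset.mem_filter]
      rcases Nat.eq_zero_or_pos q.1 with h0 | h0
      · exact Or.inl (htop q hq h0).2
      · exact Or.inr ⟨hq, h0⟩
    exact (Finset.card_le_card hsub).trans (Finset.card_insert_le _ _)
  have hdiv : (z + 1) / (ℓ - 1) = S.card := by
    rw [← hz1, Nat.add_mul_div_left _ _ hdpos, Nat.div_eq_of_lt hmlt, zero_add]
  -- For `a = 0` the only position of the ladder in the first row is missing from `μ`, so all of `S`
  -- can be moved up. Otherwise a possible box of `S` in the first row is lost, but `(a, b)` in `T`
  -- is not hit.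
  rcases a with _ | a
  · have hST : S.card ≤ T.card := by
      refine hmap S (fun q hq => ⟨hq, Nat.pos_of_ne_zero fun h0 => ?_⟩) T fun _ _ h => h
      obtain ⟨-, rfl⟩ := htop q hq h0
      rw [hS, mem_onLadder] at hq
      have hb := ladderIndex_inj_of_row hℓ (hq.2.trans hk)
      rw [hb] at hq
      exact hn hq.1
    have h0 : k % (ℓ - 1) = 0 := by rw [← hmod, Nat.zero_mod]
    have hdvd : ℓ - 1 ∣ z + 1 := by rw [← hz1, h0, zero_add]; exact Dvd.intro _ rfl
    have := Nat.succ_div_of_dvd hdvd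
    omega
  · have hTmem : (a, b) ∈ T := by
      refine (mem_onLadder _ _ _ _).2 ⟨hup a rfl, ?_⟩
      rw [ladderIndex_down] at hk
      omega
    have hST : (S.filter fun q => 0 < q.1).card ≤ (T.erase (a, b)).card := by
      refine hmap _ (fun q hq => Finset.mem_filter.1 hq) _ fun q hq hqT => ?_
      refine Finset.mem_erase.2 ⟨fun he => hn ?_, hqT⟩
      obtain ⟨e, f⟩ := q
      simp only [Prod.mk.injEq] at he
      rw [Finset.mem_filter] at hq
      obtain rfl : e = a + 1 := by have := hq.2; simp only at this; omega
      rw [← he.2]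
      exact ((mem_onLadder _ _ _ _).1 hq.1).1
    have hTpos := Finset.card_pos.2 ⟨_, hTmem⟩
    rw [Finset.card_erase_of_mem hTmem] at hST
    by_cases h0 : k % (ℓ - 1) = 0
    · have hdvd : ℓ - 1 ∣ z + 1 := by rw [← hz1, h0, zero_add]; exact Dvd.intro _ rfl
      have := Nat.succ_div_of_dvd hdvd
      omega
    · have hall : (S.filter fun q => 0 < q.1) = S :=
        Finset.filter_true_of_mem fun q hq => Nat.pos_of_ne_zero fun hq0 => h0 (htop q hq hq0).1
      rw [hall] at hST
      have := Nat.div_le_div_right (c := ℓ - 1) (Nat.le_succ z)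
      rw [Nat.succ_eq_add_one, hdiv] at this
      omega

/-- Induction along the locking rules. The locked boxes of a regular partition are common to all
partitions with this regularization, tight or not. -/
theorem mem_of_locked_of_sameLadders (hℓ : 3 ≤ ℓ) (hν : IsRegular ℓ ν) (h : SameLadders ℓ μ ν)
    {p : ℕ × ℕ} (hp : Locked ℓ ν p) : p ∈ μ := by
  induction hp with
  | typeI_top b h1 h2 =>
    exact mem_of_noRoomBelow hℓ hν h h1 h2 fun c hc => absurd hc (by omega)
  | typeI_below a b h1 _ h2 ih =>
    refine mem_of_noRoomBelow hℓ hν h h1 h2 fun c hc => ?_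
    obtain rfl : a = c := by omega
    exact ih
  | typeII a b c hbc _ ih => exact μ.up_left_mem le_rfl hbc.le ih

theorem lowest_eq {s t : Finset (ℕ × ℕ)} (hts : t ⊆ s)
    (hs : ∀ p ∈ s, ∀ q ∈ s, p.1 = q.1 → p = q)
    (hlow : ∀ p ∈ t, ∀ q ∈ s, p.1 < q.1 → q ∈ t) : lowest s t.card = t := by
  ext p
  rw [lowest, Finset.mem_filter]
  constructor
  · rintro ⟨hp, hcard⟩
    by_contra hn
    refine absurd (Finset.card_le_card (s := t) ?_) (not_le.2 hcard)
    intro q hq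
    refine Finset.mem_filter.2 ⟨hts hq, ?_⟩
    rcases lt_trichotomy p.1 q.1 with h | h | h
    · exact h
    · exact absurd (hs p hp q (hts hq) h ▸ hq) hn
    · exact absurd (hlow q hq p hp h) hn
  · intro hp
    refine ⟨hts hp, Finset.card_lt_card
      ((Finset.ssubset_iff_of_subset ?_).2 ⟨p, hp, by simp⟩)⟩
    intro q hq
    rw [Finset.mem_filter] at hq
    exact hlow p hp q hq.1 hq.2

/-- Both partitions contain the locked boxes `K` of `ν`, so they have equally many other boxes on
each ladder. Those of `μ` are not locked, hence have no unoccupied position below them, and fill the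
lowest positions outside `K`. -/
theorem IsTight.deregularization_eq (hℓ : 3 ≤ ℓ) (hμ : IsTight ℓ μ) (hν : IsRegular ℓ ν)
    (h : SameLadders ℓ μ ν) : deregularization ℓ ν = some μ := by
  classical
  rw [deregularization, ofBoxes_eq_some_iff]
  set K := lockedBoxes ℓ ν with hK
  have hKmem : ∀ p, p ∈ K ↔ Locked ℓ ν p := by
    intro p
    rw [hK, lockedBoxes, Finset.mem_filter, YoungDiagram.mem_cells, and_iff_right_iff_imp]
    exact mem_of_locked
  have hKμ : ∀ p ∈ K, p ∈ μ := fun p hp => mem_of_locked_of_sameLadders hℓ hν h ((hKmem p).1 hp)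
  have hKν : ∀ p ∈ K, p ∈ ν := fun p hp => mem_of_locked ((hKmem p).1 hp)
  have hU : unlockedBoxes ℓ ν = ν.cells \ K := by
    ext p
    rw [unlockedBoxes, Finset.mem_filter, Finset.mem_sdiff, hKmem]
  have hsplit : ∀ ρ : YoungDiagram, (∀ p ∈ K, p ∈ ρ) → ∀ k,
      (onLadder ℓ (ρ.cells \ K) k).card + (onLadder ℓ K k).card =
        (onLadder ℓ ρ.cells k).card := by
    intro ρ hρ k
    have hsub : K ⊆ ρ.cells := fun p hp => (YoungDiagram.mem_cells _).2 (hρ p hp)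
    rw [onLadder, onLadder, onLadder, ← Finset.card_union_of_disjoint,
      ← Finset.filter_union, Finset.sdiff_union_of_subset hsub]
    exact Finset.disjoint_filter_filter Finset.sdiff_disjoint
  have hcard : ∀ k, (onLadder ℓ (unlockedBoxes ℓ ν) k).card =
      (onLadder ℓ (μ.cells \ K) k).card := by
    intro k
    have h1 := hsplit μ hKμ k
    have h2 := hsplit ν hKν k
    have h3 := h k
    rw [hU]
    omega
  have hmem : ∀ p k, p ∈ onLadder ℓ (μ.cells \ K) k ↔ p ∈ μ ∧ p ∉ K ∧ ladderIndex ℓ p = k := by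
    intro p k
    rw [onLadder, Finset.mem_filter, Finset.mem_sdiff, YoungDiagram.mem_cells, and_assoc]
  have hlow : ∀ k, lowest (ladder ℓ k \ K) (onLadder ℓ (unlockedBoxes ℓ ν) k).card =
      onLadder ℓ (μ.cells \ K) k := by
    intro k
    rw [hcard]
    refine lowest_eq ?_ ?_ ?_
    · intro p hp
      rw [hmem] at hp
      rw [Finset.mem_sdiff, mem_ladder hℓ]
      exact ⟨hp.2.2, hp.2.1⟩
    · rintro ⟨a, b⟩ hp ⟨c, d⟩ hq hpq
      rw [Finset.mem_sdiff, mem_ladder hℓ] at hp hq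
      simp only at hpq
      subst hpq
      rw [ladderIndex_inj_of_row hℓ (hp.1.trans hq.1.symm)]
    · rintro ⟨a, b⟩ hp ⟨c, d⟩ hq hpq
      rw [hmem] at hp ⊢
      rw [Finset.mem_sdiff, mem_ladder hℓ] at hq
      refine ⟨?_, hq.2, hq.1⟩
      by_contra hn
      exact hp.2.1 ((hKmem _).2 (hμ.locked_of_above hℓ hν h a b c d
        (hp.2.2.trans hq.1.symm) hpq hp.1 hn))
  ext p
  rw [deregBoxes, ← hK]
  simp only [hlow, Finset.mem_union, Finset.mem_biUnion, hmem, YoungDiagram.mem_cells]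
  constructor
  · intro hp
    by_cases hpK : p ∈ K
    · exact Or.inl hpK
    · refine Or.inr ⟨ladderIndex ℓ p, ?_, hp, hpK, rfl⟩
      -- `deregBoxes` runs only over ladders carrying an unlocked box of `ν`; equality of the counts
      -- provides one.
      have hpos : 0 < (onLadder ℓ (unlockedBoxes ℓ ν) (ladderIndex ℓ p)).card := by
        rw [hcard]
        exact Finset.card_pos.2 ⟨p, (hmem _ _).2 ⟨hp, hpK, rfl⟩⟩
      obtain ⟨q, hq⟩ := Finset.card_pos.1 hpos
      rw [onLadder, Finset.mem_filter] at hq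
      exact Finset.mem_image.2 ⟨q, hq⟩
  · rintro (hp | ⟨k, -, hp, -⟩)
    · exact hKμ p hp
    · exact hp

end Deregularization

/-! ### The isomorphisms of crystals -/

section Main

variable {ℓ : ℕ}

theorem mem_node_ladderCrystal (hℓ : 3 ≤ ℓ) {μ : YoungDiagram} :
    μ ∈ (ladderCrystal ℓ).node ↔ IsTight ℓ μ :=
  ⟨LadderNode.isTight hℓ, IsTight.ladderNode hℓ⟩

theorem isCrystal_ladderCrystal (hℓ : 3 ≤ ℓ) : IsCrystal (ladderCrystal ℓ) :=
  ((isReading_ladderReading hℓ).isCrystal hℓ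
    (fun _ _ hx _ h => (mem_node_ladderCrystal hℓ).2
      (((mem_node_ladderCrystal hℓ).1 hx).removeGood hℓ h))
    (fun _ _ hx _ h => (mem_node_ladderCrystal hℓ).2
      (((mem_node_ladderCrystal hℓ).1 hx).addCogood hℓ h))).2

theorem isCrystal_misraMiwaCrystal (hℓ : 3 ≤ ℓ) : IsCrystal (misraMiwaCrystal ℓ) :=
  (isReading_rowReading.isCrystal hℓ
    (fun _ _ hx _ h => IsRegular.removeGood hℓ hx h)
    (fun _ _ hx _ h => IsRegular.addCogood hℓ hx h)).2

theorem deregularization_regularization (hℓ : 3 ≤ ℓ) {μ : YoungDiagram} (hμ : IsTight ℓ μ) :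
    deregularization ℓ (regularization ℓ hℓ μ) = some μ :=
  hμ.deregularization_eq hℓ (isRegular_regularization hℓ) (sameLadders_regularization hℓ)

/-- Deregularization recovers a tight partition, which gives injectivity; `IsRegular.exists_isTight`
gives surjectivity. -/
theorem isCrystalIso_regularization (hℓ : 3 ≤ ℓ) :
    IsCrystalIso (ladderCrystal ℓ) (misraMiwaCrystal ℓ) (regularization ℓ hℓ) where
  bijOn := by
    refine ⟨fun μ _ => isRegular_regularization hℓ, ?_, ?_⟩
    · intro μ hμ ν hν h
      have h1 := deregularization_regularization hℓ ((mem_node_ladderCrystal hℓ).1 hμ)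
      have h2 := deregularization_regularization hℓ ((mem_node_ladderCrystal hℓ).1 hν)
      rw [h, h2] at h1
      exact (Option.some_inj.1 h1).symm
    · intro μ hμ
      obtain ⟨ν, hν, h⟩ := IsRegular.exists_isTight hℓ hμ
      exact ⟨ν, (mem_node_ladderCrystal hℓ).2 hν, h⟩
  map_e := fun _ _ hμ => ((mem_node_ladderCrystal hℓ).1 hμ).map_removeGood hℓ
  map_f := fun _ _ hμ => ((mem_node_ladderCrystal hℓ).1 hμ).map_addCogood hℓ
  map_ε := fun i _ hμ => by
    have h := congrArg List.length (((mem_node_ladderCrystal hℓ).1 hμ).map_boxes_eq i hℓ).2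
    rw [List.length_map, List.length_map] at h
    exact h.symm
  map_φ := fun i _ hμ => by
    have h := congrArg List.length (((mem_node_ladderCrystal hℓ).1 hμ).map_boxes_eq i hℓ).1
    rw [List.length_map, List.length_map] at h
    exact h.symm
  map_wt := fun _ _ => weight_regularization hℓ

theorem IsCrystalIso.of_invOn {C D : CrystalData ℓ} {Ψ Φ : YoungDiagram → YoungDiagram}
    (h : IsCrystalIso C D Ψ) (hC : IsCrystal C) (hinv : Set.InvOn Φ Ψ C.node D.node) :
    IsCrystalIso D C Φ := by
  have hpre : ∀ y ∈ D.node, Φ y ∈ C.node ∧ Ψ (Φ y) = y := by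
    intro y hy
    obtain ⟨x, hx, rfl⟩ := h.bijOn.surjOn hy
    rw [hinv.1 hx]
    exact ⟨hx, rfl⟩
  have hmap : ∀ o : Option YoungDiagram, (∀ x, o = some x → x ∈ C.node) →
      (o.map Ψ).map Φ = o := by
    rintro (_ | x) hx
    · rfl
    · exact congrArg some (hinv.1 (hx x rfl))
  refine ⟨hinv.symm.bijOn (fun y hy => (hpre y hy).1) h.bijOn.mapsTo, ?_, ?_, ?_, ?_, ?_⟩
  · intro i y hy
    obtain ⟨hx, hΨ⟩ := hpre y hy
    have := h.map_e i _ hx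
    rw [hΨ] at this
    rw [← this, hmap _ (hC.e_mem i _ hx)]
  · intro i y hy
    obtain ⟨hx, hΨ⟩ := hpre y hy
    have := h.map_f i _ hx
    rw [hΨ] at this
    rw [← this, hmap _ (hC.f_mem i _ hx)]
  · intro i y hy
    obtain ⟨hx, hΨ⟩ := hpre y hy
    rw [← h.map_ε i _ hx, hΨ]
  · intro i y hy
    obtain ⟨hx, hΨ⟩ := hpre y hy
    rw [← h.map_φ i _ hx, hΨ]
  · intro y hy
    obtain ⟨hx, hΨ⟩ := hpre y hy
    rw [← h.map_wt _ hx, hΨ]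

end Main

end LadderCrystal

theorem mainTheorem1 (ℓ : ℕ) (hℓ : 3 ≤ ℓ) :
    (∀ i : ZMod ℓ, ∀ μ ∈ (LadderCrystal.ladderCrystal ℓ).node,
      ((LadderCrystal.ladderCrystal ℓ).f i μ).map (LadderCrystal.regularization ℓ hℓ) =
        (LadderCrystal.misraMiwaCrystal ℓ).f i (LadderCrystal.regularization ℓ hℓ μ)) ∧
    (∀ i : ZMod ℓ, ∀ μ ∈ (LadderCrystal.ladderCrystal ℓ).node,
      ((LadderCrystal.ladderCrystal ℓ).e i μ).map (LadderCrystal.regularization ℓ hℓ) =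
        (LadderCrystal.misraMiwaCrystal ℓ).e i (LadderCrystal.regularization ℓ hℓ μ)) ∧
    LadderCrystal.IsCrystal (LadderCrystal.ladderCrystal ℓ) ∧
    LadderCrystal.IsCrystal (LadderCrystal.misraMiwaCrystal ℓ) ∧
    LadderCrystal.IsCrystalIso (LadderCrystal.ladderCrystal ℓ)
      (LadderCrystal.misraMiwaCrystal ℓ) (LadderCrystal.regularization ℓ hℓ) ∧
    ∃ S : YoungDiagram → YoungDiagram,
      (∀ μ ∈ (LadderCrystal.misraMiwaCrystal ℓ).node,
        LadderCrystal.deregularization ℓ μ = some (S μ)) ∧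
      LadderCrystal.IsCrystalIso (LadderCrystal.misraMiwaCrystal ℓ)
        (LadderCrystal.ladderCrystal ℓ) S ∧
      Set.InvOn S (LadderCrystal.regularization ℓ hℓ)
        (LadderCrystal.ladderCrystal ℓ).node (LadderCrystal.misraMiwaCrystal ℓ).node := by
  have hiso := LadderCrystal.isCrystalIso_regularization hℓ
  have hcrys := LadderCrystal.isCrystal_ladderCrystal hℓ
  have hpre : ∀ μ ∈ (LadderCrystal.misraMiwaCrystal ℓ).node,
      ∃ ν ∈ (LadderCrystal.ladderCrystal ℓ).node, LadderCrystal.regularization ℓ hℓ ν = μ :=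
    fun _ hμ => hiso.bijOn.surjOn hμ
  have hS : ∀ ν ∈ (LadderCrystal.ladderCrystal ℓ).node,
      LadderCrystal.deregularization ℓ (LadderCrystal.regularization ℓ hℓ ν) = some ν :=
    fun _ hν => LadderCrystal.deregularization_regularization hℓ
      ((LadderCrystal.mem_node_ladderCrystal hℓ).1 hν)
  -- The default value `⊥` never occurs on nodes: each regular partition is the regularization of a
  -- tight one, where deregularization is defined.
  have hinv : Set.InvOn (fun μ => (LadderCrystal.deregularization ℓ μ).getD ⊥)
      (LadderCrystal.regularization ℓ hℓ) (LadderCrystal.ladderCrystal ℓ).node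
      (LadderCrystal.misraMiwaCrystal ℓ).node := by
    constructor
    · intro ν hν
      simp only [hS ν hν, Option.getD_some]
    · intro μ hμ
      obtain ⟨ν, hν, rfl⟩ := hpre μ hμ
      simp only [hS ν hν, Option.getD_some]
  refine ⟨fun i μ hμ => hiso.map_f i μ hμ, fun i μ hμ => hiso.map_e i μ hμ, hcrys,
    LadderCrystal.isCrystal_misraMiwaCrystal hℓ, hiso, _, ?_, hiso.of_invOn hcrys hinv, hinv⟩
  intro μ hμ
  obtain ⟨ν, hν, rfl⟩ := hpre μ hμ
  simp only [hS ν hν, Option.getD_some]
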